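/- Let $\mathcal A=(Q,E,\Sigma,s,F)$ be a finite automaton with a finite set $Q$ of states, a finite totally ordered alphabet $\Sigma$, edges $E\subseteq Q\times Q\times\Sigma$, initial state $s$ and set $F$ of final states. Assume, as always below, that every character labels an edge, all edges reaching the same state have the same label, every state is reachable from $s$, $s$ has no incoming edges, and from every state a final state can be reached. $\mathcal A$ is a DFA if every state has at most one outgoing edge with a given label. Let $\lambda(v)$ be the label of the edges reaching $v\neq s$, and let $\lambda(s)=\#$ be smaller than every character. A co-lexicographic order of $\mathcal A$ is a partial order $\le$ on $Q$ such that (1) $\lambda(u)<\lambda(v)$ implies $u<v$, and (2) if there are edges from $u'$ to $u$ and from $v'$ to $v$, $\lambda(u)=\lambda(v)$ and $u<v$, then $u'\le v'$. It is maximal if no other co-lexicographic order contains it. A $\le$-chain decomposition is a partition of $Q$ into $\le$-chains. The co-lexicographic width $\bar p$ of $\mathcal A$ is the smallest $p$ for which some co-lexicographic order $\le$ of $\mathcal A$ has a $\le$-chain decomposition $\{Q_i\}_{i=1}^p$. Every DFA has a unique maximal co-lexicographic order $\le$. In the word RAM model with words of at least $\kappa\,(\lfloor\log_2|Q|\rfloor+1)$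 bits, for a suitable constant $\kappa$, there is an algorithm that on input a DFA $\mathcal A$ computes this order $\le$ (as a $|Q|\times|Q|$ Boolean matrix) together with a smallest $\le$-chain decomposition $\{Q_i\}_{i=1}^{\bar p}$, which has exactly $\bar p$ chains, in time $O(|E|^2+|Q|^{5/2})$. Hence DFAs can be indexed with optimal width in polynomial time: there is an algorithm in the same model that on input a DFA $\mathcal A$ computes, in time polynomial in $|Q|+|E|$, the Burrows-Wheeler transform of $(\mathcal A,\le,\{Q_i\}_{i=1}^{\bar p})$, where $\le$ is the maximal co-lexicographic order and $\{Q_i\}_{i=1}^{\bar p}$ is a smallest $\le$-chain decomposition with $s\in Q_1$. Here, with $\pi(v)=i$ for $v\in Q_i$ and with the states listed as $v_1,\dots,v_n$ by increasing $\pi$ and, within a chain, by $\le$, the Burrows-Wheeler transform is the triple of sequences $(\mathtt{OUT},\mathtt{IN},\mathtt{FINAL})$ in which $\mathtt{OUT}[i]$ lists the pairs $(\pi(u),c)$ for all edges $(v_i,u,c)\in E$, $\mathtt{IN}[i]$ lists $\pi(w)$ for all edges $(w,v_i,c)\in E$, and $\mathtt{FINAL}[i]$ says whether $v_i\in F$.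 -/

import Mathlib

namespace CoLex

/- ## The word RAM

A word is an element of `BitVec w`.  A program has finitely many registers (those it mentions) and
a random access memory whose addresses are words.  Arithmetic is modulo `2 ^ w`.  Control flow is
written in structured form; every instruction and every evaluation of a test costs one step. -/

/-- The binary operations on words that cost one step (all unsigned, modulo `2 ^ w`). -/
inductive Op
  | add | sub | mul | div | mod | and | or | xor | shl | shr

def Op.eval {w : ℕ} : Op → BitVec w → BitVec w → BitVec w
  | .add, x, y => x + y
  | .sub, x, y => x - y
  | .mul, x, y => x * y
  | .div, x, y => x / y
  | .mod, x, y => x % y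
  | .and, x, y => x &&& y
  | .or, x, y => x ||| y
  | .xor, x, y => x ^^^ y
  | .shl, x, y => x <<< y
  | .shr, x, y => x >>> y

/-- The instructions.  Natural numbers name registers, except for the constant `k`. -/
inductive Instr
  /-- register `d` gets the constant `k` -/
  | const (d k : ℕ)
  /-- register `d` gets the result of `o` on the registers `a` and `b` -/
  | bin (o : Op) (d a b : ℕ)
  /-- register `d` gets the memory cell whose address is in register `a` -/
  | load (d a : ℕ)
  /-- the memory cell whose address is in register `a` gets the value of register `b` -/
  | store (a b : ℕ)

/-- Comparisons of two registers, as unsigned numbers. -/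
inductive Test
  | lt (a b : ℕ)
  | le (a b : ℕ)
  | eq (a b : ℕ)
  | ne (a b : ℕ)

/-- Programs.  They do not depend on the word size. -/
inductive Prog
  | skip
  | instr (i : Instr)
  | seq (P R : Prog)
  | ite (b : Test) (P R : Prog)
  | while (b : Test) (P : Prog)

/-- A state of the machine with word size `w`. -/
structure State (w : ℕ) where
  reg : ℕ → BitVec w
  mem : BitVec w → BitVec w

def Instr.exec {w : ℕ} : Instr → State w → State w
  | .const d k, c => { c with reg := Function.update c.reg d (BitVec.ofNat w k) }
  | .bin o d a b, c => { c with reg := Function.update c.reg d (o.eval (c.reg a) (c.reg b)) }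
  | .load d a, c => { c with reg := Function.update c.reg d (c.mem (c.reg a)) }
  | .store a b, c => { c with mem := Function.update c.mem (c.reg a) (c.reg b) }

def Test.Holds {w : ℕ} : Test → State w → Prop
  | .lt a b, c => (c.reg a).toNat < (c.reg b).toNat
  | .le a b, c => (c.reg a).toNat ≤ (c.reg b).toNat
  | .eq a b, c => c.reg a = c.reg b
  | .ne a b, c => c.reg a ≠ c.reg b

/-- `Exec P c t d`: started in the state `c`, the program `P` terminates in the state `d` after
exactly `t` steps. -/
inductive Exec {w : ℕ} : Prog → State w → ℕ → State w → Prop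
  | skip (c : State w) : Exec .skip c 1 c
  | instr (i : Instr) (c : State w) : Exec (.instr i) c 1 (i.exec c)
  | seq {P R : Prog} {c d e : State w} {t r : ℕ} :
      Exec P c t d → Exec R d r e → Exec (.seq P R) c (t + r) e
  | ite_true {b : Test} {P R : Prog} {c d : State w} {t : ℕ} :
      b.Holds c → Exec P c t d → Exec (.ite b P R) c (t + 1) d
  | ite_false {b : Test} {P R : Prog} {c d : State w} {t : ℕ} :
      ¬ b.Holds c → Exec R c t d → Exec (.ite b P R) c (t + 1) d
  | while_true {b : Test} {P : Prog} {c d e : State w} {t r : ℕ} :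
      b.Holds c → Exec P c t d → Exec (.while b P) d r e → Exec (.while b P) c (t + r + 1) e
  | while_false {b : Test} {P : Prog} {c : State w} :
      ¬ b.Holds c → Exec (.while b P) c 1 c

/-- The initial state: the input is in the memory from address `0` on, and all other cells and all
registers are `0`. -/
def State.init (w : ℕ) (input : List ℕ) : State w where
  reg := fun _ => 0
  mem := fun a => BitVec.ofNat w (input.getD a.toNat 0)

/-- The list `output` is in the memory from the address in register `0` on. -/
def State.Outputs {w : ℕ} (c : State w) (output : List ℕ) : Prop :=
  (c.reg 0).toNat + output.length ≤ 2 ^ w ∧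
    ∀ (i : ℕ) (h : i < output.length),
      (c.mem (BitVec.ofNat w ((c.reg 0).toNat + i))).toNat = output[i]

/-- On the machine with word size `w` and on the given input, `P` terminates after exactly `t`
steps with the given output. -/
def Prog.Computes (P : Prog) (w : ℕ) (input : List ℕ) (t : ℕ) (output : List ℕ) : Prop :=
  ∃ c : State w, Exec P (State.init w input) t c ∧ c.Outputs output

/- ## Finite automata -/

/-- A finite automaton; `(u, v, a) ∈ E` is an edge from `u` to `v` with label `a`. -/
structure Automaton (Q α : Type*) where
  E : Finset (Q × Q × α)
  s : Q
  F : Finset Q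

namespace Automaton

variable {Q α : Type*} (M : Automaton Q α)

/-- There is an edge from `u` to `v`. -/
def Edge (u v : Q) : Prop := ∃ a, (u, v, a) ∈ M.E

/-- The standing assumptions on an NFA. -/
structure IsStandard : Prop where
  /-- the alphabet is effective -/
  effective : ∀ a : α, ∃ u v, (u, v, a) ∈ M.E
  /-- all edges reaching the same state have the same label -/
  input_consistent : ∀ u u₁ v a a₁, (u, v, a) ∈ M.E → (u₁, v, a₁) ∈ M.E → a = a₁
  /-- every state is reachable from the initial state -/
  reachable : ∀ u, Relation.ReflTransGen M.Edge M.s u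
  /-- the initial state has no incoming edges -/
  no_incoming : ∀ u, ¬ M.Edge u M.s
  /-- every state is final or allows to reach a final state -/
  coreachable : ∀ u, ∃ f ∈ M.F, Relation.ReflTransGen M.Edge u f

/-- Every state has at most one outgoing edge with a given label. -/
def IsDeterministic : Prop :=
  ∀ u v v₁ a, (u, v, a) ∈ M.E → (u, v₁, a) ∈ M.E → v = v₁

open Classical in
/-- The label `λ(v)` of the edges reaching `v`; it is `⊥`, smaller than every character, if there
are none (that is, for the initial state). -/
noncomputable def lam (v : Q) : WithBot α :=
  if h : ∃ a u, (u, v, a) ∈ M.E then (h.choose : WithBot α) else ⊥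

section Order

variable [LinearOrder α]

/-- Co-lexicographic orders. -/
structure IsCoLex (le : Q → Q → Prop) : Prop where
  refl : ∀ u, le u u
  antisymm : ∀ u v, le u v → le v u → u = v
  trans : ∀ u v z, le u v → le v z → le u z
  axiom_one : ∀ u v, M.lam u < M.lam v → le u v ∧ u ≠ v
  axiom_two : ∀ u₁ u v₁ v, M.Edge u₁ u → M.Edge v₁ v → M.lam u = M.lam v →
    le u v → u ≠ v → le u₁ v₁

/-- Co-lexicographic orders whose only refinement (by a co-lexicographic order) is the order
itself. -/
def IsMaximalCoLex (le : Q → Q → Prop) : Prop :=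
  M.IsCoLex le ∧
    ∀ le₁ : Q → Q → Prop, M.IsCoLex le₁ → (∀ u v, le u v → le₁ u v) → le₁ = le

end Order

end Automaton

/-- A partition of `Q` into `p` (nonempty) chains, given by the function that maps a state to the
index of its chain. -/
def IsChainDecomposition {Q : Type*} (le : Q → Q → Prop) {p : ℕ} (chain : Q → Fin p) : Prop :=
  Function.Surjective chain ∧ ∀ i, IsChain le {v | chain v = i}

/-- A chain decomposition with the smallest number of chains. -/
def IsSmallestChainDecomposition {Q : Type*} (le : Q → Q → Prop) {p : ℕ} (chain : Q → Fin p) :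
    Prop :=
  IsChainDecomposition le chain ∧
    ∀ (r : ℕ) (chain₁ : Q → Fin r), IsChainDecomposition le chain₁ → p ≤ r

namespace Automaton

section Width

variable {Q α : Type*} [LinearOrder α] (M : Automaton Q α)

/-- `M` is `p`-sortable. -/
def Sortable (p : ℕ) : Prop :=
  ∃ le : Q → Q → Prop, M.IsCoLex le ∧ ∃ chain : Q → Fin p, IsChainDecomposition le chain

/-- The co-lexicographic width. -/
noncomputable def width : ℕ := sInf {p | M.Sortable p}

end Width

end Automaton

/- ## Inputs and outputs -/

section Coding

variable {Q α : Type*} [Fintype Q] [Fintype α] [LinearOrder α]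

/-- A character is represented by its rank in the alphabet, so by a number below `|α|`. -/
def rank (a : α) : ℕ := (Finset.univ.filter fun b : α => b < a).card

/-- The choices made when an automaton is written down: a numbering of the states and a list of the
edges, in an arbitrary order and without repetitions. -/
structure Presentation (M : Automaton Q α) where
  idx : Q ≃ Fin (Fintype.card Q)
  edges : List (Q × Q × α)
  nodup : edges.Nodup
  mem_edges : ∀ e, e ∈ edges ↔ e ∈ M.E

open Classical in
/-- The input: `|Q|`, `|E|`, `|α|`, the initial state; the edges, as triples; for every state a
bit that says whether it is final. -/
noncomputable def Presentation.code {M : Automaton Q α} (D : Presentation M) : List ℕ :=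
  [Fintype.card Q, M.E.card, Fintype.card α, (D.idx M.s : ℕ)]
    ++ D.edges.flatMap (fun e => [(D.idx e.1 : ℕ), (D.idx e.2.1 : ℕ), rank e.2.2])
    ++ List.ofFn (fun i => if D.idx.symm i ∈ M.F then 1 else 0)

open Classical in
/-- A relation on the states as a list of `|Q| ^ 2` bits, in row-major order. -/
noncomputable def Presentation.codeRel {M : Automaton Q α} (D : Presentation M)
    (le : Q → Q → Prop) : List ℕ :=
  (List.ofFn fun i => List.ofFn fun j =>
    if le (D.idx.symm i) (D.idx.symm j) then 1 else 0).flatten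

/-- A chain decomposition as the number of chains and, for every state, the index of its chain. -/
def Presentation.codeChain {M : Automaton Q α} (D : Presentation M) {p : ℕ}
    (chain : Q → Fin p) : List ℕ :=
  p :: List.ofFn (fun i => (chain (D.idx.symm i) : ℕ))

end Coding

/- ## The index -/

/-- Three sequences of length `n`: lists of pairs (chain, character), lists of chains, bits. -/
structure BWT (n p : ℕ) (α : Type*) where
  outs : Fin n → List (Fin p × α)
  ins : Fin n → List (Fin p)
  final : Fin n → Bool

open Classical in
/-- `B` is the Burrows-Wheeler transform of `M`, the order `le` and the chain decomposition `chain`.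
The states are listed as `v 0, v 1, …` by chain, and by `le` within a chain.  Entry `i` holds one
pair (chain of the target, label) for every edge leaving `v i`, the chain of the source of every
edge reaching `v i`, and whether `v i` is final. -/
def BWT.IsOf {Q α : Type*} [Fintype Q] {p : ℕ} (B : BWT (Fintype.card Q) p α)
    (M : Automaton Q α) (le : Q → Q → Prop) (chain : Q → Fin p) : Prop :=
  ∃ v : Fin (Fintype.card Q) ≃ Q,
    (∀ i j, i < j → chain (v i) < chain (v j) ∨
      (chain (v i) = chain (v j) ∧ le (v i) (v j) ∧ v i ≠ v j)) ∧
    ∀ i,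
      (B.outs i : Multiset (Fin p × α)) =
        (M.E.filter fun e => e.1 = v i).val.map (fun e => (chain e.2.1, e.2.2)) ∧
      (B.ins i : Multiset (Fin p)) =
        (M.E.filter fun e => e.2.1 = v i).val.map (fun e => chain e.1) ∧
      (B.final i = true ↔ v i ∈ M.F)

/-- The three sequences one after the other, every list preceded by its length. -/
def BWT.code {n p : ℕ} {α : Type*} [Fintype α] [LinearOrder α] (B : BWT n p α) : List ℕ :=
  p :: ((List.ofFn B.outs).flatMap
      (fun l => l.length :: l.flatMap (fun x => [(x.1 : ℕ), rank x.2]))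
    ++ (List.ofFn B.ins).flatMap (fun l => l.length :: l.map (fun j => (j : ℕ)))
    ++ List.ofFn (fun i => (B.final i).toNat))

end CoLex

/-!
The axioms rule out `u < v` in every co-lexicographic order if `λ(v) < λ(u)`, or if edges with
equally labelled targets lead to `u` and `v` from states `u'` and `v'` with `u' = v'` (where
determinism is used) or for which `u' < v'` is already ruled out. The relation of all pairs that are
not ruled out is an interval order and satisfies the axioms, so it contains every co-lexicographic
order and is the only maximal one. The pairs that are ruled out are found by a graph search with at
most `|Q|²` vertices and `|E|²` arrows.

In an interval order the sets of predecessors are linearly ordered by inclusion. Take the states by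
increasing number of predecessors and put each of them on top of a chain whose top is below it, if
there is one. When there is none, the tops of all chains and the new state form an antichain,
because a top has at most as many predecessors as the new state. Hence the greedy decomposition is
smallest, and its size is the width. This needs no matching and takes `O(|E|² + |Q|²)` steps.

The algorithms are written in a small language with arrays, whose statements are compiled to the
word RAM. All variables and array cells stay below `B = 4(|Q| + |E| + 4)²`, and `B ^ 16` is bounded
by a power of `|Q| + 1`, hence by `2 ^ w`.
-/

namespace CoLex

theorem IsChainDecomposition.mono {Q : Type*} {le le' : Q → Q → Prop} {p : ℕ} {chain : Q → Fin p}
    (h : IsChainDecomposition le chain) (hle : ∀ u v, le u v → le' u v) :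
    IsChainDecomposition le' chain :=
  ⟨h.1, fun i _ hu _ hv huv => (h.2 i hu hv huv).imp (hle _ _) (hle _ _)⟩

theorem IsChainDecomposition.le_of_antichain {Q : Type*} {le : Q → Q → Prop} {p r : ℕ}
    {chain : Q → Fin r} (h : IsChainDecomposition le chain) {f : Fin p → Q}
    (hf : Pairwise fun i j => f i ≠ f j ∧ ¬ le (f i) (f j)) : p ≤ r := by
  have hinj : Function.Injective (chain ∘ f) := by
    intro i j hij
    by_contra hne
    exact (h.2 (chain (f i)) rfl hij.symm (hf hne).1).elim (hf hne).2 (hf (Ne.symm hne)).2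
  simpa using Fintype.card_le_of_injective _ hinj

theorem IsChainDecomposition.isSmallest_of_antichain {Q : Type*} {le : Q → Q → Prop} {p : ℕ}
    {chain : Q → Fin p} (h : IsChainDecomposition le chain) {f : Fin p → Q}
    (hf : Pairwise fun i j => f i ≠ f j ∧ ¬ le (f i) (f j)) :
    IsSmallestChainDecomposition le chain :=
  ⟨h, fun _ _ h' => h'.le_of_antichain hf⟩

namespace Automaton

variable {Q α : Type*} {M : Automaton Q α}

theorem IsStandard.lam_eq (hM : M.IsStandard) {u v : Q} {a : α} (h : (u, v, a) ∈ M.E) :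
    M.lam v = a := by
  have hex : ∃ a u, (u, v, a) ∈ M.E := ⟨a, u, h⟩
  obtain ⟨u', hu'⟩ := hex.choose_spec
  rw [lam, dif_pos hex, hM.input_consistent _ _ _ _ _ hu' h]

theorem IsStandard.lam_s (hM : M.IsStandard) : M.lam M.s = ⊥ := by
  rw [lam, dif_neg]
  rintro ⟨a, u, h⟩
  exact hM.no_incoming u ⟨a, h⟩

theorem IsStandard.exists_edge (hM : M.IsStandard) {v : Q} (hv : v ≠ M.s) : ∃ u, M.Edge u v := by
  rcases Relation.ReflTransGen.cases_tail (hM.reachable v) with h | ⟨u, -, h⟩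
  · exact absurd h hv
  · exact ⟨u, h⟩

theorem IsStandard.exists_edge_of_lam_eq (hM : M.IsStandard) {u u' v : Q} (h : M.Edge u' u)
    (huv : M.lam u = M.lam v) : ∃ v', M.Edge v' v := by
  refine hM.exists_edge ?_
  rintro rfl
  obtain ⟨a, ha⟩ := h
  rw [hM.lam_s, hM.lam_eq ha] at huv
  exact WithBot.coe_ne_bot huv

theorem IsStandard.lam_s_lt [LinearOrder α] (hM : M.IsStandard) {v : Q} (hv : v ≠ M.s) :
    M.lam M.s < M.lam v := by
  obtain ⟨u, a, h⟩ := hM.exists_edge hv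
  rw [hM.lam_s, hM.lam_eq h]
  exact WithBot.bot_lt_coe a

section Order

variable [LinearOrder α]

/-- The pairs `(u, v)` for which the axioms of co-lexicographic orders of a DFA rule out `u < v`:
an order in which `u < v` would, by the second axiom, relate all pairs of states reached by going
backwards along equally labelled edges. -/
inductive NotBelow (M : Automaton Q α) : Q → Q → Prop
  | refl (u : Q) : NotBelow M u u
  | lam {u v : Q} : M.lam v < M.lam u → NotBelow M u v
  | step {u' u v' v : Q} : M.Edge u' u → M.Edge v' v → M.lam u = M.lam v →
      NotBelow M u' v' → NotBelow M u v

/-- The maximal co-lexicographic order of a DFA. -/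
def maxOrder (M : Automaton Q α) (u v : Q) : Prop := u = v ∨ ¬ M.NotBelow u v

theorem NotBelow.lam_le {u v : Q} (h : M.NotBelow u v) : M.lam v ≤ M.lam u := by
  cases h with
  | refl => exact le_rfl
  | lam h => exact h.le
  | step _ _ h _ => exact h.ge

theorem NotBelow.total (hM : M.IsStandard) (u v : Q) : M.NotBelow u v ∨ M.NotBelow v u := by
  induction hM.reachable u generalizing v with
  | refl =>
    by_cases hv : v = M.s
    · exact Or.inl (hv ▸ .refl _)
    · exact Or.inr (.lam (hM.lam_s_lt hv))
  | @tail u' u _ hu ih =>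
    rcases lt_trichotomy (M.lam u) (M.lam v) with h | h | h
    · exact Or.inr (.lam h)
    · obtain ⟨v', hv⟩ := hM.exists_edge_of_lam_eq hu h
      exact (ih v').imp (.step hu hv h) (.step hv hu h.symm)
    · exact Or.inl (.lam h)

theorem NotBelow.cotrans (hM : M.IsStandard) {u z : Q} (h : M.NotBelow u z) (v : Q) :
    M.NotBelow u v ∨ M.NotBelow v z := by
  induction h generalizing v with
  | refl u => exact NotBelow.total hM u v
  | @lam u z h =>
    rcases lt_or_ge (M.lam v) (M.lam u) with hv | hv
    · exact Or.inl (.lam hv)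
    · exact Or.inr (.lam (h.trans_le hv))
  | @step u' u z' z hu hz h _ ih =>
    rcases lt_trichotomy (M.lam u) (M.lam v) with huv | huv | huv
    · exact Or.inr (.lam (h ▸ huv))
    · obtain ⟨v', hv⟩ := hM.exists_edge_of_lam_eq hu huv
      exact (ih v').imp (.step hu hv huv) (.step hv hz (huv.symm.trans h))
    · exact Or.inl (.lam huv)

theorem NotBelow.interval (hM : M.IsStandard) {u y : Q} (h : M.NotBelow u y) {x v : Q}
    (h' : M.NotBelow x v) : M.NotBelow u v ∨ M.NotBelow x y := by
  induction h generalizing x v with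
  | refl u => exact (h'.cotrans hM u).symm
  | @lam u y h =>
    rcases lt_or_ge (M.lam v) (M.lam u) with hvu | hvu
    · exact Or.inl (.lam hvu)
    · exact Or.inr (.lam (h.trans_le (hvu.trans h'.lam_le)))
  | @step u' u y' y hu hy huy h ih =>
    rcases lt_or_ge (M.lam v) (M.lam u) with hvu | hvu
    · exact Or.inl (.lam hvu)
    rcases lt_or_ge (M.lam y) (M.lam x) with hyx | hyx
    · exact Or.inr (.lam hyx)
    have huv : M.lam u = M.lam v := le_antisymm hvu (h'.lam_le.trans (hyx.trans huy.ge))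
    have hxy : M.lam x = M.lam y := le_antisymm hyx (huy ▸ hvu.trans h'.lam_le)
    cases h' with
    | refl => exact (NotBelow.step hu hy huy h).cotrans hM x
    | lam hvx => exact absurd hvx (not_lt.2 (hyx.trans (huy ▸ hvu)))
    | step hx hv _ hx'v' => exact (ih hx'v').imp (.step hu hv huv) (.step hx hy hxy)

theorem maxOrder_antisymm (hM : M.IsStandard) {u v : Q} (h : M.maxOrder u v)
    (h' : M.maxOrder v u) : u = v := by
  by_contra hne
  exact (NotBelow.total hM u v).elim (h.resolve_left hne) (h'.resolve_left (Ne.symm hne))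

theorem maxOrder_isCoLex (hM : M.IsStandard) : M.IsCoLex M.maxOrder where
  refl u := Or.inl rfl
  antisymm u v := maxOrder_antisymm hM
  trans u v z := by
    rintro (rfl | h) (rfl | h')
    · exact Or.inl rfl
    · exact Or.inr h'
    · exact Or.inr h
    · exact Or.inr fun hnot => (hnot.cotrans hM v).elim h h'
  axiom_one u v h := ⟨Or.inr fun h' => absurd h'.lam_le (not_le.2 h), fun h' => h.ne (h' ▸ rfl)⟩
  axiom_two u₁ u v₁ v hu hv hl h hne := Or.inr fun h' => h.resolve_left hne (.step hu hv hl h')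

theorem IsCoLex.le_maxOrder (hM : M.IsStandard) (hD : M.IsDeterministic) {le : Q → Q → Prop}
    (h : M.IsCoLex le) {u v : Q} (huv : le u v) : M.maxOrder u v := by
  by_cases hne : u = v
  · exact Or.inl hne
  · refine Or.inr fun hnot => ?_
    induction hnot with
    | refl => exact hne rfl
    | lam hlam => exact hne (h.antisymm _ _ huv (h.axiom_one _ _ hlam).1)
    | step hu hv hl _ ih =>
      refine ih (h.axiom_two _ _ _ _ hu hv hl huv hne) ?_
      -- Distinct states with equal labels have distinct predecessors: `M` is deterministic.
      rintro rfl
      obtain ⟨a, ha⟩ := hu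
      obtain ⟨b, hb⟩ := hv
      rw [hM.lam_eq ha, hM.lam_eq hb, WithBot.coe_inj] at hl
      exact hne (hD _ _ _ _ ha (hl ▸ hb))

theorem maxOrder_isMaximalCoLex (hM : M.IsStandard) (hD : M.IsDeterministic) :
    M.IsMaximalCoLex M.maxOrder := by
  refine ⟨maxOrder_isCoLex hM, fun le h h' => ?_⟩
  ext u v
  exact ⟨h.le_maxOrder hM hD, h' u v⟩

theorem IsMaximalCoLex.eq_maxOrder (hM : M.IsStandard) (hD : M.IsDeterministic)
    {le : Q → Q → Prop} (h : M.IsMaximalCoLex le) : le = M.maxOrder :=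
  (h.2 _ (maxOrder_isCoLex hM) fun _ _ => h.1.le_maxOrder hM hD).symm

theorem width_eq_of_isSmallestChainDecomposition (hM : M.IsStandard) (hD : M.IsDeterministic)
    {p : ℕ} {chain : Q → Fin p} (hC : IsSmallestChainDecomposition M.maxOrder chain) :
    M.width = p := by
  have hsort : M.Sortable p := ⟨_, maxOrder_isCoLex hM, chain, hC.1⟩
  refine le_antisymm (Nat.sInf_le hsort) (le_csInf ⟨p, hsort⟩ ?_)
  rintro r ⟨le, hle, chain', h⟩
  exact hC.2 r chain' (h.mono fun _ _ => hle.le_maxOrder hM hD)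

end Order

end Automaton

/-- An interval order on the natural numbers in which all numbers with a successor are below `n`:
states are identified with their numbers. -/
structure IntervalOrder (n : ℕ) (lt : ℕ → ℕ → Prop) : Prop where
  left_lt : ∀ u v, lt u v → u < n
  irrefl : ∀ u, ¬ lt u u
  interval : ∀ u v x y, lt u v → lt x y → lt u y ∨ lt x v

open Classical in
/-- The number of predecessors of `v` below `n`. Sorting by it extends an interval order. -/
noncomputable def numPreds (n : ℕ) (lt : ℕ → ℕ → Prop) (v : ℕ) : ℕ :=
  ((Finset.range n).filter fun u => lt u v).card

theorem numPreds_lt_numPreds {n u v z : ℕ} {lt : ℕ → ℕ → Prop} (hsub : ∀ x, lt x v → lt x z)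
    (hu : u < n) (huz : lt u z) (huv : ¬ lt u v) : numPreds n lt v < numPreds n lt z := by
  classical
  unfold numPreds
  refine Finset.card_lt_card (Finset.ssubset_iff_of_subset ?_ |>.2 ⟨u, ?_, ?_⟩)
  · exact Finset.monotone_filter_right _ fun x _ => hsub x
  · simpa [huz] using hu
  · simp [huv]

namespace IntervalOrder

variable {n : ℕ} {lt : ℕ → ℕ → Prop} (h : IntervalOrder n lt)
include h

theorem trans {u v z : ℕ} (huv : lt u v) (hvz : lt v z) : lt u z :=
  (h.interval _ _ _ _ huv hvz).resolve_right (h.irrefl v)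

theorem numPreds_lt_of_lt {u v : ℕ} (huv : lt u v) : numPreds n lt u < numPreds n lt v :=
  numPreds_lt_numPreds (fun _ hx => h.trans hx huv) (h.left_lt _ _ huv) huv (h.irrefl u)

theorem lt_of_numPreds_le {u v z : ℕ} (huv : lt u v) (hvz : numPreds n lt v ≤ numPreds n lt z) :
    lt u z := by
  by_contra huz
  exact absurd hvz (not_le.2 (numPreds_lt_numPreds
    (fun x hx => (h.interval _ _ _ _ hx huv).resolve_right huz) (h.left_lt _ _ huv) huv huz))

theorem numPreds_lt {v : ℕ} (hv : v < n) : numPreds n lt v < n := by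
  classical
  have hss : ((Finset.range n).filter fun u => lt u v) ⊂ Finset.range n :=
    Finset.filter_ssubset.2 ⟨v, Finset.mem_range.2 hv, h.irrefl v⟩
  simpa [numPreds] using Finset.card_lt_card hss

end IntervalOrder

/-- The first `k` values of `ord` are the numbers below `n` with the property `P`, in the order
given by `R`. -/
structure Listing (n : ℕ) (R : ℕ → ℕ → Prop) (P : ℕ → Prop) (k : ℕ) (ord : ℕ → ℕ) : Prop where
  ord_lt : ∀ i < k, ord i < n
  mono : ∀ i j, i < j → j < k → R (ord i) (ord j)
  mem : ∀ v < n, P v ↔ ∃ i < k, ord i = v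

namespace Listing

variable {n k : ℕ} {R : ℕ → ℕ → Prop} {P : ℕ → Prop} {ord : ℕ → ℕ}

theorem inj (hR : ∀ u, ¬ R u u) (h : Listing n R P k ord) {i j : ℕ} (hi : i < k) (hj : j < k)
    (hij : ord i = ord j) : i = j := by
  rcases lt_trichotomy i j with hlt | heq | hlt
  · exact absurd (hij ▸ h.mono i j hlt hj) (hR _)
  · exact heq
  · exact absurd (hij ▸ h.mono j i hlt hi) (hR _)

theorem le (hR : ∀ u, ¬ R u u) (h : Listing n R P k ord) : k ≤ n := by
  have hcard := Finset.card_le_card_of_injOn (s := Finset.range k) (t := Finset.range n)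
    ord (fun i hi => by simpa using h.ord_lt i (by simpa using hi))
    (fun i hi j hj hij => h.inj hR (by simpa using hi) (by simpa using hj) hij)
  simpa using hcard

theorem eq (hR : ∀ u, ¬ R u u) (h : Listing n R (fun _ => True) k ord) : k = n := by
  refine le_antisymm (h.le hR) ?_
  have hcard := Finset.card_le_card_of_surjOn (s := Finset.range k) (t := Finset.range n) ord
    (fun v hv => by
      obtain ⟨i, hi, hiv⟩ := (h.mem v (by simpa using hv)).1 trivial
      exact ⟨i, by simpa using hi, hiv⟩)
  simpa using hcard

theorem congr {P' : ℕ → Prop} (h : Listing n R P k ord) (hP : ∀ v < n, P' v ↔ P v) :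
    Listing n R P' k ord :=
  ⟨h.ord_lt, h.mono, fun v hv => (hP v hv).trans (h.mem v hv)⟩

theorem snoc {P' : ℕ → Prop} (h : Listing n R P k ord) {v : ℕ} (hv : v < n)
    (hP : ∀ u < n, P' u ↔ P u ∨ u = v) (hm : ∀ u < n, P u → R u v) :
    Listing n R P' (k + 1) (Function.update ord k v) := by
  have hlast : ∀ i < k, R (ord i) v := fun i hi =>
    hm _ (h.ord_lt i hi) ((h.mem _ (h.ord_lt i hi)).2 ⟨i, hi, rfl⟩)
  have hlt := h.ord_lt
  have hmono := h.mono
  constructor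
  · grind
  · grind
  · intro u hu
    rw [hP u hu, h.mem u hu]
    constructor
    · rintro (⟨i, hi, rfl⟩ | rfl)
      · exact ⟨i, by omega, Function.update_of_ne hi.ne _ _⟩
      · exact ⟨k, by omega, Function.update_self ..⟩
    · grind

end Listing

/-- Comparison by the number of predecessors, with ties broken by the numbering. -/
def PredLT (n : ℕ) (lt : ℕ → ℕ → Prop) (u v : ℕ) : Prop :=
  numPreds n lt u < numPreds n lt v ∨ (numPreds n lt u = numPreds n lt v ∧ u < v)

theorem PredLT.irrefl {n : ℕ} {lt : ℕ → ℕ → Prop} (u : ℕ) : ¬ PredLT n lt u u := by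
  simp [PredLT]

/-- The sequence `ord` lists the numbers below `n` by increasing number of predecessors. -/
abbrev Sorted (n : ℕ) (lt : ℕ → ℕ → Prop) (ord : ℕ → ℕ) : Prop :=
  Listing n (PredLT n lt) (fun _ => True) n ord

theorem Sorted.numPreds_le {n : ℕ} {lt : ℕ → ℕ → Prop} {ord : ℕ → ℕ} (h : Sorted n lt ord)
    {i j : ℕ} (hij : i ≤ j) (hj : j < n) : numPreds n lt (ord i) ≤ numPreds n lt (ord j) := by
  rcases hij.lt_or_eq with hij | rfl
  · have hlt := h.mono i j hij hj
    unfold PredLT at hlt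
    omega
  · exact le_rfl

/-- There are `p` pairwise incomparable numbers below `n`. -/
def HasAntichain (n : ℕ) (lt : ℕ → ℕ → Prop) (p : ℕ) : Prop :=
  ∃ f : ℕ → ℕ, (∀ c < p, f c < n) ∧
    ∀ c < p, ∀ c' < p, c ≠ c' → f c ≠ f c' ∧ ¬ lt (f c) (f c')

/-- The first `i` numbers in the list `ord` are distributed to `p` chains, along which `ord` is
increasing; the antichain shows that fewer chains do not suffice. -/
structure Chains (n : ℕ) (lt : ℕ → ℕ → Prop) (ord : ℕ → ℕ) (i p : ℕ) (chain : ℕ → ℕ) : Prop where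
  p_le : p ≤ i
  chain_lt : ∀ j < i, chain (ord j) < p
  asc : ∀ j j', j < j' → j' < i → chain (ord j) = chain (ord j') → lt (ord j) (ord j')
  first : 0 < i → chain (ord 0) = 0
  surj : ∀ c < p, ∃ j < i, chain (ord j) = c
  antichain : HasAntichain n lt p

/-- The value `top c` is the last of the first `i` numbers in the list `ord` that is in the
chain `c`. -/
def IsTop (ord : ℕ → ℕ) (i p : ℕ) (chain top : ℕ → ℕ) : Prop :=
  ∀ c < p, ∃ j < i, top c = ord j ∧ chain (ord j) = c ∧ ∀ j' < i, chain (ord j') = c → j' ≤ j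

section Greedy

variable {n : ℕ} {lt : ℕ → ℕ → Prop} {ord chain top : ℕ → ℕ} {i p r : ℕ}

theorem IsTop.append (hT : IsTop ord i p chain top) (hord : ∀ j < i, ord j ≠ ord i) (r : ℕ)
    {p' : ℕ} (hp' : ∀ c < p', c ≠ r → c < p) :
    IsTop ord (i + 1) p' (Function.update chain (ord i) r) (Function.update top r (ord i)) := by
  intro c hc
  by_cases hcr : c = r
  · exact ⟨i, by grind⟩
  · obtain ⟨j, hj, htop, hchain, hlast⟩ := hT c (hp' c hc hcr)
    exact ⟨j, by grind⟩

theorem Chains.append (hC : Chains n lt ord i p chain) (hord : ∀ j < i, ord j ≠ ord i)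
    (hr : r ≤ p) (hasc : ∀ j < i, chain (ord j) = r → lt (ord j) (ord i))
    (hanti : HasAntichain n lt (max p (r + 1))) :
    Chains n lt ord (i + 1) (max p (r + 1)) (Function.update chain (ord i) r) := by
  obtain ⟨hp, hlt, hmono, hfirst, hsurj, -⟩ := hC
  refine ⟨by omega, by grind, by grind, fun _ => ?_, fun c hc => ?_, hanti⟩
  · rcases i.eq_zero_or_pos with rfl | hi
    · rw [Function.update_self]
      omega
    · rw [Function.update_of_ne (hord 0 hi), hfirst hi]
  · rcases eq_or_ne c r with rfl | hcr
    · exact ⟨i, by grind⟩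
    · obtain ⟨j, hj, hjc⟩ := hsurj c (by omega)
      exact ⟨j, by grind⟩

theorem Sorted.ord_ne (hS : Sorted n lt ord) (hi : i < n) : ∀ j < i, ord j ≠ ord i :=
  fun _ hj heq => hj.ne (hS.inj PredLT.irrefl (hj.trans hi) hi heq)

theorem Chains.extend_chain (hlt : IntervalOrder n lt) (hS : Sorted n lt ord)
    (hC : Chains n lt ord i p chain) (hT : IsTop ord i p chain top) (hi : i < n)
    (hr : r < p) (hrv : lt (top r) (ord i)) :
    Chains n lt ord (i + 1) p (Function.update chain (ord i) r) ∧
      IsTop ord (i + 1) p (Function.update chain (ord i) r) (Function.update top r (ord i)) := by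
  have hp : max p (r + 1) = p := max_eq_left hr
  refine ⟨?_, hT.append (hS.ord_ne hi) r fun c hc _ => hc⟩
  have hasc : ∀ j < i, chain (ord j) = r → lt (ord j) (ord i) := by
    intro j hj hjr
    obtain ⟨t, ht, htop, htr, hlast⟩ := hT r hr
    rw [htop] at hrv
    rcases (hlast j hj hjr).lt_or_eq with hjt | rfl
    · exact hlt.trans (hC.asc j t hjt ht (hjr.trans htr.symm)) hrv
    · exact hrv
  simpa only [hp] using hC.append (hS.ord_ne hi) hr.le hasc (hp.symm ▸ hC.antichain)

theorem IsTop.hasAntichain (hlt : IntervalOrder n lt) (hS : Sorted n lt ord)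
    (hT : IsTop ord i p chain top) (hi : i < n) (hv : ∀ c < p, ¬ lt (top c) (ord i)) :
    HasAntichain n lt (p + 1) := by
  have hpreds : ∀ c < p, numPreds n lt (top c) ≤ numPreds n lt (ord i) := fun c hc => by
    obtain ⟨j, hj, htop, -⟩ := hT c hc
    exact htop ▸ hS.numPreds_le hj.le hi
  have hne : ∀ c < p, top c ≠ ord i := fun c hc => by
    obtain ⟨j, hj, htop, -⟩ := hT c hc
    exact htop ▸ hS.ord_ne hi j hj
  have hinj : ∀ c < p, ∀ c' < p, top c = top c' → c = c' := fun c hc c' hc' heq => by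
    obtain ⟨j, -, htop, hjc, -⟩ := hT c hc
    obtain ⟨j', -, htop', hjc', -⟩ := hT c' hc'
    rw [← hjc, ← hjc', ← htop, ← htop', heq]
  have htop_lt : ∀ c < p, top c < n := fun c hc => by
    obtain ⟨j, hj, htop, -⟩ := hT c hc
    exact htop ▸ hS.ord_lt j (hj.trans hi)
  -- A number with more predecessors has all the predecessors of one with fewer.
  have htop_incomp : ∀ c < p, ∀ c' < p, ¬ lt (top c) (top c') := fun c hc c' hc' h =>
    hv c hc (hlt.lt_of_numPreds_le h (hpreds c' hc'))
  have hord_incomp : ∀ c < p, ¬ lt (ord i) (top c) := fun c hc h =>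
    absurd (hlt.numPreds_lt_of_lt h) (hpreds c hc).not_gt
  have hord_lt := hS.ord_lt i hi
  refine ⟨Function.update top p (ord i), ?_, ?_⟩ <;> grind

theorem Chains.open_chain (hlt : IntervalOrder n lt) (hS : Sorted n lt ord)
    (hC : Chains n lt ord i p chain) (hT : IsTop ord i p chain top) (hi : i < n)
    (hv : ∀ c < p, ¬ lt (top c) (ord i)) :
    Chains n lt ord (i + 1) (p + 1) (Function.update chain (ord i) p) ∧
      IsTop ord (i + 1) (p + 1) (Function.update chain (ord i) p)
        (Function.update top p (ord i)) := by
  have hp : max p (p + 1) = p + 1 := max_eq_right (Nat.le_succ p)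
  refine ⟨?_, hT.append (hS.ord_ne hi) p fun c hc hcp => by omega⟩
  have hasc : ∀ j < i, chain (ord j) = p → lt (ord j) (ord i) := fun j hj hjp =>
    absurd hjp (hC.chain_lt j hj).ne
  simpa only [hp] using
    hC.append (hS.ord_ne hi) le_rfl hasc (hp.symm ▸ hT.hasAntichain hlt hS hi hv)

end Greedy

/-! ## A structured language with arrays -/

theorem mul_add_lt_mul {u v m n : ℕ} (hu : u < m) (hv : v < n) : u * n + v < m * n :=
  calc u * n + v < (u + 1) * n := by rw [add_one_mul]; omega
    _ ≤ m * n := Nat.mul_le_mul_right n hu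

theorem mul_add_inj {u v u' v' n : ℕ} (hv : v < n) (hv' : v' < n) :
    u * n + v = u' * n + v' ↔ u = u' ∧ v = v' := by
  refine ⟨fun h => ?_, by rintro ⟨rfl, rfl⟩; rfl⟩
  have hdiv {a b : ℕ} (hb : b < n) : (a * n + b) / n = a := by
    rw [mul_comm, Nat.mul_add_div (by omega), Nat.div_eq_of_lt hb, add_zero]
  obtain rfl : u = u' := (hdiv hv).symm.trans ((congrArg (· / n) h).trans (hdiv hv'))
  exact ⟨rfl, by omega⟩

/-- The variables of the source language. -/
inductive Var
  | outBase | numStates | numEdges | edge | edge' | len | node | arrow | next | qHead | qTail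
  | row | col | state | degree | pos | cand | best | numChains | outPos
  deriving DecidableEq

/-- The arrays of the source language.  The memory of the machine starts with the array `io`, which
holds the input and later the output. -/
inductive Arr
  | io | src | dst | lab | lam | arrowSrc | arrowDst | prev | head | mark | queue | predCount
  | order | chain | top | listed
  deriving DecidableEq

theorem Var.ctorIdx_injective : Function.Injective Var.ctorIdx := by
  intro x y h
  cases x <;> cases y <;> first | rfl | cases h

theorem Arr.ctorIdx_injective : Function.Injective Arr.ctorIdx := by
  intro A A' h
  cases A <;> cases A' <;> first | rfl | cases h

theorem Arr.ctorIdx_lt (A : Arr) : A.ctorIdx < 16 := by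
  cases A <;> decide

/-- The values of the variables and of the array cells. -/
structure Store where
  var : Var → ℕ
  arr : Arr → ℕ → ℕ

namespace Store

/-- Assignment to a variable. -/
def setVar (σ : Store) (x : Var) (b : ℕ) : Store where
  var := Function.update σ.var x b
  arr := σ.arr

/-- Assignment to an array cell. -/
def setArr (σ : Store) (A : Arr) (i b : ℕ) : Store where
  var := σ.var
  arr := Function.update σ.arr A (Function.update (σ.arr A) i b)

@[simp] theorem setVar_var (σ : Store) (x y : Var) (b : ℕ) :
    (σ.setVar x b).var y = if y = x then b else σ.var y :=
  Function.update_apply ..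

@[simp] theorem setVar_arr (σ : Store) (x : Var) (b : ℕ) : (σ.setVar x b).arr = σ.arr := rfl

@[simp] theorem setArr_var (σ : Store) (A : Arr) (i b : ℕ) : (σ.setArr A i b).var = σ.var := rfl

@[simp] theorem setArr_arr (σ : Store) (A A' : Arr) (i b : ℕ) :
    (σ.setArr A i b).arr A' = if A' = A then Function.update (σ.arr A) i b else σ.arr A' :=
  Function.update_apply ..

/-- All values are below `B`. -/
structure Bounded (B : ℕ) (σ : Store) : Prop where
  var_lt : ∀ x, σ.var x < B
  arr_lt : ∀ A i, σ.arr A i < B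

theorem Bounded.setVar {B : ℕ} {σ : Store} (h : σ.Bounded B) (x : Var) {b : ℕ} (hb : b < B) :
    (σ.setVar x b).Bounded B where
  var_lt y := by
    rw [setVar_var]
    split_ifs
    exacts [hb, h.var_lt y]
  arr_lt := h.arr_lt

theorem Bounded.setArr {B : ℕ} {σ : Store} (h : σ.Bounded B) (A : Arr) (i : ℕ) {b : ℕ}
    (hb : b < B) : (σ.setArr A i b).Bounded B where
  var_lt := h.var_lt
  arr_lt A' j := by
    rw [setArr_arr]
    split_ifs
    · rw [Function.update_apply]
      split_ifs
      exacts [hb, h.arr_lt A j]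
    · exact h.arr_lt A' j

end Store

/-- Arithmetic expressions; `load A e` is the cell of the array `A` with index `e`. -/
inductive Expr
  | lit (k : ℕ)
  | var (x : Var)
  | load (A : Arr) (e : Expr)
  | add (a b : Expr)
  | mul (a b : Expr)

namespace Expr

instance : Add Expr := ⟨add⟩
instance : Mul Expr := ⟨mul⟩
instance : Coe Var Expr := ⟨var⟩
instance (k : ℕ) : OfNat Expr k := ⟨lit k⟩
instance : CoeFun Arr fun _ => Expr → Expr := ⟨load⟩

/-- The value of an expression. -/
def eval (σ : Store) : Expr → ℕ
  | lit k => k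
  | var x => σ.var x
  | load A e => σ.arr A (e.eval σ)
  | add a b => a.eval σ + b.eval σ
  | mul a b => a.eval σ * b.eval σ

/-- All array accesses are at indices below `B`. -/
def InBounds (B : ℕ) (σ : Store) : Expr → Prop
  | lit _ => True
  | var _ => True
  | load _ e => e.InBounds B σ ∧ e.eval σ < B
  | add a b => a.InBounds B σ ∧ b.InBounds B σ
  | mul a b => a.InBounds B σ ∧ b.InBounds B σ

/-- In a store bounded by `B` the value is below `B`, which is automatic for variables and array
cells: see `eval_lt_of_storable`. -/
def Storable (B : ℕ) (σ : Store) : Expr → Prop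
  | lit k => k < B
  | var _ => True
  | load _ _ => True
  | add a b => a.eval σ + b.eval σ < B
  | mul a b => a.eval σ * b.eval σ < B

/-- An exponent `s` such that all intermediate values are below `B ^ s` in a store bounded by `B`:
see `eval_lt_pow_size`. -/
def size : Expr → ℕ
  | lit k => k + 1
  | var _ => 1
  | load _ e => e.size
  | add a b => a.size + b.size
  | mul a b => a.size + b.size

section Simp

variable (B : ℕ) (σ : Store) (a b : Expr) (k : ℕ) (x : Var) (A : Arr)

@[simp] theorem eval_ofNat : (no_index (OfNat.ofNat k) : Expr).eval σ = OfNat.ofNat k := rfl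
@[simp] theorem eval_var : (var x).eval σ = σ.var x := rfl
@[simp] theorem eval_load : (load A a).eval σ = σ.arr A (a.eval σ) := rfl
@[simp] theorem eval_add : (a + b).eval σ = a.eval σ + b.eval σ := rfl
@[simp] theorem eval_mul : (a * b).eval σ = a.eval σ * b.eval σ := rfl

@[simp] theorem inBounds_ofNat : (no_index (OfNat.ofNat k) : Expr).InBounds B σ ↔ True := Iff.rfl
@[simp] theorem inBounds_var : (var x).InBounds B σ ↔ True := Iff.rfl
@[simp] theorem inBounds_load : (load A a).InBounds B σ ↔ a.InBounds B σ ∧ a.eval σ < B := Iff.rfl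
@[simp] theorem inBounds_add : (a + b).InBounds B σ ↔ a.InBounds B σ ∧ b.InBounds B σ := Iff.rfl
@[simp] theorem inBounds_mul : (a * b).InBounds B σ ↔ a.InBounds B σ ∧ b.InBounds B σ := Iff.rfl

@[simp] theorem storable_ofNat :
    (no_index (OfNat.ofNat k) : Expr).Storable B σ ↔ OfNat.ofNat k < B := Iff.rfl
@[simp] theorem storable_var : (var x).Storable B σ ↔ True := Iff.rfl
@[simp] theorem storable_load : (load A a).Storable B σ ↔ True := Iff.rfl
@[simp] theorem storable_add : (a + b).Storable B σ ↔ a.eval σ + b.eval σ < B := Iff.rfl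

end Simp

variable {B : ℕ} {σ : Store}

theorem eval_lt_of_storable (hσ : σ.Bounded B) {e : Expr} (he : e.Storable B σ) :
    e.eval σ < B := by
  cases e with
  | lit k => exact he
  | var x => exact hσ.var_lt x
  | load A e => exact hσ.arr_lt A _
  | add a b => exact he
  | mul a b => exact he

theorem size_pos (e : Expr) : 0 < e.size := by
  induction e with
  | lit | var => exact Nat.succ_pos _
  | load _ _ ih => exact ih
  | add _ _ ih | mul _ _ ih => exact Nat.add_pos_left ih _

theorem eval_lt_pow_size (hB : 2 ≤ B) (hσ : σ.Bounded B) (e : Expr) : e.eval σ < B ^ e.size := by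
  have two_le_pow (e : Expr) : 2 ≤ B ^ e.size := hB.trans (Nat.le_self_pow e.size_pos.ne' B)
  induction e with
  | lit k =>
    exact (Nat.lt_pow_self hB).trans_le (Nat.pow_le_pow_right (by omega) (Nat.le_succ k))
  | var x => simpa [size] using hσ.var_lt x
  | load A e => exact (hσ.arr_lt A _).trans_le (Nat.le_self_pow e.size_pos.ne' B)
  | add a b iha ihb =>
    change a.eval σ + b.eval σ < B ^ (a.size + b.size)
    rw [pow_add]
    nlinarith [two_le_pow a, two_le_pow b]
  | mul a b iha ihb =>
    change a.eval σ * b.eval σ < B ^ (a.size + b.size)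
    rw [pow_add]
    exact Nat.mul_lt_mul'' iha ihb

end Expr

/-- Comparisons of two expressions. -/
inductive Cond
  | lt (a b : Expr)
  | eq (a b : Expr)

namespace Cond

/-- The comparison is true. -/
def Holds (σ : Store) : Cond → Prop
  | lt a b => a.eval σ < b.eval σ
  | eq a b => a.eval σ = b.eval σ

/-- The left side of a comparison. -/
def left : Cond → Expr
  | lt a _ => a
  | eq a _ => a

/-- The right side of a comparison. -/
def right : Cond → Expr
  | lt _ b => b
  | eq _ b => b

/-- All array accesses are at indices below `B`. -/
def InBounds (B : ℕ) (σ : Store) (b : Cond) : Prop := b.left.InBounds B σ ∧ b.right.InBounds B σ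

/-- The size condition of `WordBound`. -/
def fits (b : Cond) : Bool := decide (b.left.size ≤ 16) && decide (b.right.size ≤ 16)

end Cond

/-- The statements of the source language; `store A i a` assigns `a` to the cell `i` of `A`. -/
inductive Stmt
  | skip
  | assign (x : Var) (a : Expr)
  | store (A : Arr) (i a : Expr)
  | seq (S R : Stmt)
  | ite (b : Cond) (S R : Stmt)
  | while (b : Cond) (S : Stmt)

namespace Stmt

/-- The statements of a list, one after the other. -/
def block : List Stmt → Stmt
  | [] => skip
  | S :: l => seq S (block l)

/-- The loop in which `x` runs from `0` to `N - 1`. -/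
def forLoop (x N : Var) (S : Stmt) : Stmt :=
  seq (assign x 0) (.while (.lt x N) (seq S (assign x (x + 1))))

/-- The size condition of `WordBound`. -/
def fits : Stmt → Bool
  | skip => true
  | assign _ a => decide (a.size ≤ 16)
  | store _ i a => decide (i.size ≤ 16) && decide (a.size ≤ 16)
  | seq S R => S.fits && R.fits
  | ite b S R => b.fits && S.fits && R.fits
  | .while b S => b.fits && S.fits

/-- The variable `x` is assigned to somewhere in the statement. -/
def writesVar (x : Var) : Stmt → Bool
  | skip => false
  | assign y _ => decide (x = y)
  | store _ _ _ => false
  | seq S R => S.writesVar x || R.writesVar x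
  | ite _ S R => S.writesVar x || R.writesVar x
  | .while _ S => S.writesVar x

/-- A cell of the array `A` is assigned to somewhere in the statement. -/
def writesArr (A : Arr) : Stmt → Bool
  | skip => false
  | assign _ _ => false
  | store A' _ _ => decide (A = A')
  | seq S R => S.writesArr A || R.writesArr A
  | ite _ S R => S.writesArr A || R.writesArr A
  | .while _ S => S.writesArr A

end Stmt

/-- The stores differ only in what the statement assigns to. -/
structure Frame (S : Stmt) (σ τ : Store) : Prop where
  var : ∀ x, S.writesVar x = false → τ.var x = σ.var x
  arr : ∀ A, S.writesArr A = false → τ.arr A = σ.arr A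

namespace Frame

variable {S R : Stmt} {b : Cond} {σ τ ρ : Store}

theorem refl (S : Stmt) (σ : Store) : Frame S σ σ := ⟨fun _ _ => rfl, fun _ _ => rfl⟩

theorem trans (h : Frame S σ τ) (h' : Frame S τ ρ) : Frame S σ ρ :=
  ⟨fun x hx => (h'.var x hx).trans (h.var x hx), fun A hA => (h'.arr A hA).trans (h.arr A hA)⟩

theorem seq_left (R : Stmt) (h : Frame S σ τ) : Frame (.seq S R) σ τ :=
  ⟨fun x hx => h.var x (Bool.or_eq_false_iff.1 hx).1,
    fun A hA => h.arr A (Bool.or_eq_false_iff.1 hA).1⟩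

theorem seq_right (S : Stmt) (h : Frame R σ τ) : Frame (.seq S R) σ τ :=
  ⟨fun x hx => h.var x (Bool.or_eq_false_iff.1 hx).2,
    fun A hA => h.arr A (Bool.or_eq_false_iff.1 hA).2⟩

theorem ite_left (b : Cond) (R : Stmt) (h : Frame S σ τ) : Frame (.ite b S R) σ τ :=
  let h' := h.seq_left R
  ⟨h'.var, h'.arr⟩

theorem ite_right (b : Cond) (S : Stmt) (h : Frame R σ τ) : Frame (.ite b S R) σ τ :=
  let h' := h.seq_right S
  ⟨h'.var, h'.arr⟩

theorem while_body (b : Cond) (h : Frame S σ τ) : Frame (.while b S) σ τ := ⟨h.var, h.arr⟩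

end Frame

/-! ## Compilation to the word RAM and timed triples -/

/-- Words of `w` bits hold all intermediate values of expressions of size at most `16` over
variables and array cells below `B`, as well as the addresses of all cells of the arrays. -/
class WordBound (w B : ℕ) : Prop where
  le : 17 ≤ B
  pow_le : B ^ 16 ≤ 2 ^ w

/-- The register of a variable. -/
def Var.reg (x : Var) : ℕ := 2 * x.ctorIdx

/-- The register that holds the bound `B`, by which the arrays are spaced in the memory. -/
def baseReg : ℕ := 1

/-- The registers for the evaluation of expressions. -/
def scratch (d : ℕ) : ℕ := 2 * d + 3

/-- The address of the cell `i` of the array `A`. -/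
def Arr.address (A : Arr) (B i : ℕ) : ℕ := A.ctorIdx * B + i

section Registers

variable {x y : Var} {d j : ℕ}

theorem Var.reg_inj : x.reg = y.reg ↔ x = y :=
  (Nat.mul_right_inj two_ne_zero).trans Var.ctorIdx_injective.eq_iff

@[simp] theorem scratch_inj : scratch d = scratch j ↔ d = j := by
  simp only [scratch]
  omega

@[simp] theorem Var.reg_ne_scratch : x.reg ≠ scratch d := by
  simp only [Var.reg, scratch]
  omega

@[simp] theorem Var.reg_ne_baseReg : x.reg ≠ baseReg := by
  simp only [Var.reg, baseReg]
  omega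

@[simp] theorem baseReg_ne_scratch : baseReg ≠ scratch d := by
  simp only [baseReg, scratch]
  omega

end Registers

/-- The state `c` of the machine represents the store `σ`, all of whose values are below `B`. -/
structure Represents {w : ℕ} (B : ℕ) (c : State w) (σ : Store) : Prop where
  var : ∀ x : Var, (c.reg x.reg).toNat = σ.var x
  base : (c.reg baseReg).toNat = B
  arr : ∀ (A : Arr) (i : ℕ), i < B → (c.mem (BitVec.ofNat w (A.address B i))).toNat = σ.arr A i
  bounded : σ.Bounded B

section Represents

variable {w B : ℕ} {c : State w} {σ : Store}

theorem Arr.address_lt [WordBound w B] (A : Arr) {i : ℕ} (hi : i < B) :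
    A.address B i < 2 ^ w := by
  have hB := WordBound.le (w := w) (B := B)
  calc A.address B i < 16 * B := mul_add_lt_mul A.ctorIdx_lt hi
    _ ≤ B ^ 2 := by rw [sq]; exact Nat.mul_le_mul_right B (by omega)
    _ ≤ B ^ 16 := Nat.pow_le_pow_right (by omega) (by omega)
    _ ≤ 2 ^ w := WordBound.pow_le

theorem Arr.ofNat_address_inj [WordBound w B] {A A' : Arr} {i i' : ℕ} (hi : i < B) (hi' : i' < B) :
    BitVec.ofNat w (A.address B i) = BitVec.ofNat w (A'.address B i') ↔ A = A' ∧ i = i' := by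
  rw [← BitVec.toNat_inj, BitVec.toNat_ofNat, BitVec.toNat_ofNat,
    Nat.mod_eq_of_lt (A.address_lt hi), Nat.mod_eq_of_lt (A'.address_lt hi'), Arr.address,
    Arr.address, mul_add_inj hi hi', Arr.ctorIdx_injective.eq_iff]

theorem Represents.update_scratch (h : Represents B c σ) (d : ℕ) (b : BitVec w) :
    Represents B { c with reg := Function.update c.reg (scratch d) b } σ where
  var x := by simp [h.var]
  base := by simp [h.base]
  arr := h.arr
  bounded := h.bounded

theorem Represents.update_var (h : Represents B c σ) (x : Var) {b : BitVec w} (hb : b.toNat < B) :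
    Represents B { c with reg := Function.update c.reg x.reg b } (σ.setVar x b.toNat) where
  var y := by
    by_cases hy : y = x
    · simp [hy]
    · simp [hy, Var.reg_inj, h.var]
  base := by simp [Var.reg_ne_baseReg.symm, h.base]
  arr := h.arr
  bounded := h.bounded.setVar x hb

theorem Represents.update_mem [WordBound w B] (h : Represents B c σ) (A : Arr) {i : ℕ} (hi : i < B)
    {b : BitVec w} (hb : b.toNat < B) :
    Represents B { c with mem := Function.update c.mem (BitVec.ofNat w (A.address B i)) b }
      (σ.setArr A i b.toNat) where
  var := h.var
  base := h.base
  arr A' j hj := by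
    simp only [Function.update_apply, Arr.ofNat_address_inj hj hi, Store.setArr_arr]
    by_cases hA : A' = A
    · by_cases hji : j = i <;> simp [hA, hji, ← h.arr A j hj]
    · simp [hA, h.arr A' j hj]
  bounded := h.bounded.setArr A i hb

end Represents

/-- The program that replaces the index in the scratch register `d` by the address of the cell of
`A`, with the help of the scratch register `t`. -/
def Arr.addressCode (A : Arr) (d t : ℕ) : Prog :=
  .seq (.instr (.const (scratch t) A.ctorIdx)) (.seq
    (.instr (.bin .mul (scratch t) (scratch t) baseReg))
    (.instr (.bin .add (scratch d) (scratch d) (scratch t))))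

theorem Arr.exec_addressCode {w B : ℕ} {c : State w} {σ : Store} (h : Represents B c σ) (A : Arr)
    {d t : ℕ} (hdt : d ≠ t) {i : ℕ} (hi : (c.reg (scratch d)).toNat = i) :
    ∃ c', Exec (A.addressCode d t) c 3 c' ∧ Represents B c' σ ∧
      c'.reg (scratch d) = BitVec.ofNat w (A.address B i) ∧
      ∀ j, j ≠ d → j ≠ t → c'.reg (scratch j) = c.reg (scratch j) := by
  refine ⟨_, .seq (.instr _ _) (.seq (.instr _ _) (.instr _ _)),
    ((h.update_scratch t _).update_scratch t _).update_scratch d _, ?_, fun j hd ht => ?_⟩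
  · have hsum : c.reg (scratch d) + BitVec.ofNat w A.ctorIdx * c.reg baseReg
        = BitVec.ofNat w (A.address B i) := by
      apply BitVec.eq_of_toNat_eq
      rw [BitVec.toNat_add, BitVec.toNat_mul, hi, h.base]
      simp [Arr.address, Nat.add_comm]
    simpa [Instr.exec, Op.eval, hdt] using hsum
  · simp [Instr.exec, hd, ht]

namespace Expr

/-- The program that puts the value into the scratch register `d` and keeps the scratch registers
below `d`. -/
def compile (d : ℕ) : Expr → Prog
  | lit k => .instr (.const (scratch d) k)
  | var x => .instr (.bin .or (scratch d) x.reg x.reg)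
  | load A e => .seq (e.compile d) (.seq (A.addressCode d (d + 1))
      (.instr (.load (scratch d) (scratch d))))
  | add a b => .seq (a.compile d) (.seq (b.compile (d + 1))
      (.instr (.bin .add (scratch d) (scratch d) (scratch (d + 1)))))
  | mul a b => .seq (a.compile d) (.seq (b.compile (d + 1))
      (.instr (.bin .mul (scratch d) (scratch d) (scratch (d + 1)))))

/-- The time of the evaluation. -/
def cost : Expr → ℕ
  | lit _ => 1
  | var _ => 1
  | load _ e => e.cost + 4
  | add a b => a.cost + (b.cost + 1)
  | mul a b => a.cost + (b.cost + 1)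

/-- The compiled expression does what `compile` promises, in time `cost`. -/
def Evaluates (w B : ℕ) (σ : Store) (e : Expr) : Prop :=
  ∀ (d : ℕ) (c : State w), Represents B c σ → ∃ c', Exec (e.compile d) c e.cost c' ∧
    Represents B c' σ ∧ (c'.reg (scratch d)).toNat = e.eval σ ∧
    ∀ j < d, c'.reg (scratch j) = c.reg (scratch j)

variable {w B : ℕ} {σ : Store}

theorem eval_lt_two_pow [WordBound w B] (hσ : σ.Bounded B) {e : Expr} (he : e.size ≤ 16) :
    e.eval σ < 2 ^ w := by
  have hB := WordBound.le (w := w) (B := B)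
  calc e.eval σ < B ^ e.size := eval_lt_pow_size (by omega) hσ e
    _ ≤ B ^ 16 := Nat.pow_le_pow_right (by omega) he
    _ ≤ 2 ^ w := WordBound.pow_le

theorem evaluates_lit [WordBound w B] {k : ℕ} (hk : (lit k).size ≤ 16) :
    (lit k).Evaluates w B σ := fun d c h =>
  ⟨_, .instr _ _, h.update_scratch d _,
    by simpa [Instr.exec, eval] using Nat.mod_eq_of_lt (eval_lt_two_pow h.bounded hk),
    fun j hj => by simp [Instr.exec, hj.ne]⟩

theorem evaluates_var (x : Var) : (var x).Evaluates w B σ := fun d c h =>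
  ⟨_, .instr _ _, h.update_scratch d _, by simpa [Instr.exec, Op.eval] using h.var x,
    fun j hj => by simp [Instr.exec, hj.ne]⟩

theorem Evaluates.load {e : Expr} (he : e.Evaluates w B σ) (A : Arr) (hlt : e.eval σ < B) :
    (load A e).Evaluates w B σ := by
  intro d c h
  obtain ⟨c₁, hx₁, h₁, hval, hkeep₁⟩ := he d c h
  obtain ⟨c₂, hx₂, h₂, haddr, hkeep₂⟩ := A.exec_addressCode h₁ (Nat.succ_ne_self d).symm hval
  refine ⟨_, .seq hx₁ (.seq hx₂ (.instr _ _)), h₂.update_scratch d _, ?_, fun j hj => ?_⟩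
  · simpa [Instr.exec, haddr] using h₂.arr A _ hlt
  · simp [Instr.exec, hj.ne, hkeep₂ j hj.ne (by omega), hkeep₁ j hj]

theorem Evaluates.add [WordBound w B] {a b : Expr} (ha : a.Evaluates w B σ)
    (hb : b.Evaluates w B σ) (hab : (a + b).size ≤ 16) : (a + b).Evaluates w B σ := by
  intro d c h
  obtain ⟨c₁, hx₁, h₁, hval₁, hkeep₁⟩ := ha d c h
  obtain ⟨c₂, hx₂, h₂, hval₂, hkeep₂⟩ := hb (d + 1) c₁ h₁
  refine ⟨_, .seq hx₁ (.seq hx₂ (.instr _ _)), h₂.update_scratch d _, ?_, fun j hj => ?_⟩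
  · simpa [Instr.exec, Op.eval, hkeep₂ d (by omega), hval₁, hval₂] using
      Nat.mod_eq_of_lt (eval_lt_two_pow h.bounded hab)
  · simp [Instr.exec, hj.ne, hkeep₂ j (by omega), hkeep₁ j hj]

theorem Evaluates.mul [WordBound w B] {a b : Expr} (ha : a.Evaluates w B σ)
    (hb : b.Evaluates w B σ) (hab : (a * b).size ≤ 16) : (a * b).Evaluates w B σ := by
  intro d c h
  obtain ⟨c₁, hx₁, h₁, hval₁, hkeep₁⟩ := ha d c h
  obtain ⟨c₂, hx₂, h₂, hval₂, hkeep₂⟩ := hb (d + 1) c₁ h₁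
  refine ⟨_, .seq hx₁ (.seq hx₂ (.instr _ _)), h₂.update_scratch d _, ?_, fun j hj => ?_⟩
  · simpa [Instr.exec, Op.eval, hkeep₂ d (by omega), hval₁, hval₂] using
      Nat.mod_eq_of_lt (eval_lt_two_pow h.bounded hab)
  · simp [Instr.exec, hj.ne, hkeep₂ j (by omega), hkeep₁ j hj]

theorem evaluates [WordBound w B] {e : Expr} (he : e.InBounds B σ) (hs : e.size ≤ 16) :
    e.Evaluates w B σ := by
  induction e with
  | lit k => exact evaluates_lit hs
  | var x => exact evaluates_var x
  | load A e ih => exact (ih he.1 hs).load A he.2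
  | add a b iha ihb =>
    have hab : a.size + b.size ≤ 16 := hs
    exact (iha he.1 (by omega)).add (ihb he.2 (by omega)) hs
  | mul a b iha ihb =>
    have hab : a.size + b.size ≤ 16 := hs
    exact (iha he.1 (by omega)).mul (ihb he.2 (by omega)) hs

end Expr

namespace Cond

/-- The test of the machine for a comparison whose sides are in the first two scratch registers. -/
def test : Cond → Test
  | lt _ _ => .lt (scratch 0) (scratch 1)
  | eq _ _ => .eq (scratch 0) (scratch 1)

/-- The program that puts the two sides into the first two scratch registers. -/
def compile (b : Cond) : Prog := .seq (b.left.compile 0) (b.right.compile 1)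

/-- The time of the evaluation of the two sides. -/
def cost (b : Cond) : ℕ := b.left.cost + b.right.cost

theorem exec_compile {w B : ℕ} [WordBound w B] {c : State w} {σ : Store} (h : Represents B c σ)
    {b : Cond} (hb : b.InBounds B σ) (hf : b.fits) :
    ∃ c', Exec b.compile c b.cost c' ∧ Represents B c' σ ∧ (b.test.Holds c' ↔ b.Holds σ) := by
  simp only [fits, Bool.and_eq_true, decide_eq_true_eq] at hf
  obtain ⟨c₁, hx₁, h₁, hval₁, -⟩ := Expr.evaluates hb.1 hf.1 0 c h
  obtain ⟨c₂, hx₂, h₂, hval₂, hkeep⟩ := Expr.evaluates hb.2 hf.2 1 c₁ h₁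
  refine ⟨c₂, .seq hx₁ hx₂, h₂, ?_⟩
  rw [← hkeep 0 one_pos] at hval₁
  cases b with
  | lt _ _ => simp only [test, Test.Holds, Holds, hval₁, hval₂, left, right]
  | eq _ _ => simp only [test, Test.Holds, Holds, ← BitVec.toNat_inj, hval₁, hval₂, left, right]

end Cond

namespace Stmt

/-- The program for a statement. -/
def compile : Stmt → Prog
  | skip => .skip
  | assign x a => .seq (a.compile 0) (.instr (.bin .or x.reg (scratch 0) (scratch 0)))
  | store A i a => .seq (i.compile 0) (.seq (a.compile 1)
      (.seq (A.addressCode 0 2) (.instr (.store (scratch 0) (scratch 1)))))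
  | seq S R => .seq S.compile R.compile
  | ite b S R => .seq b.compile (.ite b.test S.compile R.compile)
  | .while b S => .seq b.compile (.while b.test (.seq S.compile b.compile))

/-- An upper bound for the time of a statement without loops. -/
def cost : Stmt → ℕ
  | skip => 1
  | assign _ a => a.cost + 1
  | store _ i a => i.cost + a.cost + 4
  | seq S R => S.cost + R.cost
  | ite b S R => b.cost + S.cost + R.cost + 1
  | .while _ _ => 0

end Stmt

/-- Timed triples: from a representation of `σ` the program for `S` reaches, in at most `T` steps, a
representation of a store with the property `Post`. -/
def Triple (w B : ℕ) (S : Stmt) (σ : Store) (T : ℕ) (Post : Store → Prop) : Prop :=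
  ∀ c : State w, Represents B c σ → ∃ (t : ℕ) (c' : State w) (τ : Store),
    Exec S.compile c t c' ∧ t ≤ T ∧ Represents B c' τ ∧ Frame S σ τ ∧ Post τ

namespace Triple

variable {w B : ℕ} {S R : Stmt} {b : Cond} {σ : Store} {T T' T'' : ℕ} {Post Post' : Store → Prop}

theorem mono (h : Triple w B S σ T Post) (hT : T ≤ T')
    (hPost : ∀ τ, Frame S σ τ → Post τ → Post' τ) : Triple w B S σ T' Post' := by
  intro c hc
  obtain ⟨t, c', τ, hx, ht, hτ, hF, hP⟩ := h c hc
  exact ⟨t, c', τ, hx, ht.trans hT, hτ, hF, hPost τ hF hP⟩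

theorem mono_time (h : Triple w B S σ T Post) (hT : T ≤ T') : Triple w B S σ T' Post :=
  h.mono hT fun _ _ hP => hP

theorem skip (h : Post σ) : Triple w B .skip σ 1 Post :=
  fun c hc => ⟨1, c, σ, .skip c, le_rfl, hc, .refl _ _, h⟩

theorem seq (T T' : ℕ) (Post : Store → Prop) (hT : T + T' ≤ T'') (h : Triple w B S σ T Post)
    (h' : ∀ τ, Frame S σ τ → Post τ → Triple w B R τ T' Post') :
    Triple w B (.seq S R) σ T'' Post' := by
  intro c hc
  obtain ⟨t, c₁, τ, hx, ht, hτ, hF, hP⟩ := h c hc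
  obtain ⟨t', c₂, ρ, hx', ht', hρ, hF', hP'⟩ := h' τ hF hP c₁ hτ
  exact ⟨t + t', c₂, ρ, .seq hx hx', by omega, hρ, (hF.seq_left R).trans (hF'.seq_right S), hP'⟩

theorem assign [WordBound w B] {x : Var} {a : Expr} (hsize : a.size ≤ 16) (ha : a.InBounds B σ)
    (hs : a.Storable B σ) (h : Post (σ.setVar x (a.eval σ))) :
    Triple w B (.assign x a) σ (a.cost + 1) Post := by
  intro c hc
  obtain ⟨c₁, hx, h₁, hval, -⟩ := Expr.evaluates ha hsize 0 c hc
  have hlt : (c₁.reg (scratch 0)).toNat < B := hval ▸ Expr.eval_lt_of_storable hc.bounded hs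
  refine ⟨_, _, σ.setVar x (a.eval σ), .seq hx (.instr _ _), le_rfl, ?_, ⟨fun y hy => ?_,
    fun _ _ => rfl⟩, h⟩
  · simpa [Instr.exec, Op.eval, hval] using h₁.update_var x hlt
  · simp [of_decide_eq_false hy]

theorem store [WordBound w B] {A : Arr} {i a : Expr} (hi_size : i.size ≤ 16) (ha_size : a.size ≤ 16)
    (hi : i.InBounds B σ) (hlt : i.eval σ < B) (ha : a.InBounds B σ) (hs : a.Storable B σ)
    (h : Post (σ.setArr A (i.eval σ) (a.eval σ))) :
    Triple w B (.store A i a) σ (i.cost + a.cost + 4) Post := by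
  intro c hc
  obtain ⟨c₁, hx₁, h₁, hval₁, -⟩ := Expr.evaluates hi hi_size 0 c hc
  obtain ⟨c₂, hx₂, h₂, hval₂, hkeep⟩ := Expr.evaluates ha ha_size 1 c₁ h₁
  rw [← hkeep 0 one_pos] at hval₁
  obtain ⟨c₃, hx₃, h₃, haddr, hkeep₃⟩ := A.exec_addressCode h₂ (t := 2) (by decide) hval₁
  rw [← hkeep₃ 1 (by decide) (by decide)] at hval₂
  have hlt' : (c₃.reg (scratch 1)).toNat < B := hval₂ ▸ Expr.eval_lt_of_storable hc.bounded hs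
  refine ⟨_, _, σ.setArr A (i.eval σ) (a.eval σ), .seq hx₁ (.seq hx₂ (.seq hx₃ (.instr _ _))),
    by omega, ?_, ⟨fun _ _ => rfl, fun A' hA => ?_⟩, h⟩
  · simpa [Instr.exec, haddr, hval₂] using h₃.update_mem A hlt hlt'
  · simp [of_decide_eq_false hA]

theorem ite [WordBound w B] (hf : b.fits) (hb : b.InBounds B σ)
    (h : b.Holds σ → Triple w B S σ T Post) (h' : ¬ b.Holds σ → Triple w B R σ T' Post) :
    Triple w B (.ite b S R) σ (b.cost + T + T' + 1) Post := by
  intro c hc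
  obtain ⟨c₁, hx, h₁, htest⟩ := Cond.exec_compile hc hb hf
  by_cases hσ : b.Holds σ
  · obtain ⟨t, c₂, τ, hx', ht, hτ, hF, hP⟩ := h hσ c₁ h₁
    exact ⟨_, c₂, τ, .seq hx (.ite_true (htest.2 hσ) hx'), by omega, hτ, hF.ite_left b R, hP⟩
  · obtain ⟨t, c₂, τ, hx', ht, hτ, hF, hP⟩ := h' hσ c₁ h₁
    exact ⟨_, c₂, τ, .seq hx (.ite_false (mt htest.1 hσ) hx'), by omega, hτ, hF.ite_right b S, hP⟩

/-- The loop is entered with the sides of the comparison already evaluated. -/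
theorem exec_while [WordBound w B] (hf : b.fits) (Inv : Store → Prop) (Φ : Store → ℕ)
    (hb : ∀ τ, Inv τ → b.InBounds B τ)
    (hS : ∀ τ, Frame (.while b S) σ τ → Inv τ → b.Holds τ →
      Triple w B S τ T (fun ρ => Inv ρ ∧ Φ ρ < Φ τ))
    {τ : Store} (hF : Frame (.while b S) σ τ) (hI : Inv τ)
    {c : State w} (hc : Represents B c τ) (htest : b.test.Holds c ↔ b.Holds τ) :
    ∃ (t : ℕ) (c' : State w) (ρ : Store),
      Exec (.while b.test (.seq S.compile b.compile)) c t c' ∧ t ≤ Φ τ * (T + b.cost + 1) + 1 ∧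
        Represents B c' ρ ∧ Frame (.while b S) σ ρ ∧ Inv ρ ∧ ¬ b.Holds ρ := by
  induction hΦ : Φ τ using Nat.strong_induction_on generalizing τ c with
  | _ N ih =>
    subst hΦ
    by_cases hτ : b.Holds τ
    · obtain ⟨t₁, c₁, τ₁, hx₁, ht₁, hc₁, hF₁, hI₁, hlt⟩ := hS τ hF hI hτ c hc
      obtain ⟨c₂, hx₂, hc₂, htest₂⟩ := Cond.exec_compile hc₁ (hb τ₁ hI₁) hf
      obtain ⟨t₃, c₃, ρ, hx₃, ht₃, hρ⟩ :=
        ih _ hlt (hF.trans (hF₁.while_body b)) hI₁ hc₂ htest₂ rfl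
      refine ⟨_, c₃, ρ, .while_true (htest.2 hτ) (.seq hx₁ hx₂) hx₃, ?_, hρ⟩
      have := Nat.mul_le_mul_right (T + b.cost + 1) hlt
      rw [Nat.succ_mul] at this
      omega
    · exact ⟨1, c, τ, .while_false (mt htest.1 hτ), by omega, hc, hF, hI, hτ⟩

theorem while_variant [WordBound w B] (hf : b.fits) (Inv : Store → Prop) (Φ : Store → ℕ)
    (hb : ∀ τ, Inv τ → b.InBounds B τ)
    (hS : ∀ τ, Frame (.while b S) σ τ → Inv τ → b.Holds τ →
      Triple w B S τ T (fun ρ => Inv ρ ∧ Φ ρ < Φ τ)) (h0 : Inv σ) :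
    Triple w B (.while b S) σ (Φ σ * (T + b.cost + 1) + b.cost + 1)
      (fun τ => Inv τ ∧ ¬ b.Holds τ) := by
  intro c hc
  obtain ⟨c₁, hx, hc₁, htest⟩ := Cond.exec_compile hc (hb σ h0) hf
  obtain ⟨t, c₂, τ, hx', ht, hτ⟩ := exec_while hf Inv Φ hb hS (.refl _ _) h0 hc₁ htest
  exact ⟨_, c₂, τ, .seq hx hx', by omega, hτ⟩

theorem while_counter [WordBound w B] {x N : Var} (hNx : N ≠ x) (hxS : S.writesVar x = false)
    (hNS : S.writesVar N = false) (Inv : ℕ → Store → Prop) (hx : σ.var x = 0) (h0 : Inv 0 σ)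
    (hS : ∀ τ j, Frame (.while (.lt x N) (.seq S (.assign x (x + 1)))) σ τ → τ.var x = j →
      j < σ.var N → Inv j τ → Triple w B S τ T (fun ρ => Inv (j + 1) (ρ.setVar x (j + 1)))) :
    Triple w B (.while (.lt x N) (.seq S (.assign x (x + 1)))) σ (σ.var N * (T + 7) + 3)
      (Inv (σ.var N)) := by
  intro c hc
  have hNB := hc.bounded.var_lt N
  have hloop := while_variant (w := w) (B := B) (σ := σ) (T := T + 4) (b := .lt x N)
    (S := .seq S (.assign x (x + 1))) rfl
    (fun τ => τ.var N = σ.var N ∧ τ.var x ≤ σ.var N ∧ Inv (τ.var x) τ)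
    (fun τ => σ.var N - τ.var x) (fun _ _ => ⟨trivial, trivial⟩) ?_ ⟨rfl, by omega, hx.symm ▸ h0⟩
  · refine hloop.mono ?_ ?_ c hc
    · rw [hx]
      exact le_rfl
    · rintro τ - ⟨⟨hN, hle, hI⟩, hnot⟩
      rwa [show τ.var x = σ.var N from le_antisymm hle (hN ▸ not_lt.1 hnot)] at hI
  · rintro τ hF ⟨hN, -, hI⟩ hlt
    have hlt : τ.var x < σ.var N := hN ▸ hlt
    refine seq T 4 _ le_rfl (hS τ _ hF rfl hlt hI) fun ρ hFρ hIρ => ?_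
    have hxρ : ρ.var x = τ.var x := hFρ.var x hxS
    have hNρ : ρ.var N = σ.var N := (hFρ.var N hNS).trans hN
    refine assign (Nat.le_of_ble_eq_true rfl) ⟨trivial, trivial⟩
      (show ρ.var x + 1 < B by omega) ?_
    simp only [Expr.eval_add, Expr.eval_var, Expr.eval_ofNat, Store.setVar_var, if_true, hNx,
      if_false, hNρ, hxρ]
    exact ⟨⟨trivial, by omega, hIρ⟩, by omega⟩

theorem forLoop [WordBound w B] {x N : Var} (K T : ℕ) (Inv : ℕ → Store → Prop) (hN : σ.var N = K)
    (hT : K * (T + 10) + 10 ≤ T') (h0 : Inv 0 (σ.setVar x 0))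
    (hS : ∀ τ j, Frame (.forLoop x N S) σ τ → τ.var x = j → j < K → Inv j τ →
      Triple w B S τ T (fun ρ => Inv (j + 1) (ρ.setVar x (j + 1))))
    (h : ∀ τ, Frame (.forLoop x N S) σ τ → Inv K τ → Post τ)
    (hNx : N ≠ x := by decide) (hxS : S.writesVar x = false := by rfl)
    (hNS : S.writesVar N = false := by rfl) : Triple w B (.forLoop x N S) σ T' Post := by
  have hN' : (σ.setVar x 0).var N = K := by simp [hNx, hN]
  have hB := WordBound.le (w := w) (B := B)
  refine mono (seq 2 (K * (T + 7) + 3) (fun τ => τ = σ.setVar x 0) ?_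
    (assign (Nat.le_of_ble_eq_true rfl) trivial (show 0 < B by omega) rfl) ?_) le_rfl h
  · exact le_trans (by linarith [Nat.zero_le K]) hT
  · rintro τ hF rfl
    have hloop := while_counter (w := w) (B := B) hNx hxS hNS Inv (by simp) h0
      fun ρ j hF' hj hlt hI => hS ρ j ((hF.seq_left _).trans (hF'.seq_right _)) hj (hN' ▸ hlt) hI
    rwa [hN'] at hloop

end Triple

/-- The weakest precondition of a statement without loops. -/
def Stmt.wp (B : ℕ) : Stmt → Store → (Store → Prop) → Prop
  | skip, σ, Post => Post σ
  | assign x a, σ, Post => a.InBounds B σ ∧ a.Storable B σ ∧ Post (σ.setVar x (a.eval σ))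
  | store A i a, σ, Post => i.InBounds B σ ∧ i.eval σ < B ∧ a.InBounds B σ ∧ a.Storable B σ ∧
      Post (σ.setArr A (i.eval σ) (a.eval σ))
  | seq S R, σ, Post => S.wp B σ (fun τ => R.wp B τ Post)
  | ite b S R, σ, Post =>
      b.InBounds B σ ∧ (b.Holds σ → S.wp B σ Post) ∧ (¬ b.Holds σ → R.wp B σ Post)
  | .while _ _, _, _ => False

theorem Triple.of_wp_cost {w B : ℕ} [WordBound w B] {S : Stmt} {σ : Store} {Post : Store → Prop}
    (h : S.wp B σ Post) (hf : S.fits) : Triple w B S σ S.cost Post := by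
  induction S generalizing σ Post with
  | skip => exact .skip h
  | assign x a => exact .assign (of_decide_eq_true hf) h.1 h.2.1 h.2.2
  | store A i a =>
    simp only [Stmt.fits, Bool.and_eq_true, decide_eq_true_eq] at hf
    obtain ⟨hi, hlt, ha, hs, hPost⟩ := h
    exact .store hf.1 hf.2 hi hlt ha hs hPost
  | seq S R ihS ihR =>
    simp only [Stmt.fits, Bool.and_eq_true] at hf
    exact .seq _ _ _ le_rfl (ihS h hf.1) fun _ _ h' => ihR h' hf.2
  | ite b S R ihS ihR =>
    simp only [Stmt.fits, Bool.and_eq_true] at hf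
    exact .ite hf.1.1 h.1 (fun hb => ihS (h.2.1 hb) hf.1.2) fun hb => ihR (h.2.2 hb) hf.2
  | _ => exact h.elim

theorem Triple.of_wp {w B : ℕ} [WordBound w B] {S : Stmt} {σ : Store} {T : ℕ}
    {Post : Store → Prop} (h : S.wp B σ Post) (hf : S.fits := by rfl)
    (hT : S.cost ≤ T := by decide) : Triple w B S σ T Post :=
  (Triple.of_wp_cost h hf).mono_time hT

attribute [simp] Stmt.block Stmt.wp Cond.InBounds Cond.Holds Cond.left Cond.right

/-! ## The programs -/

section Programs

open Stmt Var Arr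

/-- Copy the edges from the input to arrays, and make the table of the labels `λ(v)`: the value is
one more than the rank of the label, and `0` if no edge reaches `v`. -/
def loadEdges : Stmt :=
  forLoop edge numEdges (block [
    store src edge (io (4 + 3 * edge)),
    store dst edge (io (5 + 3 * edge)),
    store lab edge (io (6 + 3 * edge)),
    store lam (dst edge) (lab edge + 1)])

/-- Read the input; the output will be written behind it. -/
def readInput : Stmt :=
  seq (block [
    assign numStates (io 0),
    assign numEdges (io 1),
    assign outBase (4 + 3 * numEdges + numStates)]) loadEdges

/-- List the arrows of the graph on the pairs of states: there is an arrow from `(u', v')` to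
`(u, v)` if there are edges from `u'` to `u` and from `v'` to `v` and `λ(u) = λ(v)`. -/
def listArrows : Stmt :=
  forLoop edge numEdges (forLoop edge' numEdges
    (ite (.eq (lam (dst edge)) (lam (dst edge')))
      (block [
        assign len (len + 1),
        store arrowSrc len (src edge * numStates + src edge'),
        store arrowDst len (dst edge * numStates + dst edge')])
      skip))

/-- Make linked lists of the arrows that leave the same pair; an entry `0` ends the list. -/
def linkArrows : Stmt :=
  forLoop pos len (block [
    store prev (pos + 1) (head (arrowSrc (pos + 1))),
    store head (arrowSrc (pos + 1)) (pos + 1)])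

/-- Mark a pair and put it into the queue. -/
def push (a : Expr) : Stmt :=
  block [store mark a 1, store queue qTail a, assign qTail (qTail + 1)]

/-- Mark the pairs `(u, v)` with `λ(v) < λ(u)` or `u = v`. -/
def seed : Stmt :=
  forLoop row numStates (forLoop col numStates
    (ite (.lt (lam col) (lam row)) (push (row * numStates + col))
      (ite (.eq row col) (push (row * numStates + col)) skip)))

/-- Mark all pairs that can be reached from the marked ones; this empties the linked lists. -/
def search : Stmt :=
  .while (.lt qHead qTail) (block [
    assign node (queue qHead),
    assign arrow (head node),
    ite (.eq arrow 0) (assign qHead (qHead + 1))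
      (block [
        store head node (prev arrow),
        assign next (arrowDst arrow),
        ite (.eq (mark next) 0) (push next) skip])])

/-- Count the predecessors of every state. -/
def countPreds : Stmt :=
  forLoop col numStates (seq (store predCount col 0)
    (forLoop row numStates (ite (.eq (mark (row * numStates + col)) 0)
      (store predCount col (predCount col + 1)) skip)))

/-- Sort the states by the number of predecessors. -/
def sortStates : Stmt :=
  seq (assign len 0) (forLoop degree numStates (forLoop col numStates
    (ite (.eq (predCount col) degree) (block [store order len col, assign len (len + 1)]) skip)))

/-- Look for a chain whose top is below `state`. -/
def findChain : Stmt :=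
  forLoop cand numChains
    (ite (.eq (mark (top cand * numStates + state)) 0) (assign best cand) skip)

/-- Put the state at position `pos` of the list on top of some chain if this is possible, else on a
new one. -/
def placeState : Stmt :=
  seq (block [assign state (order pos), assign best numChains])
    (seq findChain
      (block [store chain state best, store top best state,
        ite (.eq best numChains) (assign numChains (numChains + 1)) skip]))

/-- Distribute the sorted states to chains. -/
def assignChains : Stmt := forLoop pos numStates placeState

/-- Append a value to the output. -/
def emit (a : Expr) : Stmt := block [store io outPos a, assign outPos (outPos + 1)]

/-- Output the order as a matrix. -/
def emitMatrix : Stmt :=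
  forLoop row numStates (forLoop col numStates
    (ite (.eq row col) (emit 1) (ite (.eq (mark (row * numStates + col)) 0) (emit 1) (emit 0))))

/-- Output the order and the chain decomposition. -/
def emitOrder : Stmt :=
  seq (assign outPos outBase)
    (seq emitMatrix (seq (emit numChains) (forLoop col numStates (emit (chain col)))))

/-- List the states of the chain `cand` as they are sorted. -/
def listChain : Stmt :=
  forLoop pos numStates (ite (.eq (chain (order pos)) cand)
    (block [store listed len (order pos), assign len (len + 1)]) skip)

/-- List the states chain by chain. -/
def listStates : Stmt := seq (assign len 0) (forLoop cand numChains listChain)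

/-- Count the edges with `state` as their entry in `A`. -/
def countEdges (A : Arr) : Stmt :=
  seq (assign len 0)
    (forLoop edge numEdges (ite (.eq (A edge) state) (assign len (len + 1)) skip))

/-- Run `S` for every edge with `state` as its entry in `A`. -/
def forEdges (A : Arr) (S : Stmt) : Stmt :=
  forLoop edge numEdges (ite (.eq (A edge) state) S skip)

/-- For every state output the number of the edges with the state as their entry in `A`, and then
the output of `S` for each of these edges. -/
def emitLists (A : Arr) (S : Stmt) : Stmt :=
  forLoop pos numStates (seq (assign state (listed pos))
    (seq (countEdges A) (seq (emit len) (forEdges A S))))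

/-- Output the entry of `edge` in `OUT`. -/
def emitOut : Stmt := seq (emit (chain (dst edge))) (emit (lab edge))

/-- Output the entry of `edge` in `IN`. -/
def emitIn : Stmt := emit (chain (src edge))

/-- Output the entry of `FINAL` at `pos`. -/
def emitFinal : Stmt := emit (io (4 + 3 * numEdges + listed pos))

/-- Output the Burrows-Wheeler transform. -/
def emitIndex : Stmt :=
  seq (assign outPos outBase) (seq (emit numChains)
    (seq (emitLists src emitOut) (seq (emitLists dst emitIn) (forLoop pos numStates emitFinal))))

/-- Mark the pairs of states `(u, v)` for which `u ≤ v` fails or `u = v`. -/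
def markPairs : Stmt := seq listArrows (seq linkArrows (seq seed search))

/-- Compute a smallest chain decomposition of the order. -/
def sortIntoChains : Stmt := seq countPreds (seq sortStates assignChains)

/-- Compute the maximal order and a smallest chain decomposition. -/
def solve : Stmt := seq readInput (seq markPairs sortIntoChains)

end Programs

/-! ## Correctness of the phases -/

/-- The automaton as it is given in the input: the states are the numbers below `n`, the edges the
numbers below `m`, and `lam` is the table made by `loadEdges`. -/
structure Input where
  n : ℕ
  m : ℕ
  src : ℕ → ℕ
  dst : ℕ → ℕ
  lab : ℕ → ℕ
  lam : ℕ → ℕ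
  fin : ℕ → ℕ
  n_pos : 0 < n
  src_lt : ∀ e < m, src e < n
  dst_lt : ∀ e < m, dst e < n
  lab_lt : ∀ e < m, lab e < m
  lam_dst : ∀ e < m, lam (dst e) = lab e + 1
  lam_eq_zero : ∀ v < n, (∀ e < m, dst e ≠ v) → lam v = 0

namespace Input

variable (G : Input)

/-- A bound for all values in the computation. -/
def size : ℕ := (2 * (G.n + G.m + 4)) ^ 2

theorem size_eq : G.size =
    4 * (G.n * G.n) + 8 * (G.n * G.m) + 4 * (G.m * G.m) + 32 * G.n + 32 * G.m + 64 := by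
  unfold size
  ring

/-- The store at the beginning. -/
structure Start (σ : Store) : Prop where
  n : σ.arr .io 0 = G.n
  m : σ.arr .io 1 = G.m
  src : ∀ e < G.m, σ.arr .io (4 + 3 * e) = G.src e
  dst : ∀ e < G.m, σ.arr .io (5 + 3 * e) = G.dst e
  lab : ∀ e < G.m, σ.arr .io (6 + 3 * e) = G.lab e
  fin : ∀ v < G.n, σ.arr .io (4 + 3 * G.m + v) = G.fin v
  var : ∀ x, σ.var x = 0
  arr : ∀ A, A ≠ .io → ∀ i, σ.arr A i = 0

/-- The store after `readInput`. -/
structure Loaded (σ : Store) : Prop where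
  n : σ.var .numStates = G.n
  m : σ.var .numEdges = G.m
  outBase : σ.var .outBase = 4 + 3 * G.m + G.n
  src : ∀ e < G.m, σ.arr .src e = G.src e
  dst : ∀ e < G.m, σ.arr .dst e = G.dst e
  lab : ∀ e < G.m, σ.arr .lab e = G.lab e
  lam : ∀ v < G.n, σ.arr .lam v = G.lam v
  fin : ∀ v < G.n, σ.arr .io (4 + 3 * G.m + v) = G.fin v

variable {G} {w : ℕ} [WordBound w G.size] {σ : Store}

theorem triple_loadEdges (hσ : G.Start σ) {τ : Store} (harr : τ.arr = σ.arr)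
    (hn : τ.var .numStates = G.n) (hm : τ.var .numEdges = G.m)
    (hout : τ.var .outBase = 4 + 3 * G.m + G.n) :
    Triple w G.size loadEdges τ (G.m * 210 + 10) G.Loaded := by
  have hs := G.size_eq
  have hmn : G.m ≤ G.n * G.m := Nat.le_mul_of_pos_left _ G.n_pos
  refine .forLoop G.m 200 (fun j τ =>
    (∀ e < j, τ.arr .src e = G.src e) ∧ (∀ e < j, τ.arr .dst e = G.dst e) ∧
    (∀ e < j, τ.arr .lab e = G.lab e) ∧ (∀ e < j, τ.arr .lam (G.dst e) = G.lam (G.dst e)) ∧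
    ∀ v, (∀ e < j, G.dst e ≠ v) → τ.arr .lam v = 0) hm (by omega) ?_ ?_ ?_
  · simp [harr, hσ.arr]
  · rintro ρ j hF hj hjm ⟨hsrc, hdst, hlab, hlam, hlam0⟩
    have hio : ρ.arr .io = σ.arr .io := (hF.arr .io rfl).trans (by rw [harr])
    refine .of_wp ?_
    have := G.dst_lt j hjm
    have := G.lab_lt j hjm
    have := G.lam_dst j hjm
    have hBj : 6 + 3 * j < G.size := by omega
    have hB : G.lab j + 1 < G.size ∧ G.dst j < G.size := by omega
    simp [hio, hj, hσ.src j hjm, hσ.dst j hjm, hσ.lab j hjm, Function.update_apply]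
    grind (splits := 20)
  · rintro ρ hF ⟨hsrc, hdst, hlab, hlam, hlam0⟩
    refine ⟨(hF.var _ rfl).trans hn, (hF.var _ rfl).trans hm, (hF.var _ rfl).trans hout, hsrc,
      hdst, hlab, fun v hv => ?_, fun v hv => ?_⟩
    · by_cases h : ∀ e < G.m, G.dst e ≠ v
      · rw [hlam0 v h, G.lam_eq_zero v hv h]
      · push Not at h
        obtain ⟨e, he, rfl⟩ := h
        exact hlam e he
    · rw [hF.arr .io rfl, harr, hσ.fin v hv]

theorem triple_readInput (hσ : G.Start σ) :
    Triple w G.size readInput σ (300 * (G.m + 1)) G.Loaded := by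
  have hs := G.size_eq
  have hmn : G.m ≤ G.n * G.m := Nat.le_mul_of_pos_left _ G.n_pos
  refine .seq 150 (G.m * 210 + 10) (fun τ => τ.arr = σ.arr ∧ τ.var .numStates = G.n ∧
    τ.var .numEdges = G.m ∧ τ.var .outBase = 4 + 3 * G.m + G.n) (by omega) (.of_wp ?_) ?_
  · simp [hσ.n, hσ.m, show 4 + 3 * G.m + G.n < G.size by omega]
    omega
  · rintro τ - ⟨harr, hn, hm, hout⟩
    exact triple_loadEdges hσ harr hn hm hout

end Input

/-- `head` and `prev` are linked lists, in decreasing order, of the arrows `1, …, K` with the same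
source; an entry `0` ends a list. -/
structure LinkedLists (K : ℕ) (source prev head : ℕ → ℕ) : Prop where
  prev_lt : ∀ a, 0 < a → a ≤ K → prev a < a
  source_prev : ∀ a, 0 < a → a ≤ K → prev a ≠ 0 → source (prev a) = source a
  source_ne : ∀ a, 0 < a → a ≤ K → ∀ b, prev a < b → b < a → source b ≠ source a
  head_le : ∀ x, head x ≠ 0 → head x ≤ K
  source_head : ∀ x, head x ≠ 0 → source (head x) = x

/-- The arrows that are still in the linked lists. -/
def listedArrows (K : ℕ) (source head : ℕ → ℕ) : Finset ℕ :=
  {a ∈ Finset.Icc 1 K | a ≤ head (source a)}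

theorem card_listedArrows_le (K : ℕ) (source head : ℕ → ℕ) :
    (listedArrows K source head).card ≤ K :=
  (Finset.card_filter_le _ _).trans (by simp)

namespace LinkedLists

variable {K : ℕ} {source prev head : ℕ → ℕ}

theorem cons (h : LinkedLists K source prev head)
    (hall : ∀ a, 0 < a → a ≤ K → a ≤ head (source a)) :
    LinkedLists (K + 1) source (Function.update prev (K + 1) (head (source (K + 1))))
      (Function.update head (source (K + 1)) (K + 1)) := by
  obtain ⟨hprev, hsource, hne, hle, hhead⟩ := h
  constructor
  · intro a ha haK
    grind
  · intro a ha haK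
    grind
  · intro a ha haK b
    rcases haK.lt_or_eq with hlt | rfl
    · rw [Function.update_of_ne hlt.ne]
      exact hne a ha (by omega) b
    · rw [Function.update_self]
      intro hb hbK h
      have := hall b (by omega) (by omega)
      rw [h] at this
      omega
  · intro x
    have := hle x
    grind
  · intro x
    have := hhead x
    grind

theorem pop (h : LinkedLists K source prev head) {x : ℕ} (hx : head x ≠ 0) :
    LinkedLists K source prev (Function.update head x (prev (head x))) := by
  have hlt := h.prev_lt (head x) (Nat.pos_of_ne_zero hx) (h.head_le x hx)
  have hsource := h.source_prev (head x) (Nat.pos_of_ne_zero hx) (h.head_le x hx)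
  refine ⟨h.prev_lt, h.source_prev, h.source_ne, fun y => ?_, fun y => ?_⟩
  · have := h.head_le x hx
    have := h.head_le y
    grind
  · have := h.source_head x hx
    have := h.source_head y
    grind

theorem head_mem_listedArrows (h : LinkedLists K source prev head) {x : ℕ} (hx : head x ≠ 0) :
    head x ∈ listedArrows K source head := by
  simp [listedArrows, h.source_head x hx, h.head_le x hx, Nat.one_le_iff_ne_zero, hx]

theorem listedArrows_pop (h : LinkedLists K source prev head) {x : ℕ} (hx : head x ≠ 0) :
    listedArrows K source (Function.update head x (prev (head x))) =
      (listedArrows K source head).erase (head x) := by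
  have hpos := Nat.pos_of_ne_zero hx
  have hlt := h.prev_lt _ hpos (h.head_le x hx)
  have hne := h.source_ne _ hpos (h.head_le x hx)
  have hsource := h.source_head x hx
  ext a
  simp only [listedArrows, Finset.mem_filter, Finset.mem_erase, Finset.mem_Icc,
    Function.update_apply]
  grind

theorem card_listedArrows_pop_lt (h : LinkedLists K source prev head) {x : ℕ} (hx : head x ≠ 0) :
    (listedArrows K source (Function.update head x (prev (head x)))).card <
      (listedArrows K source head).card := by
  rw [h.listedArrows_pop hx]
  exact Finset.card_erase_lt_of_mem (h.head_mem_listedArrows hx)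

end LinkedLists

/-- The first `tail` entries of `queue` are the marked numbers, without repetitions, and they are
below `N`. -/
structure Queue (N : ℕ) (mark queue : ℕ → ℕ) (tail : ℕ) : Prop where
  lt : ∀ i < tail, queue i < N
  marked : ∀ i < tail, mark (queue i) ≠ 0
  inj : ∀ i < tail, ∀ j < tail, queue i = queue j → i = j
  mem : ∀ y, mark y ≠ 0 → ∃ i < tail, queue i = y

namespace Queue

variable {N tail : ℕ} {mark queue : ℕ → ℕ}

theorem push (h : Queue N mark queue tail) {a : ℕ} (haN : a < N) (ha : mark a = 0) :
    Queue N (Function.update mark a 1) (Function.update queue tail a) (tail + 1) := by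
  obtain ⟨hlt, hmarked, hinj, hmem⟩ := h
  constructor
  · grind
  · intro i hi
    have := hlt i
    have := hmarked i
    grind
  · grind
  · intro y hy
    by_cases hya : y = a
    · exact ⟨tail, by omega, by rw [Function.update_self, hya]⟩
    · obtain ⟨i, hi, rfl⟩ := hmem y (by rwa [Function.update_of_ne hya] at hy)
      exact ⟨i, by omega, Function.update_of_ne hi.ne ..⟩

theorem tail_le (h : Queue N mark queue tail) : tail ≤ N := by
  have := Finset.card_le_card_of_injOn (s := Finset.range tail) (t := Finset.range N) queue
    (fun i hi => by simpa using h.lt i (by simpa using hi))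
    (fun i hi j hj hij => h.inj i (by simpa using hi) j (by simpa using hj) hij)
  simpa using this

end Queue

/-- The invariant of the graph search: the arrows from numbers in the queue before `qHead` have been
followed, and from `queue qHead` those that are not in the linked lists anymore. -/
structure SearchInv (N K : ℕ) (source target prev mark₀ : ℕ → ℕ) (P : ℕ → Prop)
    (mark queue head : ℕ → ℕ) (qHead qTail : ℕ) : Prop extends
    Queue N mark queue qTail, LinkedLists K source prev head where
  qHead_le : qHead ≤ qTail
  followed : ∀ a, 0 < a → a ≤ K → a ∉ listedArrows K source head → mark (target a) ≠ 0
  head_eq_zero : ∀ i < qHead, head (queue i) = 0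
  sound : ∀ y, mark y ≠ 0 → P y
  mark_mono : ∀ y, mark₀ y ≠ 0 → mark y ≠ 0

namespace SearchInv

variable {N K qHead qTail x : ℕ} {source target prev mark₀ mark queue head : ℕ → ℕ} {P : ℕ → Prop}

theorem dequeue (h : SearchInv N K source target prev mark₀ P mark queue head qHead qTail)
    (hlt : qHead < qTail) (h0 : head (queue qHead) = 0) :
    SearchInv N K source target prev mark₀ P mark queue head (qHead + 1) qTail :=
  { h with
    qHead_le := hlt
    head_eq_zero := fun i hi =>
      (Nat.lt_succ_iff_lt_or_eq.1 hi).elim (h.head_eq_zero i) (by rintro rfl; exact h0) }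

theorem follow_of_marked (h : SearchInv N K source target prev mark₀ P mark queue head qHead qTail)
    (hlt : qHead < qTail) (hx : queue qHead = x) (hne : head x ≠ 0)
    (hm : mark (target (head x)) ≠ 0) :
    SearchInv N K source target prev mark₀ P mark queue (Function.update head x (prev (head x)))
      qHead qTail :=
  { h with
    toLinkedLists := h.pop hne
    followed := fun a ha haK => by
      rw [h.listedArrows_pop hne, Finset.mem_erase, not_and_or, not_not]
      rintro (rfl | ha')
      exacts [hm, h.followed a ha haK ha']
    head_eq_zero := fun i hi => by
      rw [Function.update_of_ne, h.head_eq_zero i hi]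
      rintro rfl
      have := h.inj i (hi.trans hlt) qHead hlt hx.symm
      omega }

theorem push (h : SearchInv N K source target prev mark₀ P mark queue head qHead qTail) {y : ℕ}
    (hy : mark y = 0) (hyN : y < N) (hP : P y) :
    SearchInv N K source target prev mark₀ P (Function.update mark y 1)
      (Function.update queue qTail y) head qHead (qTail + 1) := by
  have hmono (z : ℕ) (hz : mark z ≠ 0) : Function.update mark y 1 z ≠ 0 := by grind
  refine ⟨h.toQueue.push hyN hy, h.toLinkedLists, by grind [h.qHead_le],
    fun a ha haK hal => hmono _ (h.followed a ha haK hal), fun i hi => ?_, fun z => ?_,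
    fun z hz => hmono z (h.mark_mono z hz)⟩
  · rw [Function.update_of_ne (hi.trans_le h.qHead_le).ne, h.head_eq_zero i hi]
  · have := h.sound z
    grind

theorem push_follow (h : SearchInv N K source target prev mark₀ P mark queue head qHead qTail)
    (hstep : ∀ a, 0 < a → a ≤ K → P (source a) → P (target a)) (hlt : qHead < qTail)
    (hx : queue qHead = x) (hne : head x ≠ 0) (hN : target (head x) < N)
    (hm : mark (target (head x)) = 0) :
    SearchInv N K source target prev mark₀ P (Function.update mark (target (head x)) 1)
      (Function.update queue qTail (target (head x)))
      (Function.update head x (prev (head x))) qHead (qTail + 1) := by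
  have hP : P (source (head x)) := by
    rw [h.source_head x hne, ← hx]
    exact h.sound _ (h.marked _ hlt)
  exact (h.push hm hN (hstep _ (Nat.pos_of_ne_zero hne) (h.head_le x hne) hP)).follow_of_marked
    (Nat.lt_succ_of_lt hlt) ((Function.update_of_ne hlt.ne ..).trans hx) hne (by simp)

end SearchInv

namespace Input

variable {G : Input} {w : ℕ} {σ : Store}

theorem Loaded.of_frame {S : Stmt} {τ : Store} (h : G.Loaded σ) (hF : Frame S σ τ)
    (hvar : ∀ x ∈ [.numStates, .numEdges, .outBase], S.writesVar x = false := by decide)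
    (harr : ∀ A ∈ [.src, .dst, .lab, .lam, .io], S.writesArr A = false := by decide) :
    G.Loaded τ := by
  simp only [List.forall_mem_cons, List.not_mem_nil, IsEmpty.forall_iff, implies_true,
    and_true] at hvar harr
  obtain ⟨hn, hm, hout⟩ := hvar
  obtain ⟨hsrc, hdst, hlab, hlam, hio⟩ := harr
  exact ⟨(hF.var _ hn).trans h.n, (hF.var _ hm).trans h.m, (hF.var _ hout).trans h.outBase,
    hF.arr _ hsrc ▸ h.src, hF.arr _ hdst ▸ h.dst, hF.arr _ hlab ▸ h.lab, hF.arr _ hlam ▸ h.lam,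
    hF.arr _ hio ▸ h.fin⟩

/-- The arrows `1, …, K` come from pairs of edges whose heads have the same label, and they include
those from the pairs in `P`. -/
structure Arrows (G : Input) (P : ℕ → ℕ → Prop) (K : ℕ) (source target : ℕ → ℕ) : Prop where
  sound : ∀ a, 0 < a → a ≤ K → ∃ e < G.m, ∃ f < G.m, G.lam (G.dst e) = G.lam (G.dst f) ∧
    source a = G.src e * G.n + G.src f ∧ target a = G.dst e * G.n + G.dst f
  complete : ∀ e < G.m, ∀ f < G.m, P e f → G.lam (G.dst e) = G.lam (G.dst f) →
    ∃ a, 0 < a ∧ a ≤ K ∧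
      source a = G.src e * G.n + G.src f ∧ target a = G.dst e * G.n + G.dst f

namespace Arrows

variable {P P' : ℕ → ℕ → Prop} {K : ℕ} {source target : ℕ → ℕ}

theorem mono (h : G.Arrows P K source target)
    (hP : ∀ e < G.m, ∀ f < G.m, P' e f → G.lam (G.dst e) = G.lam (G.dst f) → P e f) :
    G.Arrows P' K source target :=
  ⟨h.sound, fun e he f hf hp hl => h.complete e he f hf (hP e he f hf hp hl) hl⟩

theorem snoc (h : G.Arrows P K source target) {i j : ℕ} (hi : i < G.m) (hj : j < G.m)
    (hl : G.lam (G.dst i) = G.lam (G.dst j))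
    (hP : ∀ e < G.m, ∀ f < G.m, P' e f → P e f ∨ e = i ∧ f = j) :
    G.Arrows P' (K + 1) (Function.update source (K + 1) (G.src i * G.n + G.src j))
      (Function.update target (K + 1) (G.dst i * G.n + G.dst j)) := by
  constructor
  · intro a ha haK
    rcases Nat.le_succ_iff.1 haK with haK | rfl
    · obtain ⟨e, he, f, hf, hef⟩ := h.sound a ha haK
      exact ⟨e, he, f, hf, by simpa [Function.update_of_ne (show a ≠ K + 1 by omega)] using hef⟩
    · exact ⟨i, hi, j, hj, hl, Function.update_self .., Function.update_self ..⟩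
  · intro e he f hf hp hl
    rcases hP e he f hf hp with hp | ⟨rfl, rfl⟩
    · obtain ⟨a, ha, haK, hsource, htarget⟩ := h.complete e he f hf hp hl
      have hne : a ≠ K + 1 := by omega
      exact ⟨a, ha, by omega, by rwa [Function.update_of_ne hne],
        by rwa [Function.update_of_ne hne]⟩
    · exact ⟨K + 1, by omega, le_rfl, Function.update_self .., Function.update_self ..⟩

theorem lt (h : G.Arrows P K source target) {a : ℕ} (ha : 0 < a) (haK : a ≤ K) :
    source a < G.n * G.n ∧ target a < G.n * G.n := by
  obtain ⟨e, he, f, hf, -, hsource, htarget⟩ := h.sound a ha haK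
  rw [hsource, htarget]
  exact ⟨mul_add_lt_mul (G.src_lt e he) (G.src_lt f hf),
    mul_add_lt_mul (G.dst_lt e he) (G.dst_lt f hf)⟩

end Arrows

variable [WordBound w G.size]

theorem triple_listArrows (hσ : G.Loaded σ) (hlen : σ.var .len = 0) :
    Triple w G.size listArrows σ (G.m * (G.m * 210 + 20) + 10)
      (fun τ => G.Arrows (fun _ _ => True) (τ.var .len) (τ.arr .arrowSrc) (τ.arr .arrowDst) ∧
        τ.var .len ≤ G.m * G.m) := by
  have hs := G.size_eq
  have hmn : G.m ≤ G.n * G.m := Nat.le_mul_of_pos_left _ G.n_pos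
  have hnn : G.n ≤ G.n * G.n := Nat.le_mul_of_pos_left _ G.n_pos
  refine .forLoop G.m (G.m * 210 + 10) (fun i τ =>
    G.Arrows (fun e _ => e < i) (τ.var .len) (τ.arr .arrowSrc) (τ.arr .arrowDst) ∧
      τ.var .len ≤ i * G.m) hσ.m (by rw [add_assoc]) ?_ ?_ ?_
  · suffices G.Arrows (fun _ _ => False) 0 (σ.arr .arrowSrc) (σ.arr .arrowDst) by
      simpa [hlen] using this
    exact ⟨fun a ha ha0 => by omega, fun _ _ _ _ h => h.elim⟩
  · rintro ρ i hF hi him ⟨hA, hlen⟩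
    have hL := hσ.of_frame hF
    refine .forLoop G.m 200 (fun j τ =>
      G.Arrows (fun e f => e < i ∨ e = i ∧ f < j) (τ.var .len) (τ.arr .arrowSrc)
        (τ.arr .arrowDst) ∧ τ.var .len ≤ i * G.m + j) hL.m le_rfl ?_ ?_ ?_
    · simpa using ⟨hA, hlen⟩
    · rintro ρ' j hF' hj hjm ⟨hA', hlen'⟩
      have hL' := hL.of_frame hF'
      have hi' : ρ'.var .edge = i := (hF'.var _ rfl).trans hi
      refine .of_wp ?_
      have hdi := G.dst_lt i him
      have hdj := G.dst_lt j hjm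
      have hsrc := mul_add_lt_mul (G.src_lt i him) (G.src_lt j hjm)
      have hdst := mul_add_lt_mul hdi hdj
      have hlen_lt := mul_add_lt_mul him hjm
      have hskip (hne : G.lam (G.dst i) ≠ G.lam (G.dst j)) :=
        hA'.mono (P' := fun e f => e < i ∨ e = i ∧ f ≤ j) fun e _ f _ hp hl => by grind
      have hsnoc (hl : G.lam (G.dst i) = G.lam (G.dst j)) :=
        hA'.snoc (P' := fun e f => e < i ∨ e = i ∧ f ≤ j) him hjm hl fun e _ f _ hp => by omega
      simp [hL'.n, hL'.src, hL'.dst, hL'.lam, hi', hj, him, hjm, hdi, hdj]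
      grind (splits := 20)
    · rintro τ - ⟨hA', hlen'⟩
      simp only [Store.setVar_var, Store.setVar_arr, reduceCtorEq, if_false, add_one_mul]
      exact ⟨hA'.mono fun e _ f _ _ _ => by omega, hlen'⟩
  · rintro τ - ⟨hA, hlen⟩
    exact ⟨hA.mono fun e he _ _ _ _ => he, hlen⟩

theorem triple_linkArrows {K : ℕ} (hlen : σ.var .len = K) (hK : K ≤ G.m * G.m)
    (hlt : ∀ a, 0 < a → a ≤ K → σ.arr .arrowSrc a < G.n * G.n) (h0 : ∀ x, σ.arr .head x = 0) :
    Triple w G.size linkArrows σ (K * 210 + 10)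
      (fun τ => LinkedLists K (σ.arr .arrowSrc) (τ.arr .prev) (τ.arr .head) ∧
        ∀ a, 0 < a → a ≤ K → a ≤ τ.arr .head (σ.arr .arrowSrc a)) := by
  have hs := G.size_eq
  refine .forLoop K 200 (fun j τ =>
    LinkedLists j (σ.arr .arrowSrc) (τ.arr .prev) (τ.arr .head) ∧
      ∀ a, 0 < a → a ≤ j → a ≤ τ.arr .head (σ.arr .arrowSrc a)) hlen le_rfl ?_ ?_ ?_
  · refine ⟨⟨?_, ?_, ?_, ?_, ?_⟩, ?_⟩ <;> simp [h0] <;> omega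
  · rintro ρ j hF hj hjK ⟨hlists, hall⟩
    have hsource : ρ.arr .arrowSrc = σ.arr .arrowSrc := hF.arr _ rfl
    have hlt := hlt (j + 1) (by omega) (by omega)
    have hlists' := hlists.cons hall
    have := hlists.head_le (σ.arr .arrowSrc (j + 1))
    refine .of_wp ?_
    simp [hj, hsource]
    grind
  · exact fun τ _ h => h

end Input

namespace SearchInv

variable {N K qHead qTail : ℕ} {source target prev mark₀ mark queue head : ℕ → ℕ} {P : ℕ → Prop}

theorem init (hqueue : Queue N mark queue qTail) (hlists : LinkedLists K source prev head)
    (hall : ∀ a, 0 < a → a ≤ K → a ≤ head (source a)) (hP : ∀ y, mark y ≠ 0 → P y) :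
    SearchInv N K source target prev mark P mark queue head 0 qTail where
  toQueue := hqueue
  toLinkedLists := hlists
  qHead_le := qTail.zero_le
  followed a ha haK hal := by simp [listedArrows, hall a ha haK] at hal; omega
  head_eq_zero i hi := absurd hi i.not_lt_zero
  sound := hP
  mark_mono _ h := h

theorem mark_target (h : SearchInv N K source target prev mark₀ P mark queue head qHead qTail)
    (hdone : qTail ≤ qHead) {a : ℕ} (ha : 0 < a) (haK : a ≤ K) (hm : mark (source a) ≠ 0) :
    mark (target a) ≠ 0 := by
  obtain ⟨i, hi, hqueue⟩ := h.mem _ hm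
  have h0 := h.head_eq_zero i (hi.trans_le hdone)
  refine h.followed a ha haK ?_
  rw [hqueue] at h0
  simp [listedArrows, h0, ha.ne']

end SearchInv

namespace Input

/-- The marked numbers are those of the pairs in `P`. -/
structure MarkedPairs (G : Input) (P : ℕ → ℕ → Prop) (mark queue : ℕ → ℕ) (tail : ℕ) : Prop extends
    Queue (G.n * G.n) mark queue tail where
  mark_ne_zero : ∀ u < G.n, ∀ v < G.n, mark (u * G.n + v) ≠ 0 ↔ P u v

namespace MarkedPairs

variable {G : Input} {P P' : ℕ → ℕ → Prop} {mark queue : ℕ → ℕ} {tail : ℕ}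

theorem congr (h : G.MarkedPairs P mark queue tail)
    (hP : ∀ u < G.n, ∀ v < G.n, P' u v ↔ P u v) : G.MarkedPairs P' mark queue tail :=
  { h with mark_ne_zero := fun u hu v hv => (h.mark_ne_zero u hu v hv).trans (hP u hu v hv).symm }

theorem push (h : G.MarkedPairs P mark queue tail) {i j : ℕ} (hi : i < G.n) (hj : j < G.n)
    (hij : ¬ P i j) (hP : ∀ u < G.n, ∀ v < G.n, P' u v ↔ P u v ∨ u = i ∧ v = j) :
    G.MarkedPairs P' (Function.update mark (i * G.n + j) 1)
      (Function.update queue tail (i * G.n + j)) (tail + 1) where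
  toQueue := h.toQueue.push (mul_add_lt_mul hi hj)
    (by simpa using (h.mark_ne_zero i hi j hj).not.2 hij)
  mark_ne_zero u hu v hv := by
    have := h.mark_ne_zero u hu v hv
    rw [hP u hu v hv, ← mul_add_inj hv hj, Function.update_apply]
    grind

theorem of_mark (h : G.MarkedPairs P mark queue tail) {y : ℕ} (hy : mark y ≠ 0) :
    ∃ u < G.n, ∃ v < G.n, P u v ∧ y = u * G.n + v := by
  obtain ⟨i, hi, rfl⟩ := h.mem y hy
  have hu : queue i / G.n < G.n := Nat.div_lt_of_lt_mul (h.lt i hi)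
  have hv := Nat.mod_lt (queue i) G.n_pos
  rw [← Nat.div_add_mod' (queue i) G.n] at hy
  exact ⟨_, hu, _, hv, (h.mark_ne_zero _ hu _ hv).1 hy, (Nat.div_add_mod' _ _).symm⟩

end MarkedPairs

variable {G : Input} {w : ℕ} [WordBound w G.size] {σ : Store}

theorem triple_seed (hσ : G.Loaded σ) (htail : σ.var .qTail = 0) (hmark : ∀ y, σ.arr .mark y = 0) :
    Triple w G.size seed σ (G.n * (G.n * 210 + 20) + 10)
      (fun τ => G.MarkedPairs (fun u v => G.lam v < G.lam u ∨ u = v) (τ.arr .mark) (τ.arr .queue)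
        (τ.var .qTail)) := by
  have hs := G.size_eq
  have hnn : G.n ≤ G.n * G.n := Nat.le_mul_of_pos_left _ G.n_pos
  refine .forLoop G.n (G.n * 210 + 10) (fun i τ => G.MarkedPairs
    (fun u v => u < i ∧ (G.lam v < G.lam u ∨ u = v)) (τ.arr .mark) (τ.arr .queue)
    (τ.var .qTail)) hσ.n (by rw [add_assoc]) ?_ ?_ ?_
  · refine ⟨⟨?_, ?_, ?_, ?_⟩, ?_⟩ <;> simp [htail, hmark]
  · intro ρ i hF hi hin hI
    have hL := hσ.of_frame hF
    refine .forLoop G.n 200 (fun j τ => G.MarkedPairs (fun u v => (u < i ∨ u = i ∧ v < j) ∧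
      (G.lam v < G.lam u ∨ u = v)) (τ.arr .mark) (τ.arr .queue) (τ.var .qTail)) hL.n le_rfl ?_ ?_ ?_
    · simpa using hI
    · intro ρ' j hF' hj hjn hI'
      have hL' := hL.of_frame hF'
      have hi' : ρ'.var .row = i := (hF'.var _ rfl).trans hi
      have htail_le := hI'.toQueue.tail_le
      have hpair := mul_add_lt_mul hin hjn
      have hpush (h : G.lam j < G.lam i ∨ i = j) :=
        hI'.push (P' := fun u v => (u < i ∨ u = i ∧ v ≤ j) ∧ (G.lam v < G.lam u ∨ u = v)) hin hjn
          (by omega) fun u _ v _ => by grind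
      have hskip (h : ¬ (G.lam j < G.lam i ∨ i = j)) :=
        hI'.congr (P' := fun u v => (u < i ∨ u = i ∧ v ≤ j) ∧ (G.lam v < G.lam u ∨ u = v))
          fun u _ v _ => by grind
      refine .of_wp ?_
      simp [push, hL'.n, hL'.lam, hi', hj, hin, hjn]
      grind (splits := 20)
    · intro τ _ hI'
      exact hI'.congr fun u _ v hv => by simp only [Nat.lt_succ_iff_lt_or_eq, hv, and_true]
  · intro τ _ hI
    exact hI.congr fun u hu v _ => by simp only [hu, true_and]

theorem triple_search {N K : ℕ} (hK : K ≤ G.m * G.m) (hN : N ≤ G.n * G.n) {P : ℕ → Prop}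
    (hstep : ∀ a, 0 < a → a ≤ K → P (σ.arr .arrowSrc a) → P (σ.arr .arrowDst a))
    (hdst : ∀ a, 0 < a → a ≤ K → σ.arr .arrowDst a < N) (hhead : σ.var .qHead = 0)
    (hσ : SearchInv N K (σ.arr .arrowSrc) (σ.arr .arrowDst) (σ.arr .prev) (σ.arr .mark) P
      (σ.arr .mark) (σ.arr .queue) (σ.arr .head) 0 (σ.var .qTail)) :
    Triple w G.size search σ ((N + K) * 210 + 10)
      (fun τ => (∀ y, τ.arr .mark y ≠ 0 → P y) ∧ (∀ y, σ.arr .mark y ≠ 0 → τ.arr .mark y ≠ 0) ∧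
        ∀ a, 0 < a → a ≤ K → τ.arr .mark (σ.arr .arrowSrc a) ≠ 0 →
          τ.arr .mark (σ.arr .arrowDst a) ≠ 0) := by
  have hs := G.size_eq
  refine (Triple.while_variant (T := 200) rfl
    (fun τ => SearchInv N K (σ.arr .arrowSrc) (σ.arr .arrowDst) (σ.arr .prev) (σ.arr .mark) P
      (τ.arr .mark) (τ.arr .queue) (τ.arr .head) (τ.var .qHead) (τ.var .qTail))
    (fun τ => (N - τ.var .qHead) + (listedArrows K (σ.arr .arrowSrc) (τ.arr .head)).card)
    ?_ ?_ (hhead ▸ hσ)).mono ?_ ?_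
  · exact fun _ _ => ⟨trivial, trivial⟩
  · intro ρ hF hI hlt
    have htarget : ρ.arr .arrowDst = σ.arr .arrowDst := hF.arr _ rfl
    have hprev : ρ.arr .prev = σ.arr .prev := hF.arr _ rfl
    replace hlt : ρ.var .qHead < ρ.var .qTail := hlt
    have htail := hI.toQueue.tail_le
    obtain ⟨x, hx⟩ : ∃ x, ρ.arr .queue (ρ.var .qHead) = x := ⟨_, rfl⟩
    obtain ⟨a, ha⟩ : ∃ a, ρ.arr .head x = a := ⟨_, rfl⟩
    have hxN : x < N := hx ▸ hI.lt _ hlt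
    have hdequeue (h0 : a = 0) := hI.dequeue hlt (by rw [hx, ha, h0])
    have haK (hne : a ≠ 0) : a ≤ K := ha ▸ hI.head_le x (ha ▸ hne)
    have htargetN (hne : a ≠ 0) : σ.arr .arrowDst a < N :=
      hdst a (Nat.pos_of_ne_zero hne) (haK hne)
    have hcard (hne : a ≠ 0) := hI.card_listedArrows_pop_lt (x := x) (ha ▸ hne)
    have hfollow (hne : a ≠ 0) (hm : ρ.arr .mark (σ.arr .arrowDst a) ≠ 0) :=
      hI.follow_of_marked hlt hx (ha ▸ hne) (by rwa [ha])
    have hpush (hne : a ≠ 0) (hm : ρ.arr .mark (σ.arr .arrowDst a) = 0) :=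
      hI.push_follow hstep hlt hx (ha ▸ hne) (by rw [ha]; exact htargetN hne) (by rwa [ha])
    rw [ha] at hfollow hpush hcard
    refine .of_wp ?_
    simp [push, hx, ha, htarget, hprev]
    grind (splits := 20)
  · have hcard := card_listedArrows_le K (σ.arr .arrowSrc) (σ.arr .head)
    have := Nat.mul_le_mul_right 203 (Nat.add_le_add (Nat.sub_le N (σ.var .qHead)) hcard)
    simp [Cond.cost, Cond.left, Cond.right, Expr.cost]
    omega
  · rintro τ - ⟨hI, hdone⟩
    exact ⟨hI.sound, hI.mark_mono, fun a ha haK hm => hI.mark_target (not_lt.1 hdone) ha haK hm⟩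

end Input

theorem numPreds_le {n : ℕ} {lt : ℕ → ℕ → Prop} (v : ℕ) : numPreds n lt v ≤ n := by
  classical
  simpa [numPreds] using Finset.card_filter_le (Finset.range n) fun u => lt u v

open Classical in
theorem numPreds_zero {lt : ℕ → ℕ → Prop} (v : ℕ) : numPreds 0 lt v = 0 := by
  simp [numPreds]

open Classical in
theorem numPreds_succ (n : ℕ) (lt : ℕ → ℕ → Prop) (v : ℕ) :
    numPreds (n + 1) lt v = if lt n v then numPreds n lt v + 1 else numPreds n lt v := by
  unfold numPreds
  rw [Finset.range_add_one, Finset.filter_insert]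
  split_ifs <;> simp

namespace Input

variable {G : Input} {w : ℕ} [WordBound w G.size] {σ : Store} {lt : ℕ → ℕ → Prop}

theorem triple_countPreds (hn : σ.var .numStates = G.n)
    (hmark : ∀ u < G.n, ∀ v < G.n, σ.arr .mark (u * G.n + v) = 0 ↔ lt u v) :
    Triple w G.size countPreds σ (G.n * (G.n * 210 + 230) + 10)
      (fun τ => ∀ v < G.n, τ.arr .predCount v = numPreds G.n lt v) := by
  have hs := G.size_eq
  have hnn : G.n ≤ G.n * G.n := Nat.le_mul_of_pos_left _ G.n_pos
  refine .forLoop G.n (G.n * 210 + 220) (fun j τ => ∀ v < j, τ.arr .predCount v = numPreds G.n lt v)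
    hn (by rw [add_assoc]) (by simp) ?_ fun _ _ h => h
  intro ρ j hF hj hjn hI
  have hnρ : ρ.var .numStates = G.n := (hF.var _ rfl).trans hn
  refine .seq 200 (G.n * 210 + 10)
    (fun τ => (∀ v < j, τ.arr .predCount v = numPreds G.n lt v) ∧ τ.arr .predCount j = 0)
    (by omega) (.of_wp ?_) ?_
  · simp [hj]
    grind
  rintro ρ₁ hF₁ ⟨hI₁, h0⟩
  refine .forLoop G.n 200 (fun i τ => (∀ v < j, τ.arr .predCount v = numPreds G.n lt v) ∧
    τ.arr .predCount j = numPreds i lt j) ((hF₁.var _ rfl).trans hnρ) (by omega) ?_ ?_ ?_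
  · simpa [h0, numPreds_zero] using hI₁
  · rintro ρ₂ i hF₂ hi hin ⟨hI₂, hcount⟩
    have hj₂ : ρ₂.var .col = j := (hF₂.var _ rfl).trans ((hF₁.var _ rfl).trans hj)
    have hn₂ : ρ₂.var .numStates = G.n := (hF₂.var _ rfl).trans ((hF₁.var _ rfl).trans hnρ)
    have hmark₂ : ρ₂.arr .mark = σ.arr .mark :=
      (hF₂.arr _ rfl).trans ((hF₁.arr _ rfl).trans (hF.arr _ rfl))
    have hlt := mul_add_lt_mul hin hjn
    have hle := numPreds_le (n := i) (lt := lt) j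
    have hsucc := numPreds_succ i lt j
    refine .of_wp ?_
    simp [hi, hj₂, hn₂, hmark₂, hmark i hin j hjn, hcount]
    grind (splits := 20)
  · rintro τ - ⟨hI₂, hcount⟩ v hv
    rcases Nat.lt_succ_iff_lt_or_eq.1 hv with hv | rfl
    · exact hI₂ v hv
    · exact hcount

theorem triple_sortStates (hn : σ.var .numStates = G.n) (hlt : IntervalOrder G.n lt)
    (hcount : ∀ v < G.n, σ.arr .predCount v = numPreds G.n lt v) :
    Triple w G.size sortStates σ (G.n * (G.n * 210 + 20) + 20)
      (fun τ => Sorted G.n lt (τ.arr .order)) := by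
  have hs := G.size_eq
  have hnn : G.n ≤ G.n * G.n := Nat.le_mul_of_pos_left _ G.n_pos
  refine .seq 2 (G.n * (G.n * 210 + 20) + 10) (fun τ => τ.var .len = 0) (by omega)
    (.of_wp (by simp; omega)) ?_
  intro σ₁ hF₁ hlen
  have hn₁ : σ₁.var .numStates = G.n := (hF₁.var _ rfl).trans hn
  refine .forLoop G.n (G.n * 210 + 10) (fun j τ => Listing G.n (PredLT G.n lt)
    (fun v => numPreds G.n lt v < j) (τ.var .len) (τ.arr .order)) hn₁ le_rfl ?_ ?_ ?_
  · constructor <;> simp [hlen]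
  · intro ρ j hF hj hjn hI
    refine .forLoop G.n 200 (fun i τ => Listing G.n (PredLT G.n lt)
      (fun v => numPreds G.n lt v < j ∨ numPreds G.n lt v = j ∧ v < i) (τ.var .len) (τ.arr .order))
      ((hF.var _ rfl).trans hn₁) le_rfl (by simpa using hI) ?_ ?_
    · intro ρ₂ i hF₂ hi hin hI₂
      have hj₂ : ρ₂.var .degree = j := (hF₂.var _ rfl).trans hj
      have hcount₂ : ρ₂.arr .predCount = σ.arr .predCount :=
        (hF₂.arr _ rfl).trans ((hF.arr _ rfl).trans (hF₁.arr _ rfl))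
      have hle := hI₂.le PredLT.irrefl
      have hsnoc (h : numPreds G.n lt i = j) := hI₂.snoc
        (P' := fun v => numPreds G.n lt v < j ∨ numPreds G.n lt v = j ∧ v ≤ i) hin
        (fun u _ => by grind) (fun u _ => by unfold PredLT; omega)
      have hskip (h : numPreds G.n lt i ≠ j) := hI₂.congr
        (P' := fun v => numPreds G.n lt v < j ∨ numPreds G.n lt v = j ∧ v ≤ i)
        fun u _ => by grind
      refine .of_wp ?_
      simp [hi, hj₂, hcount₂, hcount i hin]
      grind (splits := 20)
    · intro τ _ hI₂
      exact hI₂.congr fun u _ => by omega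
  · intro τ _ hI
    have hall := hI.congr (P' := fun _ => True) fun v hv => by simpa using hlt.numPreds_lt hv
    exact hall.eq PredLT.irrefl ▸ hall

end Input

theorem Chains.zero {n : ℕ} (lt : ℕ → ℕ → Prop) (ord chain : ℕ → ℕ) :
    Chains n lt ord 0 0 chain where
  p_le := le_rfl
  chain_lt _ hj := absurd hj (Nat.not_lt_zero _)
  asc _ j' _ hj' := absurd hj' j'.not_lt_zero
  first h := absurd h (lt_irrefl 0)
  surj c hc := absurd hc c.not_lt_zero
  antichain := ⟨fun _ => 0, fun c hc => absurd hc c.not_lt_zero,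
    fun c hc => absurd hc c.not_lt_zero⟩

theorem IsTop.top_lt {n i p : ℕ} {lt : ℕ → ℕ → Prop} {ord chain top : ℕ → ℕ}
    (hT : IsTop ord i p chain top) (hS : Sorted n lt ord) (hi : i ≤ n) {c : ℕ} (hc : c < p) :
    top c < n := by
  obtain ⟨j, hj, htop, -⟩ := hT c hc
  exact htop ▸ hS.ord_lt j (hj.trans_le hi)

/-- The result of a search for a chain among the first `c` of `p` chains: `best` is a chain with top
below `v`, or it is `p` if there is none. -/
def BestChain (lt : ℕ → ℕ → Prop) (top : ℕ → ℕ) (v p c best : ℕ) : Prop :=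
  best = p ∧ (∀ c' < c, ¬ lt (top c') v) ∨ best < p ∧ lt (top best) v

namespace Input

variable {G : Input} {w : ℕ} [WordBound w G.size] {σ : Store} {lt : ℕ → ℕ → Prop}

theorem triple_findChain (hn : σ.var .numStates = G.n)
    (hmark : ∀ u < G.n, ∀ v < G.n, σ.arr .mark (u * G.n + v) = 0 ↔ lt u v)
    (hstate : σ.var .state < G.n) (hp : σ.var .numChains ≤ G.n)
    (htop : ∀ c < σ.var .numChains, σ.arr .top c < G.n) (hbest : σ.var .best = σ.var .numChains) :
    Triple w G.size findChain σ (σ.var .numChains * 210 + 10)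
      (fun τ => BestChain lt (σ.arr .top) (σ.var .state) (σ.var .numChains) (σ.var .numChains)
        (τ.var .best)) := by
  have hs := G.size_eq
  have hnn : G.n ≤ G.n * G.n := Nat.le_mul_of_pos_left _ G.n_pos
  refine .forLoop (σ.var .numChains) 200 (fun c τ => BestChain lt (σ.arr .top) (σ.var .state)
    (σ.var .numChains) c (τ.var .best)) rfl le_rfl ?_ ?_ fun _ _ h => h
  · exact Or.inl ⟨hbest, fun c hc => absurd hc c.not_lt_zero⟩
  · intro ρ c hF hc hcp hI
    have htopρ : ρ.arr .top = σ.arr .top := hF.arr _ rfl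
    have hnρ : ρ.var .numStates = G.n := (hF.var _ rfl).trans hn
    have hstateρ : ρ.var .state = σ.var .state := hF.var _ rfl
    have hmarkρ : ρ.arr .mark = σ.arr .mark := hF.arr _ rfl
    have hpair := mul_add_lt_mul (htop c hcp) hstate
    have := htop c hcp
    unfold BestChain at hI ⊢
    refine .of_wp ?_
    simp [hc, htopρ, hnρ, hstateρ, hmarkρ, hmark _ (htop c hcp) _ hstate]
    grind (splits := 20)

theorem triple_placeState {ord : ℕ → ℕ} {i : ℕ} (hn : σ.var .numStates = G.n)
    (hlt : IntervalOrder G.n lt)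
    (hmark : ∀ u < G.n, ∀ v < G.n, σ.arr .mark (u * G.n + v) = 0 ↔ lt u v)
    (horder : σ.arr .order = ord) (hS : Sorted G.n lt ord) (hpos : σ.var .pos = i) (hi : i < G.n)
    (hC : Chains G.n lt ord i (σ.var .numChains) (σ.arr .chain))
    (hT : IsTop ord i (σ.var .numChains) (σ.arr .chain) (σ.arr .top)) :
    Triple w G.size placeState σ (G.n * 210 + 410) (fun τ =>
      Chains G.n lt ord (i + 1) (τ.var .numChains) (τ.arr .chain) ∧
      IsTop ord (i + 1) (τ.var .numChains) (τ.arr .chain) (τ.arr .top)) := by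
  have hs := G.size_eq
  have hnn : G.n ≤ G.n * G.n := Nat.le_mul_of_pos_left _ G.n_pos
  have hpi := hC.p_le
  have hv := hS.ord_lt i hi
  refine .seq 100 (G.n * 210 + 310)
    (fun τ => τ.var .state = ord i ∧ τ.var .best = σ.var .numChains) (by omega) (.of_wp ?_) ?_
  · simp [hpos, horder]
    omega
  rintro ρ hF ⟨hstate, hbest⟩
  have hp : ρ.var .numChains = σ.var .numChains := hF.var _ rfl
  have htop : ρ.arr .top = σ.arr .top := hF.arr _ rfl
  have hmarkρ : ρ.arr .mark = σ.arr .mark := hF.arr _ rfl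
  refine .seq (ρ.var .numChains * 210 + 10) 100 _ (by omega)
    (triple_findChain (lt := lt) ((hF.var _ rfl).trans hn) (hmarkρ ▸ hmark) (hstate ▸ hv)
      (hp.trans_le (hpi.trans hi.le)) (fun c hc => htop ▸ hT.top_lt hS hi.le (hp ▸ hc))
      (hbest.trans hp.symm)) ?_
  rw [hstate, hp, htop]
  intro ρ₁ hF₁ hbest₁
  have hp₁ : ρ₁.var .numChains = σ.var .numChains := (hF₁.var _ rfl).trans hp
  have hstate₁ : ρ₁.var .state = ord i := (hF₁.var _ rfl).trans hstate
  have htop₁ : ρ₁.arr .top = σ.arr .top := (hF₁.arr _ rfl).trans htop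
  have hchain₁ : ρ₁.arr .chain = σ.arr .chain := (hF₁.arr _ rfl).trans (hF.arr _ rfl)
  have hopen (hv : ∀ c < σ.var .numChains, ¬ lt (σ.arr .top c) (ord i)) :=
    hC.open_chain hlt hS hT hi hv
  have hextend {r : ℕ} (hr : r < σ.var .numChains) (hrv : lt (σ.arr .top r) (ord i)) :=
    hC.extend_chain hlt hS hT hi hr hrv
  refine .of_wp ?_
  unfold BestChain at hbest₁
  simp [hp₁, hstate₁, htop₁, hchain₁]
  grind (splits := 20)

theorem triple_assignChains (hn : σ.var .numStates = G.n) (hp : σ.var .numChains = 0)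
    (hlt : IntervalOrder G.n lt)
    (hmark : ∀ u < G.n, ∀ v < G.n, σ.arr .mark (u * G.n + v) = 0 ↔ lt u v)
    (hS : Sorted G.n lt (σ.arr .order)) :
    Triple w G.size assignChains σ (G.n * (G.n * 210 + 420) + 10)
      (fun τ => Chains G.n lt (σ.arr .order) G.n (τ.var .numChains) (τ.arr .chain)) := by
  refine .forLoop G.n (G.n * 210 + 410) (fun i τ =>
    Chains G.n lt (σ.arr .order) i (τ.var .numChains) (τ.arr .chain) ∧
    IsTop (σ.arr .order) i (τ.var .numChains) (τ.arr .chain) (τ.arr .top)) hn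
    (by rw [add_assoc]) ⟨?_, ?_⟩ ?_ fun _ _ h => h.1
  · simpa [hp] using Chains.zero ..
  · simp [hp, IsTop]
  · rintro ρ i hF hi hin ⟨hC, hT⟩
    have hmarkρ : ρ.arr .mark = σ.arr .mark := hF.arr _ rfl
    exact triple_placeState ((hF.var _ rfl).trans hn) hlt (hmarkρ ▸ hmark) (hF.arr _ rfl) hS hi hin
      hC hT

end Input

namespace Input

/-- The codes of the pairs of states that are reached by the search. -/
inductive Reached (G : Input) : ℕ → Prop
  | lam {u v : ℕ} (hu : u < G.n) (hv : v < G.n) (h : G.lam v < G.lam u) : Reached G (u * G.n + v)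
  | diag {u : ℕ} (hu : u < G.n) : Reached G (u * G.n + u)
  | step {e f : ℕ} (he : e < G.m) (hf : f < G.m) (hlam : G.lam (G.dst e) = G.lam (G.dst f))
      (h : Reached G (G.src e * G.n + G.src f)) : Reached G (G.dst e * G.n + G.dst f)

theorem Arrows.reached_step {G : Input} {K : ℕ} {source target : ℕ → ℕ}
    (hA : G.Arrows (fun _ _ => True) K source target) {a : ℕ} (ha : 0 < a) (haK : a ≤ K)
    (h : G.Reached (source a)) : G.Reached (target a) := by
  obtain ⟨e, he, f, hf, hlam, hsource, htarget⟩ := hA.sound a ha haK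
  rw [hsource] at h
  exact htarget ▸ .step he hf hlam h

theorem Reached.of_closed {G : Input} {K : ℕ} {source target : ℕ → ℕ} {P : ℕ → Prop}
    (hA : G.Arrows (fun _ _ => True) K source target)
    (hseed : ∀ u < G.n, ∀ v < G.n, G.lam v < G.lam u ∨ u = v → P (u * G.n + v))
    (hstep : ∀ a, 0 < a → a ≤ K → P (source a) → P (target a)) {y : ℕ} (h : G.Reached y) : P y := by
  induction h with
  | lam hu hv h => exact hseed _ hu _ hv (.inl h)
  | diag hu => exact hseed _ hu _ hu (.inr rfl)
  | step he hf hlam _ ih =>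
    obtain ⟨a, ha, haK, hsource, htarget⟩ := hA.complete _ he _ hf trivial hlam
    exact htarget ▸ hstep a ha haK (hsource ▸ ih)

/-- The store after `solve`. -/
structure Solved (G : Input) (lt : ℕ → ℕ → Prop) (σ : Store) : Prop where
  loaded : G.Loaded σ
  mark : ∀ u < G.n, ∀ v < G.n, σ.arr .mark (u * G.n + v) = 0 ↔ lt u v
  sorted : Sorted G.n lt (σ.arr .order)
  chains : Chains G.n lt (σ.arr .order) G.n (σ.var .numChains) (σ.arr .chain)

variable {G : Input} {w : ℕ} [WordBound w G.size] {σ : Store} {lt : ℕ → ℕ → Prop}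

theorem triple_seed_search (hσ : G.Loaded σ) {K : ℕ}
    (hA : G.Arrows (fun _ _ => True) K (σ.arr .arrowSrc) (σ.arr .arrowDst)) (hK : K ≤ G.m * G.m)
    (hlists : LinkedLists K (σ.arr .arrowSrc) (σ.arr .prev) (σ.arr .head))
    (hall : ∀ a, 0 < a → a ≤ K → a ≤ σ.arr .head (σ.arr .arrowSrc a))
    (hhead : σ.var .qHead = 0) (htail : σ.var .qTail = 0) (hmark : ∀ y, σ.arr .mark y = 0) :
    Triple w G.size (.seq seed search) σ (210 * (G.m * G.m) + 460 * (G.n * G.n))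
      (fun τ => ∀ y, τ.arr .mark y ≠ 0 ↔ G.Reached y) := by
  have hnn : 0 < G.n * G.n := Nat.mul_pos G.n_pos G.n_pos
  have hn : G.n ≤ G.n * G.n := Nat.le_mul_self _
  have hT : G.n * (G.n * 210 + 20) = 210 * (G.n * G.n) + 20 * G.n := by ring
  refine .seq _ ((G.n * G.n + K) * 210 + 10) _ (by omega) (triple_seed hσ htail hmark) ?_
  intro ρ hF hQ
  have hsource : ρ.arr .arrowSrc = σ.arr .arrowSrc := hF.arr _ rfl
  have htarget : ρ.arr .arrowDst = σ.arr .arrowDst := hF.arr _ rfl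
  have hhead' : ρ.arr .head = σ.arr .head := hF.arr _ rfl
  have hprev : ρ.arr .prev = σ.arr .prev := hF.arr _ rfl
  rw [← hsource, ← htarget] at hA
  rw [← hsource, ← hprev, ← hhead'] at hlists
  rw [← hsource, ← hhead'] at hall
  have hseed : ∀ y, ρ.arr .mark y ≠ 0 → G.Reached y := by
    intro y hy
    obtain ⟨u, hu, v, hv, h | rfl, rfl⟩ := hQ.of_mark hy
    exacts [.lam hu hv h, .diag hu]
  refine (triple_search hK le_rfl (fun a ha haK => hA.reached_step ha haK)
    (fun a ha haK => (hA.lt ha haK).2) ((hF.var _ rfl).trans hhead)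
    (.init hQ.toQueue hlists hall hseed)).mono le_rfl ?_
  rintro τ - ⟨hsound, hmono, hclosed⟩ y
  exact ⟨hsound y, Reached.of_closed (P := fun y => τ.arr .mark y ≠ 0) hA
    (fun u hu v hv h => hmono _ ((hQ.mark_ne_zero u hu v hv).2 h)) hclosed⟩

theorem triple_markPairs (hσ : G.Loaded σ) (hvar : ∀ x ∈ [Var.len, .qHead, .qTail], σ.var x = 0)
    (harr : ∀ A ∈ [Arr.head, .mark], ∀ i, σ.arr A i = 0) :
    Triple w G.size markPairs σ (700 * (G.m * G.m) + 500 * (G.n * G.n))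
      (fun τ => ∀ y, τ.arr .mark y ≠ 0 ↔ G.Reached y) := by
  simp only [List.forall_mem_cons] at hvar harr
  obtain ⟨hlen, hhead, htail, -⟩ := hvar
  obtain ⟨hhead_arr, hmark, -⟩ := harr
  have hnn : 0 < G.n * G.n := Nat.mul_pos G.n_pos G.n_pos
  have hm : G.m ≤ G.m * G.m := Nat.le_mul_self _
  have hT : G.m * (G.m * 210 + 20) = 210 * (G.m * G.m) + 20 * G.m := by ring
  refine .seq _ (420 * (G.m * G.m) + 480 * (G.n * G.n)) _ ?_ (triple_listArrows hσ hlen) ?_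
  · omega
  rintro ρ hF ⟨hA, hK⟩
  have hρ := hσ.of_frame hF
  refine .seq _ (210 * (G.m * G.m) + 460 * (G.n * G.n)) _ ?_
    (triple_linkArrows rfl hK (fun a ha haK => (hA.lt ha haK).1)
      (fun x => (congrFun (hF.arr _ rfl) x).trans (hhead_arr x))) ?_
  · omega
  rintro ρ' hF' ⟨hlists, hall⟩
  have hsource : ρ'.arr .arrowSrc = ρ.arr .arrowSrc := hF'.arr _ rfl
  have htarget : ρ'.arr .arrowDst = ρ.arr .arrowDst := hF'.arr _ rfl
  have hmark' : ρ'.arr .mark = σ.arr .mark := (hF'.arr _ rfl).trans (hF.arr _ rfl)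
  refine triple_seed_search (hρ.of_frame hF') ?_ hK ?_ ?_
    (((hF'.var _ rfl).trans (hF.var _ rfl)).trans hhead)
    (((hF'.var _ rfl).trans (hF.var _ rfl)).trans htail) (hmark' ▸ hmark)
  · rwa [hsource, htarget]
  · rwa [hsource]
  · rwa [hsource]

theorem triple_sortIntoChains (hσ : G.Loaded σ) (hp : σ.var .numChains = 0)
    (hlt : IntervalOrder G.n lt)
    (hmark : ∀ u < G.n, ∀ v < G.n, σ.arr .mark (u * G.n + v) = 0 ↔ lt u v) :
    Triple w G.size sortIntoChains σ (1400 * (G.n * G.n)) (G.Solved lt) := by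
  have hnn : 0 < G.n * G.n := Nat.mul_pos G.n_pos G.n_pos
  have hn : G.n ≤ G.n * G.n := Nat.le_mul_self _
  have hT₁ : G.n * (G.n * 210 + 230) = 210 * (G.n * G.n) + 230 * G.n := by ring
  have hT₂ : G.n * (G.n * 210 + 20) = 210 * (G.n * G.n) + 20 * G.n := by ring
  have hT₃ : G.n * (G.n * 210 + 420) = 210 * (G.n * G.n) + 420 * G.n := by ring
  refine .seq _ (900 * (G.n * G.n)) _ ?_ (triple_countPreds hσ.n hmark) ?_
  · omega
  intro ρ hF hcount
  have hρ := hσ.of_frame hF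
  rw [← hF.arr .mark rfl] at hmark
  refine .seq _ (640 * (G.n * G.n)) _ ?_ (triple_sortStates hρ.n hlt hcount) ?_
  · omega
  intro ρ' hF' hS
  have hρ' := hρ.of_frame hF'
  rw [← hF'.arr .mark rfl] at hmark
  refine (triple_assignChains hρ'.n (((hF'.var _ rfl).trans (hF.var _ rfl)).trans hp) hlt hmark
    hS).mono (by omega) ?_
  intro τ hF'' hC
  refine ⟨hρ'.of_frame hF'', ?_, ?_, ?_⟩
  · rwa [hF''.arr .mark rfl]
  · rwa [hF''.arr .order rfl]
  · rwa [hF''.arr .order rfl]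

theorem triple_solve (hσ : G.Start σ) (hlt : IntervalOrder G.n lt)
    (hreached : ∀ u < G.n, ∀ v < G.n, lt u v ↔ ¬ G.Reached (u * G.n + v)) :
    Triple w G.size solve σ (3000 * (G.m * G.m + G.n * G.n)) (G.Solved lt) := by
  have hnn : 0 < G.n * G.n := Nat.mul_pos G.n_pos G.n_pos
  have hm : G.m ≤ G.m * G.m := Nat.le_mul_self _
  refine .seq _ (800 * (G.m * G.m) + 2000 * (G.n * G.n)) _ ?_ (triple_readInput hσ) ?_
  · omega
  intro ρ hF hρ
  refine .seq _ (1400 * (G.n * G.n)) _ ?_ (triple_markPairs hρ ?_ ?_) ?_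
  · omega
  · intro x hx
    rw [hF.var x (by revert x; decide), hσ.var]
  · intro A hA i
    rw [hF.arr A (by revert A; decide), hσ.arr A (by revert A; decide)]
  intro ρ' hF' hmark
  refine triple_sortIntoChains (hρ.of_frame hF') ?_ hlt fun u hu v hv => ?_
  · rw [hF'.var _ rfl, hF.var _ rfl, hσ.var]
  · rw [hreached u hu v hv, ← hmark, not_not]

end Input

/-- The store `σ` arises from `σ₀` by appending the list `l` to the output, which starts at the
index `outBase` of the array `io`, and by changing variables other than the ones below. -/
structure Emitted (σ₀ : Store) (l : List ℕ) (σ : Store) : Prop where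
  outBase : σ.var .outBase = σ₀.var .outBase
  numStates : σ.var .numStates = σ₀.var .numStates
  numEdges : σ.var .numEdges = σ₀.var .numEdges
  numChains : σ.var .numChains = σ₀.var .numChains
  outPos : σ.var .outPos = σ₀.var .outBase + l.length
  arr : ∀ A, A ≠ .io → σ.arr A = σ₀.arr A
  low : ∀ i < σ₀.var .outBase, σ.arr .io i = σ₀.arr .io i
  io : ∀ i (h : i < l.length), σ.arr .io (σ₀.var .outBase + i) = l[i]

namespace Emitted

variable {w B : ℕ} [WordBound w B] {σ₀ σ : Store} {l : List ℕ}

omit [WordBound w B] in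
theorem init (σ : Store) : Emitted σ [] (σ.setVar .outPos (σ.var .outBase)) := by
  constructor <;> simp

omit [WordBound w B] in
theorem setVar (h : Emitted σ₀ l σ) (x : Var) (k : ℕ)
    (hx : x ∉ [.outBase, .numStates, .numEdges, .numChains, Var.outPos] := by decide) :
    Emitted σ₀ l (σ.setVar x k) := by
  simp only [List.mem_cons, List.not_mem_nil, or_false, not_or, ne_comm (a := x)] at hx
  exact {
    outBase := by simp [hx, h.outBase]
    numStates := by simp [hx, h.numStates]
    numEdges := by simp [hx, h.numEdges]
    numChains := by simp [hx, h.numChains]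
    outPos := by simp [hx, h.outPos]
    arr := h.arr
    low := h.low
    io := h.io }

omit [WordBound w B] in
theorem append (h : Emitted σ₀ l σ) (k : ℕ) :
    Emitted σ₀ (l ++ [k])
      ((σ.setArr .io (σ.var .outPos) k).setVar .outPos (σ.var .outPos + 1)) where
  outBase := by simp [h.outBase]
  numStates := by simp [h.numStates]
  numEdges := by simp [h.numEdges]
  numChains := by simp [h.numChains]
  outPos := by simp [h.outPos, add_assoc]
  arr A hA := by simp [h.arr A hA, hA]
  low i hi := by
    have hne : i ≠ σ.var .outPos := by have := h.outPos; omega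
    simp [hne, h.low i hi]
  io i hi := by
    rw [List.getElem_append]
    have := h.io i
    simp [h.outPos, Function.update_apply]
    grind

theorem triple_emit (h : Emitted σ₀ l σ) {a : Expr} {k : ℕ}
    (hl : σ₀.var .outBase + l.length + 1 < B) (ha : a.InBounds B σ) (hs : a.Storable B σ)
    (hk : a.eval σ = k) (hsize : a.size ≤ 16 := by decide) (hcost : a.cost ≤ 100 := by decide) :
    Triple w B (emit a) σ 150 (Emitted σ₀ (l ++ [k])) := by
  have hpos := h.outPos
  have happend := h.append k
  refine .of_wp ?_ ?_ ?_
  · simp [emit, ha, hs, hk]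
    grind
  · simp only [emit, Stmt.block, Stmt.fits, hsize]
    rfl
  · simp only [emit, Stmt.block, Stmt.cost, Expr.cost]
    have : (Expr.var .outPos + 1).cost = 3 := rfl
    omega

theorem triple_forLoop (h : Emitted σ₀ l σ) {x N : Var} {S : Stmt} {T' : ℕ} (K T L : ℕ)
    (g : ℕ → List ℕ) (hN : σ.var N = K) (hg : ∀ j < K, (g j).length ≤ L)
    (hl : σ₀.var .outBase + l.length + K * L < B) (hT : K * (T + 10) + 10 ≤ T')
    (hS : ∀ τ j l', Frame (.forLoop x N S) σ τ → τ.var x = j → j < K → Emitted σ₀ l' τ →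
      σ₀.var .outBase + l'.length + L < B → Triple w B S τ T (Emitted σ₀ (l' ++ g j)))
    (hx : x ∉ [.outBase, .numStates, .numEdges, .numChains, Var.outPos] := by decide)
    (hNx : N ≠ x := by decide) (hxS : S.writesVar x = false := by rfl)
    (hNS : S.writesVar N = false := by rfl) :
    Triple w B (.forLoop x N S) σ T' (Emitted σ₀ (l ++ (List.range K).flatMap g)) := by
  refine .forLoop K T (fun j => Emitted σ₀ (l ++ (List.range j).flatMap g)) hN hT ?_ ?_
    (fun _ _ h => h) hNx hxS hNS
  · simpa using h.setVar x 0 hx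
  · intro τ j hF hj hjK hE
    have hlen : ((List.range j).flatMap g).length ≤ j * L := by
      rw [List.length_flatMap]
      refine (List.sum_le_card_nsmul _ L ?_).trans (by simp)
      simp only [List.forall_mem_map, List.mem_range]
      exact fun i hi => hg i (hi.trans hjK)
    have hjL : (j + 1) * L ≤ K * L := Nat.mul_le_mul_right _ hjK
    rw [add_mul, one_mul] at hjL
    refine (hS τ j _ hF hj hjK hE ?_).mono le_rfl fun ρ _ hρ => ?_
    · rw [List.length_append]
      omega
    · rw [List.range_succ, List.flatMap_append, ← List.append_assoc, List.flatMap_singleton]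
      exact hρ.setVar x (j + 1) hx

theorem triple_forLoop_map (h : Emitted σ₀ l σ) {x N : Var} {S : Stmt} {T' : ℕ} (K T : ℕ)
    (g : ℕ → ℕ) (hN : σ.var N = K) (hl : σ₀.var .outBase + l.length + K < B)
    (hT : K * (T + 10) + 10 ≤ T')
    (hS : ∀ τ j l', Frame (.forLoop x N S) σ τ → τ.var x = j → j < K → Emitted σ₀ l' τ →
      σ₀.var .outBase + l'.length + 1 < B → Triple w B S τ T (Emitted σ₀ (l' ++ [g j])))
    (hx : x ∉ [.outBase, .numStates, .numEdges, .numChains, Var.outPos] := by decide)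
    (hNx : N ≠ x := by decide) (hxS : S.writesVar x = false := by rfl)
    (hNS : S.writesVar N = false := by rfl) :
    Triple w B (.forLoop x N S) σ T' (Emitted σ₀ (l ++ (List.range K).map g)) := by
  rw [List.map_eq_flatMap]
  exact h.triple_forLoop K T 1 _ hN (fun _ _ => le_rfl) (by rwa [mul_one]) hT hS hx hNx hxS hNS

end Emitted

namespace Input

open Classical in
/-- What `emitOrder` writes. -/
noncomputable def orderList (G : Input) (lt : ℕ → ℕ → Prop) (p : ℕ) (chain : ℕ → ℕ) : List ℕ :=
  ((List.range G.n).flatMap fun u => (List.range G.n).map fun v =>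
    if u = v ∨ lt u v then 1 else 0) ++ [p] ++ (List.range G.n).map chain

variable {G : Input} {w : ℕ} [WordBound w G.size] {σ : Store} {lt : ℕ → ℕ → Prop}

open Classical in
theorem triple_emitMatrix (hσ : G.Solved lt σ) {τ : Store} (hτ : Emitted σ [] τ) :
    Triple w G.size emitMatrix τ (330 * (G.n * G.n) + 20 * G.n + 10)
      (Emitted σ ((List.range G.n).flatMap fun u => (List.range G.n).map fun v =>
        if u = v ∨ lt u v then 1 else 0)) := by
  have hs := G.size_eq
  have hn := hσ.loaded.n
  have hbase := hσ.loaded.outBase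
  refine hτ.triple_forLoop G.n (G.n * 320 + 10) G.n _ (hτ.numStates.trans hn) (by simp)
    (by simp; omega) (by nlinarith) ?_
  intro ρ u l _ hu hun hE hl
  refine hE.triple_forLoop_map G.n 310 _ (hE.numStates.trans hn) hl le_rfl ?_
  intro ρ' v l' hF' hv hvn hE' hl'
  have hpos := hE'.outPos
  have hu' : ρ'.var .row = u := (hF'.var _ rfl).trans hu
  have hn' : ρ'.var .numStates = G.n := hE'.numStates.trans hn
  have := hE'.append (if u = v ∨ lt u v then 1 else 0)
  have := mul_add_lt_mul hun hvn
  refine .of_wp ?_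
  simp [emit, hv, hu', hn', hE'.arr, hσ.mark u hun v hvn]
  grind

theorem triple_emitOrder (hσ : G.Solved lt σ) :
    Triple w G.size emitOrder σ (4000 * (G.m * G.m + G.n * G.n))
      (Emitted σ (G.orderList lt (σ.var .numChains) (σ.arr .chain))) := by
  have hs := G.size_eq
  have hnn : 0 < G.n * G.n := Nat.mul_pos G.n_pos G.n_pos
  have hnn' : G.n ≤ G.n * G.n := Nat.le_mul_self _
  have hn := hσ.loaded.n
  have hbase := hσ.loaded.outBase
  refine .seq 2 (1000 * (G.n * G.n)) (Emitted σ []) (by omega) (.of_wp ?_) ?_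
  · simpa using Emitted.init σ
  intro τ _ hE
  refine .seq _ (600 * (G.n * G.n)) _ ?_ (triple_emitMatrix hσ hE) ?_
  · omega
  intro τ _ hE
  refine .seq _ (200 * (G.n * G.n)) _ ?_
    (hE.triple_emit (k := σ.var .numChains) ?_ trivial trivial hE.numChains) ?_
  · omega
  · simp [List.length_flatMap]
    omega
  intro τ _ hE
  refine hE.triple_forLoop_map G.n 150 (σ.arr .chain) (hE.numStates.trans hn) ?_ ?_ ?_
  · simp [List.length_flatMap]
    omega
  · omega
  · intro τ v l _ hv hvn hE hl
    exact hE.triple_emit hl (by simp [hv]; omega) trivial (by simp [hv, hE.arr])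

end Input

theorem flatMap_filter {α β : Type*} (l : List α) (q : α → Bool) (g : α → List β) :
    (l.filter q).flatMap g = l.flatMap fun x => if q x then g x else [] := by
  induction l with
  | nil => rfl
  | cons x l ih => by_cases h : q x <;> simp [h, ih]

theorem length_flatMap_le {α β : Type*} {l : List α} {g : α → List β} {k : ℕ}
    (hg : ∀ x ∈ l, (g x).length ≤ k) : (l.flatMap g).length ≤ l.length * k := by
  rw [List.length_flatMap]
  refine (List.sum_le_card_nsmul _ k ?_).trans (by simp)
  simpa only [List.forall_mem_map] using hg

/-- The order of the states in the index: chain by chain, and by `lt` within a chain. -/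
def ChainLT (lt : ℕ → ℕ → Prop) (chain : ℕ → ℕ) (u v : ℕ) : Prop :=
  chain u < chain v ∨ chain u = chain v ∧ lt u v

namespace Input

variable {G : Input} {w : ℕ} [WordBound w G.size] {σ : Store} {lt : ℕ → ℕ → Prop}

theorem triple_listChain {j : ℕ} (hlt : IntervalOrder G.n lt) {ord chain : ℕ → ℕ}
    (hS : Sorted G.n lt ord)
    (hasc : ∀ i i', i < i' → i' < G.n → chain (ord i) = chain (ord i') → lt (ord i) (ord i'))
    (hn : σ.var .numStates = G.n) (hj : σ.var .cand = j)
    (hord : σ.arr .order = ord) (hchain : σ.arr .chain = chain)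
    (hI : Listing G.n (ChainLT lt chain) (fun v => chain v < j) (σ.var .len) (σ.arr .listed)) :
    Triple w G.size listChain σ (G.n * 210 + 10) (fun τ =>
      Listing G.n (ChainLT lt chain) (fun v => chain v < j + 1) (τ.var .len) (τ.arr .listed)) := by
  have hs := G.size_eq
  have hnn : G.n ≤ G.n * G.n := Nat.le_mul_of_pos_left _ G.n_pos
  have hirrefl (u : ℕ) : ¬ ChainLT lt chain u u := by simp [ChainLT, hlt.irrefl]
  let Done (i v : ℕ) : Prop := chain v < j ∨ chain v = j ∧ ∃ i' < i, ord i' = v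
  refine .forLoop G.n 200 (fun i τ =>
    Listing G.n (ChainLT lt chain) (Done i) (τ.var .len) (τ.arr .listed)) hn le_rfl
    (by simpa [Done] using hI) ?_ ?_
  · intro ρ i hF hi hin hIρ
    have hjρ : ρ.var .cand = j := (hF.var _ rfl).trans hj
    have hordρ : ρ.arr .order = ord := (hF.arr _ rfl).trans hord
    have hchainρ : ρ.arr .chain = chain := (hF.arr _ rfl).trans hchain
    have hle := hIρ.le hirrefl
    have hoi := hS.ord_lt i hin
    have hDone (u : ℕ) : Done (i + 1) u ↔ Done i u ∨ chain u = j ∧ ord i = u := by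
      simp only [Done, Nat.lt_succ_iff_lt_or_eq]
      grind
    have hsnoc (h : chain (ord i) = j) := hIρ.snoc (P' := Done (i + 1)) hoi
      (fun u _ => by rw [hDone]; grind) (by
        rintro u - (hu | ⟨hu, i', hi', rfl⟩)
        · exact .inl (h ▸ hu)
        · exact .inr ⟨hu.trans h.symm, hasc i' i hi' hin (hu.trans h.symm)⟩)
    have hskip (h : chain (ord i) ≠ j) := hIρ.congr (P' := Done (i + 1))
      (fun u _ => by rw [hDone]; grind)
    refine .of_wp ?_
    simp [hi, hjρ, hordρ, hchainρ]
    grind (splits := 20)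
  · intro τ _ hIτ
    refine hIτ.congr fun u hu => ?_
    have := (hS.mem u hu).1 trivial
    grind

theorem triple_listStates (hlt : IntervalOrder G.n lt) (hσ : G.Solved lt σ) :
    Triple w G.size listStates σ (1000 * (G.n * G.n)) (fun τ =>
      Listing G.n (ChainLT lt (σ.arr .chain)) (fun _ => True) G.n (τ.arr .listed)) := by
  have hs := G.size_eq
  have hnn : G.n ≤ G.n * G.n := Nat.le_mul_of_pos_left _ G.n_pos
  have hn := G.n_pos
  have hirrefl (u : ℕ) : ¬ ChainLT lt (σ.arr .chain) u u := by simp [ChainLT, hlt.irrefl]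
  have hchain_lt : ∀ v < G.n, σ.arr .chain v < σ.var .numChains := fun v hv => by
    obtain ⟨i, hi, rfl⟩ := (hσ.sorted.mem v hv).1 trivial
    exact hσ.chains.chain_lt i hi
  have hT : σ.var .numChains * (G.n * 210 + 10 + 10) ≤ G.n * (G.n * 210 + 10 + 10) :=
    Nat.mul_le_mul_right _ hσ.chains.p_le
  have hT' : G.n * (G.n * 210 + 10 + 10) = 210 * (G.n * G.n) + 20 * G.n := by ring
  refine .seq 2 (600 * (G.n * G.n)) (fun τ => τ.var .len = 0) (by omega)
    (.of_wp (by simp; omega)) fun σ₁ hF₁ hlen => ?_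
  refine .forLoop (σ.var .numChains) (G.n * 210 + 10) (fun j τ =>
    Listing G.n (ChainLT lt (σ.arr .chain)) (fun v => σ.arr .chain v < j) (τ.var .len)
      (τ.arr .listed)) (hF₁.var _ rfl) (by omega) ?_ ?_ ?_
  · constructor <;> simp [hlen]
  · intro ρ j hF hj _ hI
    exact triple_listChain hlt hσ.sorted hσ.chains.asc
      ((hF.var _ rfl).trans ((hF₁.var _ rfl).trans hσ.loaded.n)) hj
      ((hF.arr _ rfl).trans (hF₁.arr _ rfl)) ((hF.arr _ rfl).trans (hF₁.arr _ rfl)) hI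
  · intro τ _ hI
    have hall := hI.congr (P' := fun _ => True) fun v hv => by simpa using hchain_lt v hv
    exact hall.eq hirrefl ▸ hall

/-- The edges `e` with `key e = v`, where `key` gives one of the ends of an edge. -/
def edgesAt (G : Input) (key : ℕ → ℕ) (v : ℕ) : List ℕ :=
  (List.range G.m).filter fun e => key e = v

/-- What `emitLists` writes if its statement writes `g e` for the edge `e`. -/
def edgeLists (G : Input) (listed key : ℕ → ℕ) (g : ℕ → List ℕ) : List ℕ :=
  (List.range G.n).flatMap fun i =>
    (G.edgesAt key (listed i)).length :: (G.edgesAt key (listed i)).flatMap g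

theorem length_edgesAt_le (G : Input) (key : ℕ → ℕ) (v : ℕ) : (G.edgesAt key v).length ≤ G.m :=
  (List.length_filter_le _ _).trans_eq List.length_range

theorem length_flatMap_edgesAt_le {key : ℕ → ℕ} {g : ℕ → List ℕ}
    (hg : ∀ e < G.m, (g e).length ≤ 2) (v : ℕ) :
    ((G.edgesAt key v).flatMap g).length ≤ G.m * 2 :=
  (length_flatMap_le fun e he => hg e (List.mem_range.1 (List.mem_of_mem_filter he))).trans
    (Nat.mul_le_mul_right _ (G.length_edgesAt_le key v))

theorem length_edgeLists_le {listed key : ℕ → ℕ} {g : ℕ → List ℕ}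
    (hg : ∀ e < G.m, (g e).length ≤ 2) :
    (G.edgeLists listed key g).length ≤ G.n * (G.m * 2 + 1) := by
  refine (length_flatMap_le (k := G.m * 2 + 1) fun i _ => ?_).trans_eq (by rw [List.length_range])
  exact Nat.succ_le_succ (length_flatMap_edgesAt_le hg _)

section EmitLists

variable {σ₀ : Store} {l : List ℕ} {A : Arr} {key : ℕ → ℕ} {v : ℕ}

theorem triple_countEdges (hE : Emitted σ₀ l σ) (hA : A ≠ .io) (hm : σ₀.var .numEdges = G.m)
    (hkey : ∀ e < G.m, σ₀.arr A e = key e) (hstate : σ.var .state = v) :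
    Triple w G.size (countEdges A) σ (G.m * 110 + 20)
      (fun τ => Emitted σ₀ l τ ∧ τ.var .len = (G.edgesAt key v).length) := by
  have hs := G.size_eq
  refine .seq 2 (G.m * 110 + 10) (fun τ => Emitted σ₀ l τ ∧ τ.var .len = 0) (by omega)
    (.of_wp ?_) ?_
  · simpa using ⟨by omega, hE.setVar .len 0⟩
  rintro σ₁ hF₁ ⟨hE₁, hlen⟩
  refine .forLoop G.m 100 (fun j τ => Emitted σ₀ l τ ∧
    τ.var .len = ((List.range j).filter fun e => key e = v).length) (hE₁.numEdges.trans hm) le_rfl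
    ⟨hE₁.setVar .edge 0, by simpa using hlen⟩ ?_ fun _ _ h => h
  rintro ρ j hF hj hjm ⟨hEρ, hlenρ⟩
  have hkeyρ : ρ.arr A j = key j := (congrFun (hEρ.arr A hA) j).trans (hkey j hjm)
  have hstateρ : ρ.var .state = v := (hF.var _ rfl).trans ((hF₁.var _ rfl).trans hstate)
  have hle := List.length_filter_le (fun e => decide (key e = v)) (List.range j)
  have hcount (k : ℕ) := (hEρ.setVar .len k).setVar .edge (j + 1)
  have hskip := hEρ.setVar .edge (j + 1)
  rw [List.length_range] at hle
  refine .of_wp ?_ rfl (Nat.le_of_ble_eq_true rfl)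
  simp [hj, hkeyρ, hstateρ, hlenρ, List.range_succ, List.filter_append, List.filter_cons]
  grind

theorem triple_forEdges {S : Stmt} {g : ℕ → List ℕ} (hE : Emitted σ₀ l σ) (hA : A ≠ .io)
    (hm : σ₀.var .numEdges = G.m) (hkey : ∀ e < G.m, σ₀.arr A e = key e)
    (hstate : σ.var .state = v) (hg : ∀ e < G.m, (g e).length ≤ 2)
    (hl : σ₀.var .outBase + l.length + G.m * 2 < G.size)
    (hSvar : ∀ x ≠ .outPos, S.writesVar x = false)
    (hS : ∀ τ l' e, τ.var .edge = e → e < G.m → Emitted σ₀ l' τ →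
      σ₀.var .outBase + l'.length + 2 < G.size → Triple w G.size S τ 310 (Emitted σ₀ (l' ++ g e))) :
    Triple w G.size (forEdges A S) σ (G.m * 400 + 10)
      (Emitted σ₀ (l ++ (G.edgesAt key v).flatMap g)) := by
  have hs := G.size_eq
  have hwrites (x : Var) (hx : x ≠ .outPos) :
      (Stmt.ite (.eq (.load A (.var .edge)) (.var .state)) S .skip).writesVar x = false := by
    simp [Stmt.writesVar, hSvar x hx]
  rw [edgesAt, flatMap_filter]
  refine hE.triple_forLoop G.m 390 2 _ (hE.numEdges.trans hm)
    (fun e he => by split_ifs <;> simp [hg e he]) hl le_rfl ?_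
    (hxS := hwrites _ (by decide)) (hNS := hwrites _ (by decide))
  intro τ e l' hF he hem hE' hl'
  have hkeyτ : τ.arr A e = key e := (congrFun (hE'.arr A hA) e).trans (hkey e hem)
  have hstateτ : τ.var .state = v := by
    refine (hF.var _ ?_).trans hstate
    simp [Stmt.forLoop, Stmt.writesVar, hSvar]
  have hholds : (Cond.eq (.load A (.var .edge)) (.var .state)).Holds τ ↔ key e = v := by
    simp [he, hkeyτ, hstateτ]
  refine (Triple.ite (T := 310) (T' := 1) rfl ?_ ?_ ?_).mono_time (Nat.le_of_ble_eq_true rfl)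
  · simp [he]
    omega
  · intro h
    simpa [hholds.1 h] using hS τ l' e he hem hE' hl'
  · intro h
    exact .skip (by simpa [mt hholds.2 h] using hE')

theorem triple_emitLists {S : Stmt} {g : ℕ → List ℕ} (hE : Emitted σ₀ l σ) (hA : A ≠ .io)
    (hn : σ₀.var .numStates = G.n) (hm : σ₀.var .numEdges = G.m)
    (hkey : ∀ e < G.m, σ₀.arr A e = key e) (hg : ∀ e < G.m, (g e).length ≤ 2)
    (hl : σ₀.var .outBase + l.length + G.n * (G.m * 2 + 1) < G.size)
    (hlisted : ∀ i < G.n, σ₀.arr .listed i < G.n)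
    (hSvar : ∀ x ≠ .outPos, S.writesVar x = false)
    (hS : ∀ τ l' e, τ.var .edge = e → e < G.m → Emitted σ₀ l' τ →
      σ₀.var .outBase + l'.length + 2 < G.size → Triple w G.size S τ 310 (Emitted σ₀ (l' ++ g e))) :
    Triple w G.size (emitLists A S) σ (1000 * (G.n * G.m) + 1000 * G.n)
      (Emitted σ₀ (l ++ G.edgeLists (σ₀.arr .listed) key g)) := by
  have hs := G.size_eq
  have hn0 := G.n_pos
  have hT : G.n * (G.m * 600 + 300 + 10) = 600 * (G.n * G.m) + 310 * G.n := by ring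
  refine hE.triple_forLoop G.n (G.m * 600 + 300) (G.m * 2 + 1) _ (hE.numStates.trans hn)
    (fun i _ => Nat.succ_le_succ (length_flatMap_edgesAt_le hg _)) hl (by omega) ?_
    (hxS := ?_) (hNS := ?_)
  · intro τ i l' _ hi hin hE' hl'
    have := hlisted i hin
    refine .seq 10 (G.m * 600 + 290) (fun ρ => Emitted σ₀ l' ρ ∧ ρ.var .state = σ₀.arr .listed i)
      (by omega) (.of_wp ?_) ?_
    · have := hE'.setVar .state (σ₀.arr .listed i)
      simp [hi, hE'.arr]
      grind
    rintro τ₁ - ⟨hE₁, hstate⟩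
    refine .seq _ (G.m * 400 + 200) _ (by omega) (triple_countEdges hE₁ hA hm hkey hstate) ?_
    rintro τ₂ hF₂ ⟨hE₂, hlen⟩
    refine .seq _ (G.m * 400 + 10) _ (by omega)
      (hE₂.triple_emit (by omega) trivial trivial hlen) ?_
    intro τ₃ hF₃ hE₃
    have := triple_forEdges hE₃ hA hm hkey
      ((hF₃.var _ rfl).trans ((hF₂.var _ rfl).trans hstate)) hg
      (by rw [List.length_append, List.length_singleton]; omega) hSvar hS
    rwa [List.append_assoc] at this
  · simp [countEdges, forEdges, emit, Stmt.forLoop, Stmt.writesVar, hSvar]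
  · simp [countEdges, forEdges, emit, Stmt.forLoop, Stmt.writesVar, hSvar]

end EmitLists

/-- What `emitIndex` writes. -/
def indexList (G : Input) (p : ℕ) (chain listed : ℕ → ℕ) : List ℕ :=
  [p] ++ G.edgeLists listed G.src (fun e => [chain (G.dst e), G.lab e]) ++
    G.edgeLists listed G.dst (fun e => [chain (G.src e)]) ++
    (List.range G.n).map fun i => G.fin (listed i)

theorem triple_emitOut (hL : G.Loaded σ) {τ : Store} {l : List ℕ} {e : ℕ}
    (hedge : τ.var .edge = e) (he : e < G.m) (hE : Emitted σ l τ)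
    (hl : σ.var .outBase + l.length + 2 < G.size) :
    Triple w G.size emitOut τ 310
      (Emitted σ (l ++ [σ.arr .chain (G.dst e), G.lab e])) := by
  have hs := G.size_eq
  have := G.dst_lt e he
  have hdst := hL.dst e he
  refine .seq 150 150 _ (by decide)
    (hE.triple_emit (k := σ.arr .chain (G.dst e)) (by omega) ?_ trivial ?_) ?_
  · simp [hedge, hE.arr, hdst]
    omega
  · simp [hedge, hE.arr, hdst]
  intro ρ hF hE'
  have hedge' : ρ.var .edge = e := (hF.var _ rfl).trans hedge
  rw [List.append_cons]
  refine hE'.triple_emit (by rw [List.length_append, List.length_singleton]; omega) ?_ trivial ?_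
  · simp [hedge']
    omega
  · simp [hedge', hE'.arr, hL.lab e he]

theorem triple_emitIn (hL : G.Loaded σ) {τ : Store} {l : List ℕ} {e : ℕ}
    (hedge : τ.var .edge = e) (he : e < G.m) (hE : Emitted σ l τ)
    (hl : σ.var .outBase + l.length + 2 < G.size) :
    Triple w G.size emitIn τ 310
      (Emitted σ (l ++ [σ.arr .chain (G.src e)])) := by
  have hs := G.size_eq
  have := G.src_lt e he
  have hsrc := hL.src e he
  refine .mono_time (T := 150) (hE.triple_emit (by omega) ?_ trivial ?_) (by decide)
  · simp [hedge, hE.arr, hsrc]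
    omega
  · simp [hedge, hE.arr, hsrc]

theorem triple_emitFinal (hL : G.Loaded σ) (hlisted : ∀ i < G.n, σ.arr .listed i < G.n)
    {τ : Store} {l : List ℕ} {i : ℕ} (hpos : τ.var .pos = i) (hi : i < G.n) (hE : Emitted σ l τ)
    (hl : σ.var .outBase + l.length + 1 < G.size) :
    Triple w G.size emitFinal τ 150
      (Emitted σ (l ++ [G.fin (σ.arr .listed i)])) := by
  have hs := G.size_eq
  have hlt := hlisted i hi
  have hm := hE.numEdges.trans hL.m
  have hlow := hE.low (4 + 3 * G.m + σ.arr .listed i) (by rw [hL.outBase]; omega)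
  refine hE.triple_emit hl ?_ trivial ?_
  · simp [hpos, hm, hE.arr]
    omega
  · simp [hpos, hm, hE.arr, hlow, hL.fin _ hlt]

theorem triple_emitIndex (hL : G.Loaded σ) (hlisted : ∀ i < G.n, σ.arr .listed i < G.n) :
    Triple w G.size emitIndex σ (4000 * (G.n * G.m + G.n))
      (Emitted σ (G.indexList (σ.var .numChains) (σ.arr .chain) (σ.arr .listed))) := by
  have hs := G.size_eq
  have hn := G.n_pos
  have hmn : G.m ≤ G.n * G.m := Nat.le_mul_of_pos_left _ hn
  have hnn : G.n ≤ G.n * G.n := Nat.le_mul_self _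
  have hbase := hL.outBase
  have hlen : G.n * (G.m * 2 + 1) = 2 * (G.n * G.m) + G.n := by ring
  have hout := G.length_edgeLists_le (listed := σ.arr .listed) (key := G.src)
    (g := fun e => [σ.arr .chain (G.dst e), G.lab e]) (by simp)
  have hin := G.length_edgeLists_le (listed := σ.arr .listed) (key := G.dst)
    (g := fun e => [σ.arr .chain (G.src e)]) (by simp)
  refine .seq 10 (4000 * (G.n * G.m) + 3000 * G.n) (Emitted σ []) (by omega) (.of_wp ?_) ?_
  · simpa using Emitted.init σ
  intro τ _ hE
  refine .seq _ (4000 * (G.n * G.m) + 2500 * G.n) _ (by omega)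
    (hE.triple_emit (k := σ.var .numChains) (by simp; omega) trivial trivial hE.numChains) ?_
  intro τ _ hE
  refine .seq _ (3000 * (G.n * G.m) + 1500 * G.n) _ (by omega)
    (triple_emitLists hE (by decide) hL.n hL.m hL.src (by simp) (by simp; omega) hlisted
      (fun x hx => by simp [emitOut, emit, Stmt.writesVar, hx])
      fun τ l e hedge he => triple_emitOut hL hedge he) ?_
  intro τ _ hE
  refine .seq _ (2000 * (G.n * G.m) + 500 * G.n) _ (by omega)
    (triple_emitLists hE (by decide) hL.n hL.m hL.dst (by simp) (by simp; omega) hlisted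
      (fun x hx => by simp [emitIn, emit, Stmt.writesVar, hx])
      fun τ l e hedge he => triple_emitIn hL hedge he) ?_
  intro τ _ hE
  exact hE.triple_forLoop_map G.n 150 _ (hE.numStates.trans hL.n) (by simp; omega) (by omega)
    fun τ i l _ hpos hi hE hl => triple_emitFinal hL hlisted hpos hi hE hl

end Input

/-! ## Runs on an input -/

/-- The spacing of the arrays for inputs that start with the number of states and the number of
edges: large enough for the arrays indexed by pairs of states and for all values. -/
def spacing (input : List ℕ) : ℕ := (2 * (input.getD 0 0 + input.getD 1 0 + 4)) ^ 2

/-- The program that puts the spacing of the arrays into `baseReg`. -/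
def prologue : Prog :=
  .seq (.instr (.load (scratch 0) (scratch 1))) <|
  .seq (.instr (.const (scratch 2) 1)) <|
  .seq (.instr (.load (scratch 2) (scratch 2))) <|
  .seq (.instr (.bin .add (scratch 0) (scratch 0) (scratch 2))) <|
  .seq (.instr (.const (scratch 2) 4)) <|
  .seq (.instr (.bin .add (scratch 0) (scratch 0) (scratch 2))) <|
  .seq (.instr (.bin .add (scratch 0) (scratch 0) (scratch 0)))
    (.instr (.bin .mul baseReg (scratch 0) (scratch 0)))

/-- The store at the start: the array `io` holds the input, everything else is `0`. -/
def Store.ofInput (input : List ℕ) : Store where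
  var _ := 0
  arr A i := if A = .io then input.getD i 0 else 0

section

theorem WordBound.lt (w : ℕ) {B : ℕ} [WordBound w B] : B < 2 ^ w :=
  have := WordBound.le (w := w) (B := B)
  calc B = B ^ 1 := (pow_one B).symm
    _ < B ^ 16 := Nat.pow_lt_pow_right (by omega) (by omega)
    _ ≤ 2 ^ w := WordBound.pow_le

variable {w B : ℕ} [WordBound w B] {input : List ℕ}

omit [WordBound w B] in
theorem Store.bounded_ofInput (hB : 0 < B) (hlt : ∀ i, input.getD i 0 < B) :
    (Store.ofInput input).Bounded B where
  var_lt _ := hB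
  arr_lt A i := by
    simp only [Store.ofInput]
    split_ifs
    exacts [hlt i, hB]

theorem mem_init (hlen : input.length ≤ B) (hlt : ∀ i, input.getD i 0 < B) (A : Arr) {i : ℕ}
    (hi : i < B) :
    ((State.init w input).mem (BitVec.ofNat w (A.address B i))).toNat =
      (Store.ofInput input).arr A i := by
  simp only [State.init, Store.ofInput, BitVec.toNat_ofNat, Nat.mod_eq_of_lt (A.address_lt hi)]
  split_ifs with h
  · rw [h, Arr.address, Nat.mod_eq_of_lt ((hlt _).trans (WordBound.lt w))]
    simp [show Arr.io.ctorIdx = 0 from rfl]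
  · have hA : 0 < A.ctorIdx := Nat.pos_of_ne_zero fun h0 => h (Arr.ctorIdx_injective h0)
    have : B ≤ A.ctorIdx * B := Nat.le_mul_of_pos_left _ hA
    rw [List.getD_eq_default _ _ (by rw [Arr.address]; omega), Nat.zero_mod]

theorem exec_prologue (hB : spacing input = B) (hlen : input.length ≤ B)
    (hlt : ∀ i, input.getD i 0 < B) :
    ∃ c, Exec prologue (State.init w input) 8 c ∧ Represents B c (Store.ofInput input) := by
  have hpos : 1 < B := by linarith only [WordBound.le (w := w) (B := B)]
  have hone : 1 % 2 ^ w = 1 := Nat.mod_eq_of_lt (hpos.trans (WordBound.lt w))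
  have hmod : spacing input % 2 ^ w = B := hB ▸ Nat.mod_eq_of_lt (hB ▸ WordBound.lt w)
  refine ⟨_, .seq (.instr _ _) (.seq (.instr _ _) (.seq (.instr _ _) (.seq (.instr _ _)
    (.seq (.instr _ _) (.seq (.instr _ _) (.seq (.instr _ _) (.instr _ _))))))), ?_, ?_, ?_, ?_⟩
  · intro x
    simp [Instr.exec, State.init, Store.ofInput]
  · rw [spacing, sq, two_mul] at hmod
    simpa [Instr.exec, Op.eval, State.init, hone] using hmod
  · exact fun A i => mem_init hlen hlt A
  · exact Store.bounded_ofInput (one_pos.trans hpos) hlt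

theorem Triple.computes {S : Stmt} {T : ℕ} {P : List ℕ → Prop} (hB : spacing input = B)
    (hlen : input.length ≤ B) (hlt : ∀ i, input.getD i 0 < B)
    (h : Triple w B S (Store.ofInput input) T fun τ => ∃ σ₀ l, P l ∧ Emitted σ₀ l τ) :
    ∃ t l, P l ∧ (Prog.seq prologue S.compile).Computes w input t l ∧ t ≤ T + 8 := by
  obtain ⟨c, hx, hc⟩ := exec_prologue (w := w) hB hlen hlt
  obtain ⟨t, c', τ, hx', ht, hτ, -, σ₀, l, hP, hE⟩ := h c hc
  have hreg : (c'.reg 0).toNat = σ₀.var .outBase := (hτ.var .outBase).trans hE.outBase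
  have hlB : σ₀.var .outBase + l.length < B := hE.outPos ▸ hτ.bounded.var_lt .outPos
  refine ⟨_, l, hP, ⟨c', .seq hx hx', ?_, fun i hi => ?_⟩, by omega⟩
  · exact (hreg ▸ hlB).le.trans (WordBound.lt w).le
  · rw [hreg, ← hE.io i hi, ← hτ.arr .io _ (by omega)]
    simp [Arr.address, show Arr.io.ctorIdx = 0 from rfl]

end

/-! ## Automata as inputs -/

theorem getElem?_flatMap_append {β γ : Type*} {f : β → List γ} {k : ℕ}
    (hf : ∀ x, (f x).length = k) (l : List β) (r : List γ) {i j : ℕ} (hi : i < l.length)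
    (hj : j < k) : (l.flatMap f ++ r)[k * i + j]? = (f l[i])[j]? := by
  induction l generalizing i with
  | nil => simp at hi
  | cons x l ih =>
    have hx := hf x
    rw [List.flatMap_cons, List.append_assoc]
    cases i with
    | zero =>
      rw [List.getElem?_append_left (by omega)]
      simp
    | succ i =>
      rw [List.getElem?_append_right (by rw [hx, mul_add_one]; omega), hx,
        show k * (i + 1) + j - k = k * i + j by rw [mul_add_one]; omega]
      simpa using ih (by simpa using hi)

section Rank

variable {α : Type*} [Fintype α] [LinearOrder α]

theorem rank_strictMono : StrictMono (rank : α → ℕ) := fun a b h =>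
  Finset.card_lt_card <| Finset.ssubset_iff_of_subset
    (Finset.monotone_filter_right _ fun _ _ hc => hc.trans h) |>.2 ⟨a, by simpa using h, by simp⟩

theorem rank_lt_card (a : α) : rank a < Fintype.card α :=
  Finset.card_lt_card <| Finset.filter_ssubset.2 ⟨a, Finset.mem_univ a, lt_irrefl a⟩

/-- The number that represents a label in the array of labels. -/
def labelRank : WithBot α → ℕ
  | ⊥ => 0
  | (a : α) => rank a + 1

theorem labelRank_strictMono : StrictMono (labelRank : WithBot α → ℕ) :=
  WithBot.strictMono_iff.2
    ⟨fun _ _ h => Nat.succ_lt_succ (rank_strictMono h), fun _ => Nat.succ_pos _⟩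

end Rank

namespace Automaton.IsStandard

variable {Q α : Type*} {M : Automaton Q α}

theorem card_alphabet_le [Fintype α] (hM : M.IsStandard) : Fintype.card α ≤ M.E.card := by
  choose f g h using hM.effective
  exact Finset.card_le_card_of_injOn (s := Finset.univ) (fun a => (f a, g a, a)) (fun a _ => h a)
    fun a _ b _ hab => congrArg (·.2.2) hab

theorem card_edges_le [Fintype Q] (hM : M.IsStandard) :
    M.E.card ≤ Fintype.card Q * Fintype.card Q := by
  rw [← Fintype.card_prod]
  refine Finset.card_le_card_of_injOn (t := Finset.univ) (fun e => (e.1, e.2.1))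
    (fun _ _ => Finset.mem_univ _) ?_
  rintro ⟨u, v, a⟩ h ⟨u', v', a'⟩ h' heq
  obtain ⟨rfl, rfl⟩ := Prod.mk.inj heq
  rw [hM.input_consistent u u v a a' h h']

end Automaton.IsStandard

namespace Presentation

variable {Q α : Type*} [Fintype Q] {M : Automaton Q α} (D : Presentation M)

theorem coe_edges : (D.edges : Multiset (Q × Q × α)) = M.E.val :=
  (Multiset.Nodup.ext (Multiset.coe_nodup.2 D.nodup) M.E.nodup).2 fun e => D.mem_edges e

theorem length_edges : D.edges.length = M.E.card := by
  rw [Finset.card_def, ← D.coe_edges, Multiset.coe_card]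

theorem exists_getElem_eq {e : Q × Q × α} (he : e ∈ M.E) :
    ∃ (i : ℕ) (hi : i < D.edges.length), D.edges[i] = e :=
  List.getElem_of_mem ((D.mem_edges e).2 he)

theorem idx_inj {u v : Q} : (D.idx u : ℕ) = D.idx v ↔ u = v :=
  Fin.val_inj.trans D.idx.apply_eq_iff_eq

theorem idx_injective : Function.Injective fun v => (D.idx v : ℕ) := fun _ _ => D.idx_inj.1

theorem exists_idx_eq {u : ℕ} (hu : u < Fintype.card Q) : ∃ x, (D.idx x : ℕ) = u :=
  ⟨D.idx.symm ⟨u, hu⟩, by simp⟩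

variable [Fintype α] [LinearOrder α]

open Classical in
theorem getElem?_code (i : ℕ) : D.code[4 + i]? =
    (D.edges.flatMap (fun e => [(D.idx e.1 : ℕ), (D.idx e.2.1 : ℕ), rank e.2.2]) ++
      List.ofFn (fun i => if D.idx.symm i ∈ M.F then 1 else 0))[i]? := by
  rw [code, List.append_assoc, List.getElem?_append_right (by simp)]
  simp

theorem getD_code_edge {i : ℕ} (hi : i < D.edges.length) :
    D.code.getD (4 + 3 * i) 0 = D.idx D.edges[i].1 ∧
      D.code.getD (5 + 3 * i) 0 = D.idx D.edges[i].2.1 ∧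
      D.code.getD (6 + 3 * i) 0 = rank D.edges[i].2.2 := by
  have hcode {j : ℕ} (hj : j < 3) : D.code[4 + (3 * i + j)]? =
      [(D.idx D.edges[i].1 : ℕ), (D.idx D.edges[i].2.1 : ℕ), rank D.edges[i].2.2][j]? := by
    rw [getElem?_code]
    exact getElem?_flatMap_append (k := 3) (fun _ => rfl) _ _ hi hj
  simp only [List.getD_eq_getElem?_getD]
  refine ⟨?_, ?_, ?_⟩
  · rw [← add_zero (3 * i), hcode (by omega)]
    rfl
  · rw [show 5 + 3 * i = 4 + (3 * i + 1) by omega, hcode (by omega)]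
    rfl
  · rw [show 6 + 3 * i = 4 + (3 * i + 2) by omega, hcode (by omega)]
    rfl

open Classical in
theorem getD_code_final (v : Q) :
    D.code.getD (4 + 3 * D.edges.length + D.idx v) 0 = if v ∈ M.F then 1 else 0 := by
  rw [List.getD_eq_getElem?_getD, add_assoc, getElem?_code, List.getElem?_append_right] <;>
    simp [List.length_flatMap, mul_comm]

open Classical in
/-- The input as a family of functions on the numbers of the states and of the edges. -/
noncomputable def input (hM : M.IsStandard) : Input where
  n := Fintype.card Q
  m := D.edges.length
  src i := D.code.getD (4 + 3 * i) 0
  dst i := D.code.getD (5 + 3 * i) 0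
  lab i := D.code.getD (6 + 3 * i) 0
  lam := Function.extend (fun v => (D.idx v : ℕ)) (fun v => labelRank (M.lam v)) 0
  fin i := D.code.getD (4 + 3 * D.edges.length + i) 0
  n_pos := Fintype.card_pos_iff.2 ⟨M.s⟩
  src_lt i hi := by
    rw [(D.getD_code_edge hi).1]
    exact (D.idx _).2
  dst_lt i hi := by
    rw [(D.getD_code_edge hi).2.1]
    exact (D.idx _).2
  lab_lt i hi := by
    rw [(D.getD_code_edge hi).2.2, length_edges]
    exact (rank_lt_card _).trans_le hM.card_alphabet_le
  lam_dst i hi := by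
    rw [(D.getD_code_edge hi).2.1, (D.getD_code_edge hi).2.2,
      D.idx_injective.extend_apply]
    have hE : (D.edges[i].1, D.edges[i].2.1, D.edges[i].2.2) ∈ M.E :=
      (D.mem_edges _).1 (List.getElem_mem hi)
    rw [hM.lam_eq hE]
    rfl
  lam_eq_zero v hv h := by
    obtain ⟨v, rfl⟩ := D.exists_idx_eq hv
    rw [D.idx_injective.extend_apply]
    suffices v = M.s by rw [this, hM.lam_s]; rfl
    by_contra hs
    obtain ⟨u, a, hE⟩ := hM.exists_edge hs
    obtain ⟨i, hi, heq⟩ := D.exists_getElem_eq hE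
    exact h i hi (by rw [(D.getD_code_edge hi).2.1, heq])

section Code

variable (hM : M.IsStandard)

theorem input_lam (v : Q) : (D.input hM).lam (D.idx v) = labelRank (M.lam v) :=
  D.idx_injective.extend_apply (fun v => labelRank (M.lam v)) 0 v

theorem edge_iff {u v : Q} : M.Edge u v ↔ ∃ i < (D.input hM).m,
    (D.input hM).src i = D.idx u ∧ (D.input hM).dst i = D.idx v := by
  constructor
  · rintro ⟨a, hE⟩
    obtain ⟨i, hi, heq⟩ := D.exists_getElem_eq hE
    obtain ⟨hsrc, hdst, -⟩ := D.getD_code_edge hi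
    rw [heq] at hsrc hdst
    exact ⟨i, hi, hsrc, hdst⟩
  · rintro ⟨i, hi, hu, hv⟩
    obtain ⟨hsrc, hdst, -⟩ := D.getD_code_edge hi
    obtain rfl := D.idx_inj.1 (hsrc.symm.trans hu)
    obtain rfl := D.idx_inj.1 (hdst.symm.trans hv)
    exact ⟨_, (D.mem_edges _).1 (List.getElem_mem hi)⟩

theorem start_ofInput : (D.input hM).Start (Store.ofInput D.code) where
  n := by simp [Store.ofInput, code, input]
  m := by simp [Store.ofInput, code, input, D.length_edges]
  src _ _ := rfl
  dst _ _ := rfl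
  lab _ _ := rfl
  fin _ _ := rfl
  var _ := rfl
  arr A hA _ := if_neg hA

theorem spacing_code : spacing D.code = (D.input hM).size := by
  simp [spacing, code, Input.size, input, D.length_edges]

theorem length_code_le : D.code.length ≤ (D.input hM).size := by
  have hs := (D.input hM).size_eq
  have hn : (D.input hM).n = Fintype.card Q := rfl
  have hm : (D.input hM).m = D.edges.length := rfl
  have hlen : D.code.length = 4 + 3 * D.edges.length + Fintype.card Q := by
    simp [code, List.length_flatMap]
    ring
  omega

theorem code_lt (i : ℕ) : D.code.getD i 0 < (D.input hM).size := by
  classical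
  have hs := (D.input hM).size_eq
  have hQ : Fintype.card Q < (D.input hM).size := by
    have hn : (D.input hM).n = Fintype.card Q := rfl
    omega
  have hE : M.E.card < (D.input hM).size := by
    have hm : (D.input hM).m = M.E.card := D.length_edges
    omega
  have hidx (v : Q) : (D.idx v : ℕ) < (D.input hM).size := (D.idx v).2.trans hQ
  have hα : Fintype.card α < (D.input hM).size := hM.card_alphabet_le.trans_lt hE
  have hall : ∀ x ∈ D.code, x < (D.input hM).size := by
    simp only [code, List.mem_append, List.mem_cons, List.not_mem_nil, or_false,
      List.mem_flatMap, List.mem_ofFn]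
    rintro x (((rfl | rfl | rfl | rfl) | ⟨e, -, (rfl | rfl | rfl)⟩) | ⟨j, rfl⟩)
    · exact hQ
    · exact hE
    · exact hα
    · exact hidx M.s
    · exact hidx e.1
    · exact hidx e.2.1
    · exact (rank_lt_card e.2.2).trans hα
    · split_ifs <;> omega
  by_cases hi : i < D.code.length
  · rw [List.getD_eq_getElem _ _ hi]
    exact hall _ (List.getElem_mem hi)
  · rw [List.getD_eq_default _ _ (by omega)]
    omega

theorem wordBound {w : ℕ} (hw : 160 * (Nat.log 2 (Fintype.card Q) + 1) ≤ w) :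
    WordBound w (D.input hM).size where
  le := by
    have hs := (D.input hM).size_eq
    omega
  pow_le := by
    have hsum : 2 * (Fintype.card Q + D.edges.length + 4) ≤ (Fintype.card Q + 1) ^ 5 := by
      have hE := hM.card_edges_le
      have hpos : 0 < Fintype.card Q := Fintype.card_pos_iff.2 ⟨M.s⟩
      rw [D.length_edges]
      obtain ⟨k, hk⟩ := Nat.exists_eq_add_of_lt hpos
      rw [hk] at hE ⊢
      ring_nf at hE ⊢
      nlinarith [Nat.zero_le (k ^ 3), Nat.zero_le (k ^ 4), Nat.zero_le (k ^ 5)]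
    calc (D.input hM).size ^ 16
        = ((2 * (Fintype.card Q + D.edges.length + 4)) ^ 2) ^ 16 := rfl
      _ ≤ (((Fintype.card Q + 1) ^ 5) ^ 2) ^ 16 := by gcongr
      _ = (Fintype.card Q + 1) ^ 160 := by ring
      _ ≤ (2 ^ (Nat.log 2 (Fintype.card Q) + 1)) ^ 160 := by
        gcongr
        exact Nat.lt_pow_succ_log_self (by omega) _
      _ = 2 ^ (160 * (Nat.log 2 (Fintype.card Q) + 1)) := by rw [← pow_mul, mul_comm]
      _ ≤ 2 ^ w := Nat.pow_le_pow_right (by omega) hw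

end Code

end Presentation

namespace Presentation

variable {Q α : Type*} [Fintype Q] [LinearOrder α] {M : Automaton Q α} (D : Presentation M)

/-- The strict part of the maximal order, on the numbers of the states. -/
def below (u v : ℕ) : Prop :=
  ∃ x y : Q, D.idx x = u ∧ D.idx y = v ∧ ¬ M.NotBelow x y

theorem below_idx {u v : Q} : D.below (D.idx u) (D.idx v) ↔ ¬ M.NotBelow u v := by
  refine ⟨?_, fun h => ⟨u, v, rfl, rfl, h⟩⟩
  rintro ⟨x, y, hx, hy, h⟩
  rwa [← D.idx_inj.1 hx, ← D.idx_inj.1 hy]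

theorem maxOrder_iff {u v : Q} :
    M.maxOrder u v ↔ (D.idx u : ℕ) = D.idx v ∨ D.below (D.idx u) (D.idx v) := by
  rw [below_idx, idx_inj, Automaton.maxOrder]

theorem intervalOrder_below (hM : M.IsStandard) : IntervalOrder (Fintype.card Q) D.below where
  left_lt := by
    rintro _ v ⟨x, y, rfl, -, -⟩
    exact (D.idx x).2
  irrefl := by
    rintro _ ⟨x, y, hx, hy, h⟩
    exact h (D.idx_inj.1 (hx.trans hy.symm) ▸ .refl x)
  interval := by
    rintro _ _ _ _ ⟨u, v, rfl, rfl, huv⟩ ⟨x, y, rfl, rfl, hxy⟩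
    rw [below_idx, below_idx]
    by_contra! h
    exact (h.1.interval hM h.2).elim huv hxy

section Reached

variable [Fintype α] {hM : M.IsStandard}

theorem reached_of_notBelow {u v : Q} (h : M.NotBelow u v) :
    (D.input hM).Reached (D.idx u * Fintype.card Q + D.idx v) := by
  induction h with
  | refl u => exact .diag (D.idx u).2
  | @lam u v h =>
    refine .lam (D.idx u).2 (D.idx v).2 ?_
    rw [input_lam, input_lam]
    exact labelRank_strictMono h
  | @step u' u v' v hu hv hlam _ ih =>
    obtain ⟨e, he, hsrc, hdst⟩ := (D.edge_iff hM).1 hu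
    obtain ⟨f, hf, hsrc', hdst'⟩ := (D.edge_iff hM).1 hv
    rw [← hdst, ← hdst']
    rw [← hsrc, ← hsrc'] at ih
    exact .step he hf (by rw [hdst, hdst', input_lam, input_lam, hlam]) ih

theorem notBelow_of_reached {z : ℕ} (h : (D.input hM).Reached z) {u v : Q}
    (hz : z = D.idx u * Fintype.card Q + D.idx v) : M.NotBelow u v := by
  have hmono : StrictMono (labelRank : WithBot α → ℕ) := labelRank_strictMono
  induction h generalizing u v with
  | lam _ hv' h =>
    obtain ⟨rfl, rfl⟩ := (mul_add_inj hv' (D.idx v).2).1 hz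
    rw [input_lam, input_lam] at h
    exact .lam (hmono.lt_iff_lt.1 h)
  | diag hu' =>
    obtain ⟨hu, hv⟩ := (mul_add_inj hu' (D.idx v).2).1 hz
    exact D.idx_inj.1 (hu.symm.trans hv) ▸ .refl u
  | @step e f he hf hlam _ ih =>
    obtain ⟨hu, hv⟩ := (mul_add_inj ((D.input hM).dst_lt f hf) (D.idx v).2).1 hz
    obtain ⟨u', hu'⟩ := D.exists_idx_eq ((D.input hM).src_lt e he)
    obtain ⟨v', hv'⟩ := D.exists_idx_eq ((D.input hM).src_lt f hf)
    rw [hu, hv, input_lam, input_lam] at hlam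
    refine .step ((D.edge_iff hM).2 ⟨e, he, hu'.symm, hu⟩)
      ((D.edge_iff hM).2 ⟨f, hf, hv'.symm, hv⟩) (hmono.injective hlam) (ih ?_)
    rw [hu', hv']
    rfl

theorem below_iff_not_reached {u v : ℕ} (hu : u < Fintype.card Q) (hv : v < Fintype.card Q) :
    D.below u v ↔ ¬ (D.input hM).Reached (u * Fintype.card Q + v) := by
  obtain ⟨u, rfl⟩ := D.exists_idx_eq hu
  obtain ⟨v, rfl⟩ := D.exists_idx_eq hv
  rw [below_idx, not_iff_not]
  exact ⟨D.reached_of_notBelow, fun h => D.notBelow_of_reached h rfl⟩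

end Reached

section Chains

variable {ord chain : ℕ → ℕ} {p : ℕ}

theorem ord_zero_eq (hM : M.IsStandard) (hS : Sorted (Fintype.card Q) D.below ord) :
    ord 0 = D.idx M.s := by
  have hpos : 0 < Fintype.card Q := Fintype.card_pos_iff.2 ⟨M.s⟩
  obtain ⟨v, hv⟩ := D.exists_idx_eq (hS.ord_lt 0 hpos)
  rw [← hv, idx_inj]
  by_contra hne
  have hbelow : D.below (D.idx M.s) (D.idx v) :=
    D.below_idx.2 fun h => h.lam_le.not_gt (hM.lam_s_lt hne)
  obtain ⟨j, hj, hs⟩ := (hS.mem _ (D.idx M.s).2).1 trivial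
  have hle := hS.numPreds_le (Nat.zero_le j) hj
  rw [← hv, hs] at hle
  exact hle.not_gt ((D.intervalOrder_below hM).numPreds_lt_of_lt hbelow)

theorem isChainDecomposition_of_chains (hS : Sorted (Fintype.card Q) D.below ord)
    (hC : Chains (Fintype.card Q) D.below ord (Fintype.card Q) p chain) {chain' : Q → Fin p}
    (hchain : ∀ v, chain (D.idx v) = chain' v) : IsChainDecomposition M.maxOrder chain' := by
  refine ⟨fun c => ?_, ?_⟩
  · obtain ⟨j, hj, hc⟩ := hC.surj c c.2
    obtain ⟨v, hv⟩ := D.exists_idx_eq (hS.ord_lt j hj)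
    exact ⟨v, Fin.ext (by rw [← hchain, hv, hc])⟩
  · rintro _ u rfl v hv -
    have heq : chain (D.idx u) = chain (D.idx v) := by rw [hchain, hchain, hv]
    obtain ⟨i, hi, hu⟩ := (hS.mem _ (D.idx u).2).1 trivial
    obtain ⟨j, hj, hv⟩ := (hS.mem _ (D.idx v).2).1 trivial
    rw [maxOrder_iff D, maxOrder_iff D, ← hu, ← hv]
    rw [← hu, ← hv] at heq
    rcases lt_trichotomy i j with hij | rfl | hij
    · exact .inl (.inr (hC.asc i j hij hj heq))
    · exact .inl (.inl rfl)
    · exact .inr (.inr (hC.asc j i hij hi heq.symm))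

theorem isSmallestChainDecomposition_of_chains (hS : Sorted (Fintype.card Q) D.below ord)
    (hC : Chains (Fintype.card Q) D.below ord (Fintype.card Q) p chain) {chain' : Q → Fin p}
    (hchain : ∀ v, chain (D.idx v) = chain' v) :
    IsSmallestChainDecomposition M.maxOrder chain' := by
  obtain ⟨f, hf, hanti⟩ := hC.antichain
  choose g hg using fun c : Fin p => D.exists_idx_eq (hf c c.2)
  refine (D.isChainDecomposition_of_chains hS hC hchain).isSmallest_of_antichain (f := g) ?_
  intro c c' hne
  obtain ⟨hfne, hlt⟩ := hanti c c.2 c' c'.2 (Fin.val_ne_of_ne hne)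
  rw [← hg, ← hg] at hfne hlt
  exact ⟨fun h => hfne (D.idx_inj.2 h), fun h => (D.maxOrder_iff.1 h).elim hfne hlt⟩

theorem exists_isSmallestChainDecomposition (hM : M.IsStandard) (hD : M.IsDeterministic)
    (hS : Sorted (Fintype.card Q) D.below ord)
    (hC : Chains (Fintype.card Q) D.below ord (Fintype.card Q) p chain) :
    p = M.width ∧ ∃ chain' : Q → Fin M.width, IsSmallestChainDecomposition M.maxOrder chain' ∧
      (∀ v, chain (D.idx v) = chain' v) ∧ (chain' M.s : ℕ) = 0 := by
  have hp (v : Q) : chain (D.idx v) < p := by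
    obtain ⟨i, hi, hv⟩ := (hS.mem _ (D.idx v).2).1 trivial
    exact hv ▸ hC.chain_lt i hi
  have hsm := D.isSmallestChainDecomposition_of_chains hS hC
    (chain' := fun v => ⟨chain (D.idx v), hp v⟩) fun _ => rfl
  obtain rfl := Automaton.width_eq_of_isSmallestChainDecomposition hM hD hsm
  refine ⟨rfl, _, hsm, fun _ => rfl, ?_⟩
  have hfirst := hC.first (Fintype.card_pos_iff.2 ⟨M.s⟩)
  rwa [D.ord_zero_eq hM hS] at hfirst

end Chains

end Presentation

/-! ## The outputs -/

theorem map_filter_range {β γ : Type*} (l : List β) {q : ℕ → Bool} {p : β → Bool} {g : ℕ → γ}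
    {f : β → γ} (hq : ∀ (i : ℕ) (hi : i < l.length), q i = p l[i])
    (hg : ∀ (i : ℕ) (hi : i < l.length), g i = f l[i]) :
    ((List.range l.length).filter q).map g = (l.filter p).map f := by
  conv_rhs => rw [← List.map_get_finRange l]
  simp only [← List.map_coe_finRange_eq_range, List.filter_map, List.map_map]
  congr 1
  · exact funext fun i => hg i i.2
  · exact congrArg₂ _ (funext fun i => hq i i.2) rfl

theorem range_flatMap {β : Type*} (n : ℕ) (g : ℕ → List β) :
    (List.range n).flatMap g = (List.finRange n).flatMap fun i : Fin n => g i := by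
  rw [← List.map_coe_finRange_eq_range, List.flatMap_map]

theorem range_map {β : Type*} (n : ℕ) (g : ℕ → β) :
    (List.range n).map g = List.ofFn fun i : Fin n => g i := by
  rw [← List.map_coe_finRange_eq_range, List.map_map, List.ofFn_eq_map]
  rfl

namespace Presentation

variable {Q α : Type*} [Fintype Q] {M : Automaton Q α} (D : Presentation M)

open Classical in
/-- The Burrows-Wheeler transform for a given list `v` of the states; the edges at a state come in
the order of the presentation. -/
noncomputable def bwt {p : ℕ} (chain : Q → Fin p) (v : Fin (Fintype.card Q) → Q) :
    BWT (Fintype.card Q) p α where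
  outs i := (D.edges.filter fun e => e.1 = v i).map fun e => (chain e.2.1, e.2.2)
  ins i := (D.edges.filter fun e => e.2.1 = v i).map fun e => chain e.1
  final i := v i ∈ M.F

variable {p : ℕ} {chain : ℕ → ℕ} {chain' : Q → Fin p}

variable [LinearOrder α]

theorem isOf_bwt {v : Fin (Fintype.card Q) → Q} (hv : Function.Injective v)
    (hsorted : ∀ i j, i < j → chain' (v i) < chain' (v j) ∨
      (chain' (v i) = chain' (v j) ∧ M.maxOrder (v i) (v j) ∧ v i ≠ v j)) :
    (D.bwt chain' v).IsOf M M.maxOrder chain' := by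
  refine ⟨.ofBijective v ((Fintype.bijective_iff_injective_and_card v).2 ⟨hv, by simp⟩),
    hsorted, fun i => ⟨?_, ?_, ?_⟩⟩
  · rw [Finset.filter_val, ← D.coe_edges, Multiset.filter_coe, Multiset.map_coe]
    rfl
  · rw [Finset.filter_val, ← D.coe_edges, Multiset.filter_coe, Multiset.map_coe]
    rfl
  · simp [bwt]

variable [Fintype α] (hM : M.IsStandard)

theorem orderList_eq (hchain : ∀ v, chain (D.idx v) = chain' v) :
    (D.input hM).orderList D.below p chain = D.codeRel M.maxOrder ++ D.codeChain chain' := by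
  classical
  have hn : (D.input hM).n = Fintype.card Q := rfl
  rw [Input.orderList, codeRel, codeChain, List.append_assoc, hn]
  congr 1
  · rw [range_flatMap, List.flatMap_def, List.ofFn_eq_map]
    simp [range_map, D.maxOrder_iff]
  · simp [range_map, ← hchain]

section Index

variable {listed : ℕ → ℕ} {v : Fin (Fintype.card Q) → Q}
  (hlisted : ∀ i : Fin (Fintype.card Q), listed i = D.idx (v i))
include hlisted

open Classical in
theorem edgeLists_eq {key : ℕ → ℕ} {key' : Q × Q × α → Q} {g : ℕ → List ℕ}
    {g' : Q × Q × α → List ℕ}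
    (hkey : ∀ (i : ℕ) (hi : i < D.edges.length), key i = D.idx (key' D.edges[i]))
    (hg : ∀ (i : ℕ) (hi : i < D.edges.length), g i = g' D.edges[i]) :
    (D.input hM).edgeLists listed key g = (List.finRange (Fintype.card Q)).flatMap fun i =>
      (D.edges.filter fun e => key' e = v i).length ::
        (D.edges.filter fun e => key' e = v i).flatMap g' := by
  have hmap (i : Fin (Fintype.card Q)) : ((D.input hM).edgesAt key (listed i)).map g =
      (D.edges.filter fun e => key' e = v i).map g' :=
    map_filter_range D.edges (fun j hj => by simp only [hlisted, hkey j hj, D.idx_inj]) hg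
  rw [Input.edgeLists, show (D.input hM).n = Fintype.card Q from rfl, range_flatMap]
  congr 1
  funext i
  rw [List.flatMap_def, hmap, ← List.flatMap_def]
  congr 1
  simpa using congrArg List.length (hmap i)

theorem indexList_eq (hchain : ∀ v, chain (D.idx v) = chain' v) :
    (D.input hM).indexList p chain listed = (D.bwt chain' v).code := by
  classical
  have houts := D.edgeLists_eq hM hlisted (key := (D.input hM).src) (key' := fun e => e.1)
    (g := fun e => [chain ((D.input hM).dst e), (D.input hM).lab e])
    (g' := fun e => [(chain' e.2.1 : ℕ), rank e.2.2])
    (fun i hi => (D.getD_code_edge hi).1)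
    (fun i hi => by simp only [input, D.getD_code_edge hi, hchain])
  have hins := D.edgeLists_eq hM hlisted (key := (D.input hM).dst) (key' := fun e => e.2.1)
    (g := fun e => [chain ((D.input hM).src e)]) (g' := fun e => [(chain' e.1 : ℕ)])
    (fun i hi => (D.getD_code_edge hi).2.1)
    (fun i hi => by simp only [input, D.getD_code_edge hi, hchain])
  have hfinal (i : Fin (Fintype.card Q)) :
      (D.input hM).fin (listed i) = ((D.bwt chain' v).final i).toNat := by
    have hfin := D.getD_code_final (v i)
    by_cases hF : v i ∈ M.F <;> simpa [hlisted, input, bwt, hF] using hfin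
  rw [Input.indexList, houts, hins, show (D.input hM).n = Fintype.card Q from rfl, range_map]
  simp [BWT.code, bwt, List.ofFn_eq_map, List.flatMap_map, ← List.map_eq_flatMap, hfinal,
    Function.comp_def]

end Index

end Presentation

/-- The program that computes the maximal order and a smallest chain decomposition. -/
def orderProg : Prog := .seq prologue (Stmt.seq solve emitOrder).compile

/-- The program that computes the Burrows-Wheeler transform. -/
def indexProg : Prog := .seq prologue (Stmt.seq solve (.seq listStates emitIndex)).compile

namespace Presentation

variable {Q α : Type*} [Fintype Q] [Fintype α] [LinearOrder α] {M : Automaton Q α}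
  (D : Presentation M) (hM : M.IsStandard) {w : ℕ}
include hM

theorem triple_solve [WordBound w (D.input hM).size] :
    Triple w (D.input hM).size solve (Store.ofInput D.code)
      (3000 * (M.E.card * M.E.card + Fintype.card Q * Fintype.card Q))
      ((D.input hM).Solved D.below) := by
  rw [← D.length_edges]
  exact Input.triple_solve (D.start_ofInput hM) (D.intervalOrder_below hM)
    fun u hu v hv => D.below_iff_not_reached hu hv

theorem triple_emitOrder [WordBound w (D.input hM).size] (hD : M.IsDeterministic) {σ : Store}
    (hσ : (D.input hM).Solved D.below σ) :
    Triple w (D.input hM).size emitOrder σ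
      (4000 * (M.E.card * M.E.card + Fintype.card Q * Fintype.card Q)) fun τ => ∃ σ₀ l,
        (∃ chain : Q → Fin M.width, IsSmallestChainDecomposition M.maxOrder chain ∧
          l = D.codeRel M.maxOrder ++ D.codeChain chain) ∧ Emitted σ₀ l τ := by
  obtain ⟨hp, chain, hsmallest, hchain, -⟩ :=
    D.exists_isSmallestChainDecomposition hM hD hσ.sorted hσ.chains
  rw [← D.length_edges]
  refine (Input.triple_emitOrder hσ).mono le_rfl fun τ _ hτ => ?_
  rw [hp, D.orderList_eq hM hchain] at hτ
  exact ⟨σ, _, ⟨chain, hsmallest, rfl⟩, hτ⟩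

theorem computes_orderProg (hD : M.IsDeterministic)
    (hw : 160 * (Nat.log 2 (Fintype.card Q) + 1) ≤ w) :
    ∃ (t : ℕ) (chain : Q → Fin M.width), IsSmallestChainDecomposition M.maxOrder chain ∧
      orderProg.Computes w D.code t (D.codeRel M.maxOrder ++ D.codeChain chain) ∧
      t ≤ 7000 * (M.E.card * M.E.card + Fintype.card Q * Fintype.card Q) + 8 := by
  have := D.wordBound hM hw
  obtain ⟨t, _, ⟨chain, hchain, rfl⟩, hrun, ht⟩ := Triple.computes (D.spacing_code hM)
    (D.length_code_le hM) (D.code_lt hM) <|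
    (D.triple_solve (w := w) hM).seq _ _ _ (by rw [← add_mul])
      fun σ _ hσ => D.triple_emitOrder hM hD hσ
  exact ⟨t, chain, hchain, hrun, ht⟩

theorem exists_bwt_of_listing {σ : Store} {chain : Q → Fin M.width} {listed : ℕ → ℕ}
    (hchain : ∀ v, σ.arr .chain (D.idx v) = chain v)
    (hL : Listing (Fintype.card Q) (ChainLT D.below (σ.arr .chain)) (fun _ => True)
      (Fintype.card Q) listed) :
    ∃ B : BWT (Fintype.card Q) M.width α, B.IsOf M M.maxOrder chain ∧
      (D.input hM).indexList M.width (σ.arr .chain) listed = B.code := by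
  have hirrefl : ∀ u, ¬ D.below u u := (D.intervalOrder_below hM).irrefl
  choose v hv using fun i : Fin (Fintype.card Q) => D.exists_idx_eq (hL.ord_lt i i.2)
  refine ⟨D.bwt chain v, D.isOf_bwt (fun i j hij => ?_) fun i j hij => ?_,
    D.indexList_eq hM (fun i => (hv i).symm) hchain⟩
  · have hlisted : listed i = listed j := by rw [← hv, ← hv, hij]
    exact Fin.ext (hL.inj (fun u => by simp [ChainLT, hirrefl]) i.2 j.2 hlisted)
  · have hlt := hL.mono i j hij j.2
    rw [← hv, ← hv, ChainLT, hchain, hchain] at hlt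
    exact hlt.imp_right fun ⟨heq, hbelow⟩ => ⟨Fin.ext heq, D.maxOrder_iff.2 (.inr hbelow),
      fun h => hirrefl _ (h ▸ hbelow)⟩

theorem triple_listStates_emitIndex [WordBound w (D.input hM).size] (hD : M.IsDeterministic)
    {σ : Store} (hσ : (D.input hM).Solved D.below σ) :
    Triple w (D.input hM).size (.seq listStates emitIndex) σ
      (9000 * (Fintype.card Q + M.E.card) ^ 2) fun τ => ∃ σ₀ l,
        (∃ (chain : Q → Fin M.width) (B : BWT (Fintype.card Q) M.width α),
          IsSmallestChainDecomposition M.maxOrder chain ∧ (chain M.s : ℕ) = 0 ∧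
          B.IsOf M M.maxOrder chain ∧ l = B.code) ∧ Emitted σ₀ l τ := by
  obtain ⟨hp, chain, hsmallest, hchain, hs⟩ :=
    D.exists_isSmallestChainDecomposition hM hD hσ.sorted hσ.chains
  rw [← D.length_edges]
  refine .seq _ _ _ ?_ (Input.triple_listStates (D.intervalOrder_below hM) hσ)
    fun ρ hF hρ => (Input.triple_emitIndex (hσ.loaded.of_frame hF) hρ.ord_lt).mono le_rfl ?_
  · have hn : Fintype.card Q ≤ Fintype.card Q * Fintype.card Q := Nat.le_mul_self _
    change 1000 * (Fintype.card Q * Fintype.card Q) +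
      4000 * (Fintype.card Q * D.edges.length + Fintype.card Q) ≤ _
    nlinarith
  intro τ _ hτ
  obtain ⟨B, hB, hcode⟩ := D.exists_bwt_of_listing hM hchain hρ
  rw [hF.var _ rfl, hF.arr _ rfl, hp, hcode] at hτ
  exact ⟨ρ, _, ⟨chain, B, hsmallest, hs, hB, rfl⟩, hτ⟩

theorem computes_indexProg (hD : M.IsDeterministic)
    (hw : 160 * (Nat.log 2 (Fintype.card Q) + 1) ≤ w) :
    ∃ (t : ℕ) (chain : Q → Fin M.width) (B : BWT (Fintype.card Q) M.width α),
      IsSmallestChainDecomposition M.maxOrder chain ∧ (chain M.s : ℕ) = 0 ∧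
      B.IsOf M M.maxOrder chain ∧ indexProg.Computes w D.code t B.code ∧
      t ≤ 12000 * (Fintype.card Q + M.E.card) ^ 2 + 8 := by
  have := D.wordBound hM hw
  obtain ⟨t, _, ⟨chain, B, hchain, hs, hB, rfl⟩, hrun, ht⟩ := Triple.computes (D.spacing_code hM)
    (D.length_code_le hM) (D.code_lt hM) <|
    (D.triple_solve (w := w) hM).seq _ _ _
      (T'' := 12000 * (Fintype.card Q + M.E.card) ^ 2) (by nlinarith)
      fun σ _ hσ => D.triple_listStates_emitIndex hM hD hσ
  exact ⟨t, chain, B, hchain, hs, hB, hrun, ht⟩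

end Presentation

theorem sq_le_rpow {x : ℝ} (hx : 1 ≤ x) : x ^ 2 ≤ x ^ (5 / 2 : ℝ) := by
  rw [← Real.rpow_natCast]
  exact Real.rpow_le_rpow_of_exponent_le hx (by norm_num)

theorem time_le_sq_add_rpow {t m n : ℕ} (hn : 0 < n) (ht : t ≤ 7000 * (m * m + n * n) + 8) :
    (t : ℝ) ≤ 7008 * ((m : ℝ) ^ 2 + (n : ℝ) ^ (5 / 2 : ℝ)) := by
  have hn' : (1 : ℝ) ≤ n := by exact_mod_cast hn
  have hrpow := sq_le_rpow hn'
  have ht' : (t : ℝ) ≤ 7000 * (m * m + n * n) + 8 := by exact_mod_cast ht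
  nlinarith [sq_nonneg (m : ℝ)]

end CoLex

theorem mainTheorem8 :
    -- the maximal order and a smallest chain decomposition, in time `O(|E|² + |Q|^{5/2})`
    (∃ (P : CoLex.Prog) (C : ℝ) (κ : ℕ),
      ∀ (Q α : Type*) [Fintype Q] [Fintype α] [LinearOrder α] (M : CoLex.Automaton Q α),
        M.IsStandard → M.IsDeterministic →
        ∃ le : Q → Q → Prop,
          (M.IsMaximalCoLex le ∧ ∀ le₁ : Q → Q → Prop, M.IsMaximalCoLex le₁ → le₁ = le) ∧
          ∀ (D : CoLex.Presentation M) (w : ℕ), κ * (Nat.log 2 (Fintype.card Q) + 1) ≤ w →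
            ∃ (t : ℕ) (chain : Q → Fin M.width),
              CoLex.IsSmallestChainDecomposition le chain ∧
              P.Computes w D.code t (D.codeRel le ++ D.codeChain chain) ∧
              (t : ℝ) ≤ C * ((M.E.card : ℝ) ^ 2 + (Fintype.card Q : ℝ) ^ (5 / 2 : ℝ))) ∧
    -- the index with optimal width, in polynomial time
    (∃ (P : CoLex.Prog) (C k κ : ℕ),
      ∀ (Q α : Type*) [Fintype Q] [Fintype α] [LinearOrder α] (M : CoLex.Automaton Q α),
        M.IsStandard → M.IsDeterministic →
        ∀ (D : CoLex.Presentation M) (w : ℕ), κ * (Nat.log 2 (Fintype.card Q) + 1) ≤ w →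
          ∃ (le : Q → Q → Prop) (t : ℕ) (chain : Q → Fin M.width)
            (B : CoLex.BWT (Fintype.card Q) M.width α),
            M.IsMaximalCoLex le ∧ CoLex.IsSmallestChainDecomposition le chain ∧
            (chain M.s : ℕ) = 0 ∧ B.IsOf M le chain ∧
            P.Computes w D.code t B.code ∧
            t ≤ C * (Fintype.card Q + M.E.card) ^ k) := by
  constructor
  · refine ⟨CoLex.orderProg, 7008, 160, fun Q α _ _ _ M hM hD => ?_⟩
    refine ⟨M.maxOrder, ⟨CoLex.Automaton.maxOrder_isMaximalCoLex hM hD,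
      fun le hle => hle.eq_maxOrder hM hD⟩, fun D w hw => ?_⟩
    obtain ⟨t, chain, hchain, hrun, ht⟩ := D.computes_orderProg hM hD hw
    have hn : 0 < Fintype.card Q := Fintype.card_pos_iff.2 ⟨M.s⟩
    exact ⟨t, chain, hchain, hrun, CoLex.time_le_sq_add_rpow hn ht⟩
  · refine ⟨CoLex.indexProg, 12008, 2, 160, fun Q α _ _ _ M hM hD D w hw => ?_⟩
    obtain ⟨t, chain, B, hchain, hs, hB, hrun, ht⟩ := D.computes_indexProg hM hD hw
    have hn : 0 < Fintype.card Q := Fintype.card_pos_iff.2 ⟨M.s⟩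
    have hpos : 0 < (Fintype.card Q + M.E.card) ^ 2 := by positivity
    exact ⟨M.maxOrder, t, chain, B, CoLex.Automaton.maxOrder_isMaximalCoLex hM hD, hchain, hs, hB,
      hrun, by omega⟩
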